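/- Let $t>1$, $R>0$, $h_+=\frac{3+\sqrt{9+8t}}{4}$, and $f(h)=-\frac{h^2}{2}-\frac{h_+}{t}h^3+\frac{h_+^2}{2t}h^4+C(t)$ with $C(t)=\frac12+\frac{h_+}{t}-\frac{h_+^2}{2t}$. Then $f\ge 0$ on $\mathbb{R}$ and $f(1)=0$. On $\mathcal{A}_h=\{h\in W^{1,2}([0,R],\mathbb{R}) : h(R)=1\}$ (functions being identified with their continuous representatives) consider $$I[h]=\int_0^R r^2\Big(\tfrac12\big(\tfrac{dh}{dr}\big)^2+\tfrac{3h^2}{r^2}+f(h)\Big)\,dr .$$ (a) $I$ has a global minimizer in $\mathcal{A}_h$. Every global minimizer $h^*$ is (real) analytic on $[0,R]$ and satisfies $$\frac{d^2h}{dr^2}+\frac2r\frac{dh}{dr}-\frac{6h}{r^2}=-h+h^3+\frac{3h_+}{t}(h^3-h^2)\quad\text{on }(0,R),\qquad h(0)=0,\quad h(R)=1 .$$ (b) For a global minimizer $h^*$, let $\mathbf{Q}^*(x)=\sqrt{\tfrac32}\,h^*(|x|)\big(\tfrac{x\otimes x}{|x|^2}-\tfrac13\mathbf{I}\big)$ for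 $x\in\mathbb{R}^3$, $0<|x|\le R$, and $\mathbf{Q}^*(0)=0$. Then $\mathbf{Q}^*$ is symmetric and traceless, continuous on the closed ball $\overline{B(0,R)}$, of class $C^2$ in the open ball $B(0,R)$, equal to $\sqrt{\tfrac32}\big(\tfrac{x\otimes x}{|x|^2}-\tfrac13\mathbf{I}\big)$ for $|x|=R$, and solves in the whole open ball the Landau–de Gennes Euler–Lagrange equations $$\Delta Q_{ij}=-Q_{ij}-\frac{3\sqrt6\,h_+}{t}\Big(Q_{ik}Q_{kj}-\frac{\delta_{ij}}3\operatorname{tr}\mathbf{Q}^2\Big)+\frac{2h_+^2}{t}Q_{ij}\operatorname{tr}\mathbf{Q}^2,\qquad i,j=1,2,3,$$ (summation over $k$). That is, $\mathbf{Q}^*$ is a stationary point, with respect to smooth symmetric traceless variations compactly supported in $B(0,R)$, of the Landau–de Gennes energy $$\tilde{\mathcal{I}}_{LG}[\mathbf{Q}]=\int_{B(0,R)}\tfrac12|\nabla\mathbf{Q}|^2-\tfrac12\operatorname{tr}\mathbf{Q}^2-\tfrac{\sqrt6h_+}{t}\operatorname{tr}\mathbf{Q}^3+\tfrac{h_+^2}{2t}(\operatorname{tr}\mathbf{Q}^2)^2\,dV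 .$$ Moreover $|\nabla\mathbf{Q}^*|^2$ and the energy density are integrable on $B(0,R)$, and $\tilde{\mathcal{I}}_{LG}[\mathbf{Q}^*]\le 12\pi R$; the same bound holds when the constant $C(t)$ is added to the energy density. (c) Every global minimizer satisfies $0\le h^*(r)\le 1$ for all $r\in[0,R]$. -/

import Mathlib

open MeasureTheory Set
open scoped ContDiff Laplacian

noncomputable section

namespace Hedgehog

/-! ### The scalar (radial) problem -/

/-- The constant `h₊ = (3 + √(9 + 8 t)) / 4`. -/
def hPlus (t : ℝ) : ℝ := (3 + √(9 + 8 * t)) / 4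

/-- The additive constant `C(t)` of the bulk energy density; it is the value for which the bulk
density vanishes at `h = 1` (where it attains its minimum). -/
def bulkConst (t : ℝ) : ℝ := 1 / 2 + hPlus t / t - hPlus t ^ 2 / (2 * t)

/-- The scalar bulk density `f(h) = - h²/2 - (h₊/t) h³ + (h₊²/(2t)) h⁴ + C(t)`. -/
def bulk (t : ℝ) (x : ℝ) : ℝ :=
  -x ^ 2 / 2 - hPlus t / t * x ^ 3 + hPlus t ^ 2 / (2 * t) * x ^ 4 + bulkConst t

/-- `g` is a weak derivative of `h` on the interval `(0, R)`. -/
def IsWeakDeriv (R : ℝ) (h g : ℝ → ℝ) : Prop :=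
  ∀ φ : ℝ → ℝ, ContDiff ℝ ∞ φ → HasCompactSupport φ → tsupport φ ⊆ Ioo 0 R →
    ∫ r in (0 : ℝ)..R, h r * deriv φ r = -∫ r in (0 : ℝ)..R, g r * φ r

/-- `h` belongs to the Sobolev space `W^{1,2}(0, R)` and `g` is its weak derivative. -/
structure MemW12 (R : ℝ) (h g : ℝ → ℝ) : Prop where
  memLp : MemLp h 2 (volume.restrict (Icc 0 R))
  memLp_deriv : MemLp g 2 (volume.restrict (Icc 0 R))
  weakDeriv : IsWeakDeriv R h g

/-- `h` (with weak derivative `g`) belongs to the admissible space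
`{h ∈ W^{1,2}([0, R]) : h(R) = 1}`. As usual in one dimension, an element of the Sobolev space is
identified with its representative that is continuous on `[0, R]`, which gives `h(R)` a meaning. -/
structure Admissible (R : ℝ) (h g : ℝ → ℝ) : Prop where
  memW12 : MemW12 R h g
  continuousOn : ContinuousOn h (Icc 0 R)
  boundary : h R = 1

/-- The reduced radial energy `I[h]`, where `g` is the weak derivative of `h`. -/
def radialEnergy (t R : ℝ) (h g : ℝ → ℝ) : ℝ :=
  ∫ r in (0 : ℝ)..R, r ^ 2 * (g r ^ 2 / 2 + 3 * h r ^ 2 / r ^ 2 + bulk t (h r))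

/-- `h` is a global minimizer of the radial energy in the admissible space. -/
def IsGlobalMinimizer (t R : ℝ) (h : ℝ → ℝ) : Prop :=
  ∃ g, Admissible R h g ∧
    ∀ k k' : ℝ → ℝ, Admissible R k k' → radialEnergy t R h g ≤ radialEnergy t R k k'

/-! ### Landau–de Gennes theory on the ball -/

/-- Three-dimensional Euclidean space. -/
abbrev E3 := EuclideanSpace ℝ (Fin 3)

/-- Real `3 × 3` matrices. -/
abbrev M3 := Matrix (Fin 3) (Fin 3) ℝ

/-- The matrix is symmetric and traceless, that is, a Q-tensor. -/
def IsQTensor (A : M3) : Prop := A.IsSymm ∧ A.trace = 0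

/-- `|∇Q|² = ∑ (∂Q_ij / ∂x_k)²`. -/
def gradSq (Q : E3 → M3) (x : E3) : ℝ :=
  ∑ i, ∑ j, ∑ k, (fderiv ℝ (fun y => Q y i j) x (EuclideanSpace.single k 1)) ^ 2

/-- The dimensionless Landau–de Gennes energy density, without additive constant. -/
def ldgDensity (t : ℝ) (Q : E3 → M3) (x : E3) : ℝ :=
  gradSq Q x / 2 - (Q x ^ 2).trace / 2 - √6 * hPlus t / t * (Q x ^ 3).trace
    + hPlus t ^ 2 / (2 * t) * (Q x ^ 2).trace ^ 2

/-- The dimensionless Landau–de Gennes energy on the ball of radius `R` about the origin. -/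
def ldgEnergy (t R : ℝ) (Q : E3 → M3) : ℝ :=
  ∫ x in Metric.ball (0 : E3) R, ldgDensity t Q x

/-- The tensor field `√(3/2) h(|x|) (x ⊗ x / |x|² - I/3)`. -/
def hedgehog (h : ℝ → ℝ) (x : E3) : M3 :=
  Matrix.of fun i j => √(3 / 2) * h ‖x‖ * (x i * x j / ‖x‖ ^ 2 - (1 : M3) i j / 3)

/-- `Q` is a classical solution, on the ball of radius `R`, of the Landau–de Gennes Euler–Lagrange
equations with strong radial anchoring on the boundary sphere. -/
structure IsClassicalSolution (t R : ℝ) (Q : E3 → M3) : Prop where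
  isQTensor : ∀ x ∈ Metric.closedBall (0 : E3) R, IsQTensor (Q x)
  contDiffOn : ∀ i j, ContDiffOn ℝ 2 (fun x => Q x i j) (Metric.ball 0 R)
  continuousOn : ∀ i j, ContinuousOn (fun x => Q x i j) (Metric.closedBall 0 R)
  boundary : ∀ x ∈ Metric.sphere (0 : E3) R, ∀ i j,
    Q x i j = √(3 / 2) * (x i / ‖x‖ * (x j / ‖x‖) - (1 : M3) i j / 3)
  eulerLagrange : ∀ x ∈ Metric.ball (0 : E3) R, ∀ i j,
    (Δ (fun y => Q y i j)) x =
      -Q x i j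
      - 3 * √6 * hPlus t / t * ((Q x * Q x) i j - (1 : M3) i j / 3 * (Q x ^ 2).trace)
      + 2 * hPlus t ^ 2 / t * Q x i j * (Q x ^ 2).trace

/-- `Q` is a stationary point of the Landau–de Gennes energy: the first variation vanishes in the
direction of every smooth Q-tensor field with compact support in the open ball. -/
def IsStationary (t R : ℝ) (Q : E3 → M3) : Prop :=
  ∀ V : E3 → M3, (∀ x, IsQTensor (V x)) → (∀ i j, ContDiff ℝ ∞ (fun x => V x i j)) →
    (∀ i j, HasCompactSupport (fun x => V x i j)) →
    (∀ i j, tsupport (fun x => V x i j) ⊆ Metric.ball 0 R) →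
    HasDerivAt (fun s : ℝ => ldgEnergy t R (fun x => Q x + s • V x)) 0 0

end Hedgehog

end

/-! Put `p = r h'`. The energy becomes half the squared `L²` norm of `p` plus the integral of the
nonnegative potential `3 h² + r² f(h)`, where `h(r) = 1 - ∫_r^R p(s)/s ds`. For fixed `r > 0` the
value `h(r)` is a bounded linear functional of `p`, so weak convergence of `p` gives pointwise
convergence of `h`, and Fatou's lemma makes the potential part weakly lower semicontinuous. The
direct method (`exists_forall_norm_sq_add_le`) yields a minimizer in this class, which is larger
than the admissible one: nothing is imposed at the origin.

Varying `p` by `s 1_A(s)` for arbitrary measurable `A` gives `r² h' = ∫₀ʳ (6h + s² f'(h)) ds`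
(`IsWeightedMinimizer.ae_eq_flux`); the flux vanishes at `0` as a natural boundary condition. A
maximum principle (`le_of_force_pos`) then gives `|h| ≤ 1`. The exponents of the linear part at `0`
are `2` and `-3`, and boundedness excludes the second, so `w = h/r²` is the right unknown: `(r⁶ w')'
= r⁴ f'(h)`. A bootstrap shows that `w` is continuous up to `0`, and scaling turns the equation into
a regular integral equation (`exists_quotient`).

Analyticity comes from the implicit function theorem in `C([0,1])`. The function `θ ↦ w(√ρ θ)` is a
fixed point of a map polynomial in `ρ` and in the function, and constant in the function at `ρ = 0`;
hence `h(r) = r² W(r²)` with `W` analytic. The same device applied to the first order system for `h`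
and the flux gives analyticity elsewhere, including `r = R`. So the relaxed minimizer is admissible,
the two problems have the same minimum, and every global minimizer inherits these properties.
Nonnegativity follows by reflecting a negative nodal piece: only the cubic term changes, and it
strictly lowers the energy.

In three dimensions the hedgehog is `√(3/2) W(|x|²)` times the harmonic quadratic form `x ⊗ x - |x|²
I/3`. This is smooth across the origin, and the Euler–Lagrange system reduces to the radial
equation. The density plus `C(t)` is the radial density, so the bound `12πR` is `4π` times the
energy `3R` of the competitor `h ≡ 1`. Stationarity follows because the energy along a line is a
quartic whose linear coefficient is the integral of a divergence. -/

namespace Hedgehog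

/-! ### Weak derivatives on an interval and primitives. -/

open Filter Topology

/-- Exchanging the order of integration over the triangle `0 < r < s ≤ R`. -/
theorem integral_mul_integral_right_eq {R : ℝ} (hR : 0 ≤ R) {k q : ℝ → ℝ}
    (hk : IntegrableOn k (Ioc 0 R)) (hq : IntegrableOn q (Ioc 0 R)) :
    ∫ r in (0 : ℝ)..R, k r * ∫ s in r..R, q s =
      ∫ s in (0 : ℝ)..R, (∫ r in (0 : ℝ)..s, k r) * q s := by
  set μ := volume.restrict (Ioc 0 R) with hμ
  have hT : MeasurableSet {z : ℝ × ℝ | z.1 < z.2} := measurableSet_lt measurable_fst measurable_snd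
  have hint : Integrable (Function.uncurry fun r s : ℝ => if r < s then k r * q s else 0)
      (μ.prod μ) := by
    refine ((Integrable.mul_prod hk hq).indicator hT).congr (Eventually.of_forall fun z => ?_)
    by_cases h : z.1 < z.2 <;> simp [h, Function.uncurry]
  have hswap := integral_integral_swap hint
  rw [intervalIntegral.integral_of_le hR, intervalIntegral.integral_of_le hR]
  calc ∫ r, (k r * ∫ s in r..R, q s) ∂μ
      = ∫ r, ∫ s, (if r < s then k r * q s else 0) ∂μ ∂μ := by
        refine setIntegral_congr_fun measurableSet_Ioc fun r hr => ?_
        have h1 : (fun s => if r < s then k r * q s else 0) =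
            (Ioi r).indicator fun s => k r * q s := by
          ext s; by_cases h : r < s <;> simp [h]
        simp only [h1]
        rw [integral_indicator measurableSet_Ioi, hμ, Measure.restrict_restrict measurableSet_Ioi,
          integral_const_mul, intervalIntegral.integral_of_le hr.2]
        have : Ioi r ∩ Ioc 0 R = Ioc r R := by
          ext s
          simp only [mem_inter_iff, mem_Ioi, mem_Ioc]
          exact ⟨fun h => ⟨h.1, h.2.2⟩, fun h => ⟨h.1, hr.1.trans h.1, h.2⟩⟩
        rw [this]
    _ = ∫ s, ∫ r, (if r < s then k r * q s else 0) ∂μ ∂μ := hswap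
    _ = ∫ s, ((∫ r in (0 : ℝ)..s, k r) * q s) ∂μ := by
        refine setIntegral_congr_fun measurableSet_Ioc fun s hs => ?_
        have h1 : (fun r => if r < s then k r * q s else 0) =
            (Iio s).indicator fun r => k r * q s := by
          ext r; by_cases h : r < s <;> simp [h]
        simp only [h1]
        rw [integral_indicator measurableSet_Iio, hμ, Measure.restrict_restrict measurableSet_Iio,
          integral_mul_const, intervalIntegral.integral_of_le hs.1.le,
          integral_Ioc_eq_integral_Ioo]
        have : Iio s ∩ Ioc 0 R = Ioo 0 s := by
          ext r
          simp only [mem_inter_iff, mem_Iio, mem_Ioc, mem_Ioo]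
          exact ⟨fun h => ⟨h.2.1, h.1⟩, fun h => ⟨h.2, h.1, h.2.le.trans hs.2⟩⟩
        rw [this]

/-- A smooth function of zero mean supported in an interval is the derivative of a smooth function
supported in that interval. -/
theorem exists_primitive_of_integral_eq_zero {R : ℝ} (hR : 0 < R) {g : ℝ → ℝ}
    (hg : ContDiff ℝ ∞ g) (hgc : HasCompactSupport g) (hgs : tsupport g ⊆ Ioo 0 R)
    (h0 : ∫ r in (0 : ℝ)..R, g r = 0) :
    ∃ φ : ℝ → ℝ, ContDiff ℝ ∞ φ ∧ HasCompactSupport φ ∧ tsupport φ ⊆ Ioo 0 R ∧ deriv φ = g := by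
  obtain ⟨a, b, ha, hab, hb, hsub⟩ : ∃ a b, 0 < a ∧ a ≤ b ∧ b < R ∧ tsupport g ⊆ Icc a b := by
    rcases (tsupport g).eq_empty_or_nonempty with h | h
    -- For `g = 0` any interior point serves as the enclosing interval.
    · exact ⟨R / 2, R / 2, by linarith, le_rfl, by linarith, by simp [h]⟩
    · have hc : IsCompact (tsupport g) := hgc
      refine ⟨sInf (tsupport g), sSup (tsupport g), (hgs (hc.sInf_mem h)).1, ?_,
        (hgs (hc.sSup_mem h)).2, fun x hx =>
          ⟨csInf_le hc.bddBelow hx, le_csSup hc.bddAbove hx⟩⟩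
      exact (csInf_le hc.bddBelow (hc.sSup_mem h))
  have hz : ∀ x, x ∉ Icc a b → g x = 0 := fun x hx => image_eq_zero_of_notMem_tsupport
    fun h => hx (hsub h)
  have hcont := hg.continuous
  have hd : ∀ x, HasDerivAt (fun x => ∫ r in (0 : ℝ)..x, g r) (g x) x := fun x =>
    intervalIntegral.integral_hasDerivAt_right (hcont.intervalIntegrable _ _)
      (hcont.stronglyMeasurableAtFilter _ _) hcont.continuousAt
  have hderiv : deriv (fun x => ∫ r in (0 : ℝ)..x, g r) = g := funext fun x => (hd x).deriv
  -- Left of `a` nothing has been accumulated; right of `b` the whole integral has, and it vanishes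
  -- by `h0`.
  have hzero : ∀ x, x ∉ Icc a b → ∫ r in (0 : ℝ)..x, g r = 0 := by
    intro x hx
    rcases lt_or_ge x a with h | h
    · refine intervalIntegral.integral_zero_ae (Eventually.of_forall fun y hy => hz y fun h' => ?_)
      have := hy.2.trans (max_le ha.le h.le)
      rcases le_total 0 x with h2 | h2
      · rw [uIoc_of_le h2] at hy; linarith [hy.2, h'.1]
      · rw [uIoc_of_ge h2] at hy; linarith [hy.2, h'.1]
    · have hxb : b < x := by by_contra h2; exact hx ⟨h, not_lt.1 h2⟩
      rw [← intervalIntegral.integral_add_adjacent_intervals (hcont.intervalIntegrable 0 R)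
        (hcont.intervalIntegrable R x), h0, zero_add]
      refine intervalIntegral.integral_zero_ae (Eventually.of_forall fun y hy => hz y fun h' => ?_)
      have h3 : b < y := lt_of_lt_of_le (lt_min hb hxb) hy.1.le
      linarith [h'.2]
  have hts : tsupport (fun x => ∫ r in (0 : ℝ)..x, g r) ⊆ Icc a b := by
    refine closure_minimal (fun x hx => ?_) isClosed_Icc
    by_contra h
    exact hx (hzero x h)
  refine ⟨fun x => ∫ r in (0 : ℝ)..x, g r, ?_, ?_, ?_, hderiv⟩
  · rw [contDiff_infty_iff_deriv, hderiv]
    exact ⟨fun x => (hd x).differentiableAt, hg⟩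
  · exact isCompact_Icc.of_isClosed_subset (isClosed_tsupport _) hts
  · exact hts.trans fun x hx => ⟨ha.trans_le hx.1, hx.2.trans_lt hb⟩

/-- A continuous function on `[0, R]` whose weak derivative vanishes is constant. -/
theorem eqOn_const_of_integral_mul_deriv_eq_zero {R : ℝ} (hR : 0 < R) {u : ℝ → ℝ}
    (hu : ContinuousOn u (Icc 0 R))
    (h : ∀ φ : ℝ → ℝ, ContDiff ℝ ∞ φ → HasCompactSupport φ → tsupport φ ⊆ Ioo 0 R →
      ∫ r in (0 : ℝ)..R, u r * deriv φ r = 0) :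
    ∀ r ∈ Icc 0 R, u r = u R := by
  have hui : IntervalIntegrable u volume 0 R := (by rwa [uIcc_of_le hR.le] :
    ContinuousOn u (uIcc 0 R)).intervalIntegrable
  let B : ContDiffBump (R / 2) := ⟨R / 8, R / 4, by linarith, by linarith⟩
  set ψ₀ : ℝ → ℝ := B.normed volume with hψ₀
  have hψ₀s : tsupport ψ₀ ⊆ Ioo 0 R := by
    rw [hψ₀, B.tsupport_normed_eq, Real.closedBall_eq_Icc]
    intro x hx
    have h1 : R / 2 - R / 4 ≤ x := hx.1
    have h2 : x ≤ R / 2 + R / 4 := hx.2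
    exact ⟨by linarith, by linarith⟩
  have hψ₀d : ContDiff ℝ ∞ ψ₀ := B.contDiff_normed
  have hψ₀c : HasCompactSupport ψ₀ := B.hasCompactSupport_normed
  have key : ∀ ψ : ℝ → ℝ, tsupport ψ ⊆ Ioo 0 R → ∀ v : ℝ → ℝ,
      ∫ r in (0 : ℝ)..R, v r * ψ r = ∫ r, v r * ψ r := by
    intro ψ hψ v
    rw [intervalIntegral.integral_of_le hR.le]
    refine setIntegral_eq_integral_of_forall_compl_eq_zero fun x hx => ?_
    rw [image_eq_zero_of_notMem_tsupport fun hx' => hx (Ioo_subset_Ioc_self (hψ hx')), mul_zero]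
  have hψ₀1 : ∫ r in (0 : ℝ)..R, ψ₀ r = 1 := by
    have := key ψ₀ hψ₀s fun _ => 1
    simp only [one_mul] at this
    rw [this]; exact B.integral_normed
  set c : ℝ := ∫ r in (0 : ℝ)..R, u r * ψ₀ r with hc
  have hae : ∀ᵐ x, x ∈ Ioo 0 R → u x - c = 0 := by
    refine isOpen_Ioo.ae_eq_zero_of_integral_contDiff_smul_eq_zero ?_ fun ψ hψd hψc hψs => ?_
    · exact ((hu.mono Ioo_subset_Icc_self).sub continuousOn_const).locallyIntegrableOn
        measurableSet_Ioo
    set I : ℝ := ∫ r in (0 : ℝ)..R, ψ r with hI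
    have hui1 : IntervalIntegrable (fun r => u r * ψ r) volume 0 R :=
      hui.mul_continuousOn hψd.continuous.continuousOn
    have hui2 : IntervalIntegrable (fun r => u r * ψ₀ r) volume 0 R :=
      hui.mul_continuousOn hψ₀d.continuous.continuousOn
    have hts : tsupport (fun r => ψ r - I * ψ₀ r) ⊆ tsupport ψ ∪ tsupport ψ₀ := by
      refine closure_minimal (fun x hx => ?_) (hψc.isCompact.union hψ₀c.isCompact).isClosed
      by_contra h'
      rw [mem_union, not_or] at h'
      exact hx (by simp [image_eq_zero_of_notMem_tsupport h'.1,
        image_eq_zero_of_notMem_tsupport h'.2])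
    -- Du Bois-Reymond: subtracting its mean times a fixed normalized bump turns an arbitrary test
    -- function into the derivative of a test function.
    obtain ⟨φ, hφ, hφc, hφs, hφd⟩ := exists_primitive_of_integral_eq_zero hR
      (g := fun r => ψ r - I * ψ₀ r) (hψd.sub (contDiff_const.mul hψ₀d))
      ((hψc.isCompact.union hψ₀c.isCompact).of_isClosed_subset (isClosed_tsupport _) hts)
      (hts.trans (union_subset hψs hψ₀s)) (by
        rw [intervalIntegral.integral_sub (hψd.continuous.intervalIntegrable _ _)
          ((hψ₀d.continuous.intervalIntegrable _ _).const_mul I),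
          intervalIntegral.integral_const_mul, hψ₀1, ← hI, mul_one, sub_self])
    have h1 := h φ hφ hφc hφs
    rw [hφd] at h1
    have h2 : ∫ r in (0 : ℝ)..R, u r * (ψ r - I * ψ₀ r) =
        (∫ r in (0 : ℝ)..R, u r * ψ r) - I * c := by
      rw [hc, ← intervalIntegral.integral_const_mul, ← intervalIntegral.integral_sub hui1
        (hui2.const_mul I)]
      exact intervalIntegral.integral_congr fun r _ => by ring
    have h3 : ∫ r in (0 : ℝ)..R, (u r - c) * ψ r = (∫ r in (0 : ℝ)..R, u r * ψ r) - c * I := by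
      rw [hI, ← intervalIntegral.integral_const_mul, ← intervalIntegral.integral_sub hui1
        ((hψd.continuous.intervalIntegrable _ _).const_mul c)]
      exact intervalIntegral.integral_congr fun r _ => by ring
    have h4 : ∫ x, ψ x • (u x - c) = ∫ r in (0 : ℝ)..R, (u r - c) * ψ r := by
      rw [key ψ hψs]
      exact integral_congr_ae (Eventually.of_forall fun x => by simp [mul_comm])
    rw [h4, h3]; linarith
  have hon : EqOn u (fun _ => c) (Ioo 0 R) := by
    refine Measure.eqOn_open_of_ae_eq (μ := volume) ?_ isOpen_Ioo
      (hu.mono Ioo_subset_Icc_self) continuousOn_const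
    rw [EventuallyEq, ae_restrict_iff' measurableSet_Ioo]
    filter_upwards [hae] with x hx hxm using sub_eq_zero.1 (hx hxm)
  have hcl : EqOn u (fun _ => c) (Icc 0 R) :=
    hon.of_subset_closure hu continuousOn_const Ioo_subset_Icc_self
      (by rw [closure_Ioo hR.ne])
  intro r hr
  rw [hcl hr, hcl (right_mem_Icc.2 hR.le)]

/-- `h` is an antiderivative of `g` on `[0, R]` exactly when `g` is its weak derivative. -/
theorem IsWeakDeriv.of_eq_integral {R : ℝ} (hR : 0 < R) {h g : ℝ → ℝ}
    (hg : IntegrableOn g (Ioc 0 R)) (hh : ∀ r ∈ Ioc 0 R, h r = h R - ∫ s in r..R, g s) :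
    IsWeakDeriv R h g := by
  intro φ hφ hφc hφs
  have hφ' : Continuous (deriv φ) := hφ.continuous_deriv (by simp)
  have h0 : ∀ s, ∫ r in (0 : ℝ)..s, deriv φ r = φ s := by
    intro s
    rw [intervalIntegral.integral_deriv_eq_sub (fun x _ => hφ.differentiable (by simp) x)
      (hφ'.intervalIntegrable _ _), image_eq_zero_of_notMem_tsupport
      fun h' => lt_irrefl _ (hφs h').1, sub_zero]
  have hφR : φ R = 0 := image_eq_zero_of_notMem_tsupport fun h' => lt_irrefl _ (hφs h').2
  -- Integration by parts against a merely integrable `g` is Fubini on the triangle.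
  have hF := integral_mul_integral_right_eq hR.le (k := deriv φ)
    ((intervalIntegrable_iff_integrableOn_Ioc_of_le hR.le).1 (hφ'.intervalIntegrable _ _)) hg
  simp only [h0] at hF
  have hc : ContinuousOn (fun r => ∫ s in r..R, g s) (uIcc 0 R) := by
    have := intervalIntegral.continuousOn_primitive_interval' (a := R)
      ((intervalIntegrable_iff_integrableOn_Ioc_of_le hR.le).2 hg) right_mem_uIcc
    exact this.neg.congr fun r _ => intervalIntegral.integral_symm _ _
  have h1 : ∫ r in (0 : ℝ)..R, h r * deriv φ r =
      ∫ r in (0 : ℝ)..R, (h R * deriv φ r - deriv φ r * ∫ s in r..R, g s) := by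
    refine intervalIntegral.integral_congr_ae (Eventually.of_forall fun r hr => ?_)
    rw [uIoc_of_le hR.le] at hr
    rw [hh r hr]; ring
  have hi : IntervalIntegrable (fun r => deriv φ r * ∫ s in r..R, g s) volume 0 R :=
    (hφ'.continuousOn.mul hc).intervalIntegrable
  rw [h1, intervalIntegral.integral_sub ((hφ'.intervalIntegrable _ _).const_mul _) hi, intervalIntegral.integral_const_mul, h0, hφR,
    hF, mul_zero, zero_sub]
  congr 1
  exact intervalIntegral.integral_congr fun r _ => mul_comm _ _

/-- `h` and the primitive of `g` have the same weak derivative, so they differ by a constant, which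
the value at `R` fixes. -/
theorem IsWeakDeriv.eq_integral {R : ℝ} (hR : 0 < R) {h g : ℝ → ℝ}
    (hg : IntegrableOn g (Ioc 0 R)) (hc : ContinuousOn h (Icc 0 R)) (hw : IsWeakDeriv R h g) :
    ∀ r ∈ Icc 0 R, h r = h R - ∫ s in r..R, g s := by
  have hgi : IntervalIntegrable g volume 0 R :=
    (intervalIntegrable_iff_integrableOn_Ioc_of_le hR.le).2 hg
  have hc' : ContinuousOn (fun r => ∫ s in r..R, g s) (Icc 0 R) := by
    have := intervalIntegral.continuousOn_primitive_interval' (a := R) hgi right_mem_uIcc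
    rw [uIcc_of_le hR.le] at this
    exact this.neg.congr fun r _ => intervalIntegral.integral_symm _ _
  have hw' : IsWeakDeriv R (fun r => -∫ s in r..R, g s) g :=
    IsWeakDeriv.of_eq_integral hR hg fun r _ => by simp
  have := eqOn_const_of_integral_mul_deriv_eq_zero hR (u := fun r => h r + ∫ s in r..R, g s)
    (hc.add hc') fun φ hφ hφc hφs => by
      have h1 := hw φ hφ hφc hφs
      have h2 := hw' φ hφ hφc hφs
      have hφ' : Continuous (deriv φ) := hφ.continuous_deriv (by simp)
      have e : ∀ r, (h r + ∫ s in r..R, g s) * deriv φ r =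
        h r * deriv φ r - (-∫ s in r..R, g s) * deriv φ r := fun r => by ring
      simp only [e]
      rw [intervalIntegral.integral_sub, h1, h2, sub_self]
      · exact ContinuousOn.intervalIntegrable (by
          rw [uIcc_of_le hR.le]; exact hc.mul hφ'.continuousOn)
      · exact ContinuousOn.intervalIntegrable (by
          rw [uIcc_of_le hR.le]; exact hc'.neg.mul hφ'.continuousOn)
  intro r hr
  have := this r hr
  simp only [intervalIntegral.integral_same, add_zero] at this
  linarith

end Hedgehog

/-! ### The direct method for the slope density `p = r h'`. -/

namespace Hedgehog

open Filter Topology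
open scoped ENNReal

/-- The direct method: on a separable Hilbert space, half the squared norm plus a weakly
sequentially lower semicontinuous functional attains its minimum. -/
theorem exists_forall_norm_sq_add_le {H : Type*} [NormedAddCommGroup H] [InnerProductSpace ℝ H]
    [CompleteSpace H] [TopologicalSpace.SeparableSpace H] (V : H → ℝ≥0∞)
    (hV : ∀ (u : ℕ → H) (p : H), (∀ q, Tendsto (fun n => inner ℝ (u n) q) atTop (𝓝 (inner ℝ p q))) →
      V p ≤ liminf (fun n => V (u n)) atTop) (p₀ : H) (hp₀ : V p₀ ≠ ⊤) :
    ∃ p, ∀ q, ENNReal.ofReal (‖p‖ ^ 2 / 2) + V p ≤ ENNReal.ofReal (‖q‖ ^ 2 / 2) + V q := by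
  set E : H → ℝ≥0∞ := fun q => ENNReal.ofReal (‖q‖ ^ 2 / 2) + V q with hE
  obtain ⟨a, ha_anti, ha, ha_mem⟩ := exists_seq_tendsto_sInf (S := range E) ⟨_, p₀, rfl⟩
    (OrderBot.bddBelow _)
  choose u hu using ha_mem
  set m := sInf (range E) with hm
  have hm_top : m ≠ ⊤ :=
    ne_top_of_le_ne_top (ENNReal.add_ne_top.2 ⟨ENNReal.ofReal_ne_top, hp₀⟩) (sInf_le ⟨p₀, rfl⟩)
  -- The minimizing values decrease, so from `N` on all lie below `m + 1`; as `V ≥ 0`, this bounds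
  -- the norms.
  obtain ⟨N, hN⟩ := (ha.eventually (gt_mem_nhds (ENNReal.lt_add_right hm_top one_ne_zero))).exists
  have hbound : ∀ n, N ≤ n → ‖u n‖ ^ 2 / 2 ≤ (m + 1).toReal := by
    intro n hn
    have h1 : ENNReal.ofReal (‖u n‖ ^ 2 / 2) ≤ m + 1 :=
      calc _ ≤ E (u n) := le_self_add
        _ = a n := hu n
        _ ≤ a N := ha_anti hn
        _ ≤ m + 1 := hN.le
    have h2 := ENNReal.toReal_mono (ENNReal.add_ne_top.2 ⟨hm_top, ENNReal.one_ne_top⟩) h1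
    rwa [ENNReal.toReal_ofReal (by positivity)] at h2
  set C := √(2 * (m + 1).toReal) with hC
  let x : ℕ → WeakDual ℝ H := fun n =>
    StrongDual.toWeakDual (InnerProductSpace.toDual ℝ H (u (N + n)))
  have hx : ∀ n, x n ∈ WeakDual.toStrongDual ⁻¹' Metric.closedBall (0 : StrongDual ℝ H) C := by
    intro n
    have : ‖u (N + n)‖ ≤ C := Real.le_sqrt_of_sq_le (by linarith [hbound (N + n) (by omega)])
    simpa [x] using this
  -- Banach–Alaoglu in sequential form, available since `H` is separable; Riesz turns the limit
  -- functional into the vector `p`.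
  obtain ⟨y, -, φ, hφ, hy⟩ := WeakDual.isSeqCompact_closedBall ℝ H 0 C hx
  set p : H := (InnerProductSpace.toDual ℝ H).symm (WeakDual.toStrongDual y) with hp
  have hweak : ∀ q, Tendsto (fun n => inner ℝ (u (N + φ n)) q) atTop (𝓝 (inner ℝ p q)) := by
    intro q
    have h1 : Tendsto (fun n => (x (φ n)) q) atTop (𝓝 (y q)) :=
      ((WeakDual.eval_continuous q).tendsto y).comp hy
    have h2 : inner ℝ p q = y q := by
      rw [hp, InnerProductSpace.toDual_symm_apply]; rfl
    rw [h2]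
    refine h1.congr fun n => ?_
    simp [x]
  have ha' : Tendsto (fun n => E (u (N + φ n))) atTop (𝓝 m) := by
    simp only [hu]
    exact ha.comp (tendsto_atTop_mono (fun n => (hφ.id_le n).trans (Nat.le_add_left _ N)) tendsto_id)
  set A := ENNReal.ofReal (‖p‖ ^ 2 / 2) with hA
  -- The tangent bound `‖u‖²/2 ≥ ⟨u, p⟩ - ‖p‖²/2` passes to the weak limit and becomes exact there.
  -- Subtracting it from the energies leaves an upper bound for `V`.
  have hb : Tendsto (fun n => ENNReal.ofReal (inner ℝ (u (N + φ n)) p - ‖p‖ ^ 2 / 2)) atTop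
      (𝓝 A) := by
    refine ENNReal.tendsto_ofReal ?_
    have := (hweak p).sub_const (‖p‖ ^ 2 / 2)
    rw [real_inner_self_eq_norm_sq] at this
    convert this using 2; ring
  have hle : ∀ n, ENNReal.ofReal (inner ℝ (u (N + φ n)) p - ‖p‖ ^ 2 / 2) + V (u (N + φ n)) ≤
      E (u (N + φ n)) := by
    intro n
    refine add_le_add_left (ENNReal.ofReal_le_ofReal ?_) _
    have := norm_sub_sq_real (u (N + φ n)) p
    nlinarith [sq_nonneg ‖u (N + φ n) - p‖]
  have hAm : A ≤ m := le_of_tendsto_of_tendsto' hb ha' fun n => le_self_add.trans (hle n)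
  have hVm : V p ≤ m - A :=
    calc V p ≤ liminf (fun n => V (u (N + φ n))) atTop := hV _ _ hweak
      _ ≤ liminf (fun n => E (u (N + φ n)) -
            ENNReal.ofReal (inner ℝ (u (N + φ n)) p - ‖p‖ ^ 2 / 2)) atTop :=
          liminf_le_liminf (Eventually.of_forall fun n =>
            ENNReal.le_sub_of_add_le_left ENNReal.ofReal_ne_top (hle n))
      _ = m - A := (ENNReal.Tendsto.sub ha' hb (Or.inl hm_top)).liminf_eq
  refine ⟨p, fun q => ?_⟩
  calc A + V p ≤ A + (m - A) := by gcongr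
    _ = m := add_tsub_cancel_of_le hAm
    _ ≤ E q := sInf_le ⟨q, rfl⟩

/-- The ratio `h₊ / t`, which determines all coefficients of the bulk density. -/
noncomputable def coupling (t : ℝ) : ℝ := hPlus t / t

theorem coupling_pos {t : ℝ} (ht : 0 < t) : 0 < coupling t := by
  unfold coupling hPlus; positivity

/-- `h₊` is the larger root of `2h² - 3h - t = 0`; thus a single parameter, the coupling, governs
all coefficients. -/
theorem hPlus_sq_div {t : ℝ} (ht : 0 < t) : hPlus t ^ 2 / t = (1 + 3 * coupling t) / 2 := by
  have h := Real.sq_sqrt (show (0 : ℝ) ≤ 9 + 8 * t by linarith)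
  unfold coupling hPlus
  field_simp
  linear_combination 2 * h

theorem bulk_eq {t : ℝ} (ht : 0 < t) (x : ℝ) :
    bulk t x = -x ^ 2 / 2 - coupling t * x ^ 3 + (1 + 3 * coupling t) / 4 * x ^ 4
      + (1 + coupling t) / 4 := by
  have h : hPlus t ^ 2 / (2 * t) = (1 + 3 * coupling t) / 4 := by
    rw [mul_comm, ← div_div, hPlus_sq_div ht]; ring
  unfold bulk bulkConst
  rw [h, show hPlus t / t = coupling t from rfl]; ring

theorem bulkConst_pos {t : ℝ} (ht : 0 < t) : 0 < bulkConst t := by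
  have h := bulk_eq ht 0
  have := coupling_pos ht
  simp only [bulk] at h
  linarith

/-- Both `f` and `f'` vanish at `1`, so `(x - 1)²` splits off, and the remaining quadratic is a
positive combination of squares. -/
theorem bulk_nonneg {t : ℝ} (ht : 0 < t) (x : ℝ) : 0 ≤ bulk t x := by
  have hs := coupling_pos ht
  have h : bulk t x = (x - 1) ^ 2 * ((coupling t / 2) * x ^ 2 + (1 + coupling t) / 4 * (x + 1) ^ 2) := by
    rw [bulk_eq ht]; ring
  rw [h]; positivity

theorem bulk_one (t : ℝ) : bulk t 1 = 0 := by
  unfold bulk bulkConst; ring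

theorem continuous_bulk (t : ℝ) : Continuous (bulk t) := by
  unfold bulk; fun_prop

/-- The potential part `3 x² + r² f(x)` of the radial energy density. -/
noncomputable def potential (t r x : ℝ) : ℝ := 3 * x ^ 2 + r ^ 2 * bulk t x

theorem potential_nonneg {t : ℝ} (ht : 0 < t) (r x : ℝ) : 0 ≤ potential t r x := by
  have := bulk_nonneg ht x
  unfold potential; positivity

/-- The profile `h` with `h(R) = 1` and `r h'(r) = p(r)`. -/
noncomputable def profile (R : ℝ) (p : ℝ → ℝ) (r : ℝ) : ℝ := 1 - ∫ s in r..R, p s / s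

/-- The slope density `p` and its profile have finite weighted energy. -/
structure FiniteEnergy (t R : ℝ) (p : ℝ → ℝ) : Prop where
  memLp : MemLp p 2 (volume.restrict (Ioc 0 R))
  integrableOn : IntegrableOn (fun r => potential t r (profile R p r)) (Ioc 0 R)

/-- The radial energy as a functional of `p = r h'`. -/
noncomputable def weightedEnergy (t R : ℝ) (p : ℝ → ℝ) : ℝ :=
  (∫ r in Ioc 0 R, p r ^ 2) / 2 + ∫ r in Ioc 0 R, potential t r (profile R p r)

/-- `p` minimizes the weighted energy among all slope densities of finite energy. -/
def IsWeightedMinimizer (t R : ℝ) (p : ℝ → ℝ) : Prop :=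
  FiniteEnergy t R p ∧ ∀ q, FiniteEnergy t R q → weightedEnergy t R p ≤ weightedEnergy t R q

/-- The weight `1/s` is bounded only away from the origin. For `p` in `L²` the quotient `p/s` may
fail to be integrable near `0`, so profiles are controlled on `(0, R]` only. -/
theorem integrableOn_div_id {R ε : ℝ} (hε : 0 < ε) {p : ℝ → ℝ}
    (hp : MemLp p 2 (volume.restrict (Ioc 0 R))) : IntegrableOn (fun s => p s / s) (Ioc ε R) := by
  have h1 : IntegrableOn p (Ioc ε R) :=
    (show IntegrableOn p (Ioc 0 R) volume from hp.integrable (by norm_num)).mono_set (Ioc_subset_Ioc_left hε.le)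
  refine (h1.bdd_mul (c := 1 / ε) (f := fun s => s⁻¹) (by fun_prop) ?_).congr
    (Eventually.of_forall fun s => by simp [div_eq_mul_inv, mul_comm])
  filter_upwards [ae_restrict_mem measurableSet_Ioc] with s hs
  rw [norm_inv, Real.norm_of_nonneg (hε.trans hs.1).le, ← one_div]
  exact one_div_le_one_div_of_le hε hs.1.le

theorem intervalIntegrable_div_id {R a b : ℝ} (ha : 0 < a) (hab : a ≤ b) (hb : b ≤ R) {p : ℝ → ℝ}
    (hp : MemLp p 2 (volume.restrict (Ioc 0 R))) :
    IntervalIntegrable (fun s => p s / s) volume a b :=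
  (intervalIntegrable_iff_integrableOn_Ioc_of_le hab).2
    ((integrableOn_div_id ha hp).mono_set (Ioc_subset_Ioc_right hb))

theorem profile_sub_profile {R a b : ℝ} (ha : 0 < a) (hab : a ≤ b) (hb : b ≤ R) {p : ℝ → ℝ}
    (hp : MemLp p 2 (volume.restrict (Ioc 0 R))) :
    profile R p b - profile R p a = ∫ s in a..b, p s / s := by
  have := intervalIntegral.integral_add_adjacent_intervals
    (intervalIntegrable_div_id ha hab hb hp)
    (intervalIntegrable_div_id (ha.trans_le hab) hb le_rfl hp)
  unfold profile
  linarith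

theorem profile_right (R : ℝ) (p : ℝ → ℝ) : profile R p R = 1 := by simp [profile]

theorem continuousOn_profile {R : ℝ} {p : ℝ → ℝ}
    (hp : MemLp p 2 (volume.restrict (Ioc 0 R))) : ContinuousOn (profile R p) (Ioc 0 R) := by
  intro x hx
  have h2 : 0 < x / 2 := half_pos hx.1
  have hle : x / 2 ≤ R := by linarith [hx.1, hx.2]
  have h := intervalIntegral.continuousOn_primitive_interval' (a := R)
    (intervalIntegrable_div_id h2 hle le_rfl hp) right_mem_uIcc
  have h3 : ContinuousOn (profile R p) (Icc (x / 2) R) := by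
    rw [uIcc_of_le hle] at h
    refine (h.const_add 1).congr fun r _ => ?_
    simp only [profile]
    rw [intervalIntegral.integral_symm R r]; ring
  refine (h3 x ⟨by linarith [hx.1], hx.2⟩).mono_of_mem_nhdsWithin ?_
  filter_upwards [self_mem_nhdsWithin, nhdsWithin_le_nhds (Ioi_mem_nhds (show x / 2 < x by linarith [hx.1]))]
    with y hy hy' using ⟨le_of_lt hy', hy.2⟩

theorem aestronglyMeasurable_profile {R : ℝ} {p : ℝ → ℝ}
    (hp : MemLp p 2 (volume.restrict (Ioc 0 R))) :
    AEStronglyMeasurable (profile R p) (volume.restrict (Ioc 0 R)) :=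
  (continuousOn_profile hp).aestronglyMeasurable measurableSet_Ioc

theorem aestronglyMeasurable_potential_profile (t : ℝ) {R : ℝ} {p : ℝ → ℝ}
    (hp : MemLp p 2 (volume.restrict (Ioc 0 R))) :
    AEStronglyMeasurable (fun r => potential t r (profile R p r)) (volume.restrict (Ioc 0 R)) := by
  have h1 := aestronglyMeasurable_profile hp
  have h2 := (continuous_bulk t).comp_aestronglyMeasurable h1
  exact ((h1.pow 2).const_mul 3).add
    (((continuous_id.pow 2).aestronglyMeasurable).mul h2)

theorem profile_congr {R : ℝ} {p q : ℝ → ℝ} (h : p =ᵐ[volume.restrict (Ioc 0 R)] q) :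
    ∀ r ∈ Ioc 0 R, profile R p r = profile R q r := by
  intro r hr
  unfold profile
  congr 1
  refine intervalIntegral.integral_congr_ae ?_
  rw [EventuallyEq, ae_restrict_iff' measurableSet_Ioc] at h
  filter_upwards [h] with s hs hs'
  rw [uIoc_of_le hr.2] at hs'
  rw [hs ⟨hr.1.trans hs'.1, hs'.2⟩]

theorem weightedEnergy_congr {t R : ℝ} {p q : ℝ → ℝ} (h : p =ᵐ[volume.restrict (Ioc 0 R)] q) :
    weightedEnergy t R p = weightedEnergy t R q := by
  have h1 : ∫ r in Ioc 0 R, p r ^ 2 = ∫ r in Ioc 0 R, q r ^ 2 :=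
    integral_congr_ae (h.mono fun r hr => by simp only [hr])
  have h2 : ∫ r in Ioc 0 R, potential t r (profile R p r) =
      ∫ r in Ioc 0 R, potential t r (profile R q r) :=
    setIntegral_congr_fun measurableSet_Ioc fun r hr => by simp only [profile_congr h r hr]
  rw [weightedEnergy, weightedEnergy, h1, h2]

/-- Pointwise values of the profile are weakly continuous in the slope density. -/
theorem tendsto_profile {R : ℝ} {u : ℕ → Lp ℝ 2 (volume.restrict (Ioc 0 R))}
    {p : Lp ℝ 2 (volume.restrict (Ioc 0 R))}
    (h : ∀ q, Tendsto (fun n => inner ℝ (u n) q) atTop (𝓝 (inner ℝ p q))) {r : ℝ}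
    (hr : r ∈ Ioc 0 R) :
    Tendsto (fun n => profile R (u n) r) atTop (𝓝 (profile R p r)) := by
  set μ := volume.restrict (Ioc 0 R) with hμ
  have hκ : MemLp ((Ioc r R).indicator fun s : ℝ => s⁻¹) 2 μ := by
    refine MemLp.of_bound ?_ (1 / r) (Eventually.of_forall fun s => ?_)
    · exact (measurable_inv.indicator measurableSet_Ioc).aestronglyMeasurable
    · by_cases hs : s ∈ Ioc r R
      · rw [indicator_of_mem hs, norm_inv, Real.norm_of_nonneg (hr.1.trans hs.1).le, ← one_div]
        exact one_div_le_one_div_of_le hr.1 hs.1.le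
      · rw [indicator_of_notMem hs, norm_zero]
        exact (one_div_pos.2 hr.1).le
  -- Evaluation at `r` is, up to a constant, the inner product with the bounded kernel
  -- `1_{(r,R]}(s)/s`.
  have key : ∀ v : Lp ℝ 2 μ, profile R v r = 1 - inner ℝ v (hκ.toLp _) := by
    intro v
    rw [L2.inner_def]
    have h1 : ∫ s, inner ℝ (v s) (hκ.toLp _ s) ∂μ =
        ∫ s, (Ioc r R).indicator (fun s => v s / s) s ∂μ := by
      refine integral_congr_ae ?_
      filter_upwards [hκ.coeFn_toLp] with s hs
      rw [hs]
      by_cases hs : s ∈ Ioc r R <;> simp [hs, div_eq_mul_inv, mul_comm]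
    rw [h1, integral_indicator measurableSet_Ioc, Measure.restrict_restrict measurableSet_Ioc,
      inter_eq_left.2 (Ioc_subset_Ioc_left hr.1.le), profile,
      intervalIntegral.integral_of_le hr.2]
  simp only [key]
  exact (h _).const_sub 1

/-- `p = 0` is the competitor `h ≡ 1`, whose bulk density vanishes. -/
theorem finiteEnergy_zero (t R : ℝ) : FiniteEnergy t R 0 := by
  refine ⟨MemLp.zero', ?_⟩
  simp [profile, potential, bulk_one]

/-- Only the term `3h²` survives for `h ≡ 1`. Multiplied by `4π`, this value is the final bound
`12πR`. -/
theorem weightedEnergy_zero {t R : ℝ} (hR : 0 ≤ R) : weightedEnergy t R 0 = 3 * R := by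
  simp [weightedEnergy, profile, potential, bulk_one, hR, mul_comm]

/-- The potential part may be infinite on `L²`, hence its values in `[0, ∞]`. It is weakly lower
semicontinuous by Fatou, since profiles converge pointwise. -/
theorem exists_isWeightedMinimizer {t : ℝ} (ht : 0 < t) (R : ℝ) :
    ∃ p, IsWeightedMinimizer t R p := by
  set μ := volume.restrict (Ioc 0 R) with hμ
  have : Fact ((1 : ℝ≥0∞) ≤ 2) := ⟨by norm_num⟩
  have : Fact ((2 : ℝ≥0∞) ≠ ⊤) := ⟨by norm_num⟩
  let V : Lp ℝ 2 μ → ℝ≥0∞ := fun p => ∫⁻ r, ENNReal.ofReal (potential t r (profile R p r)) ∂μ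
  have hlsc : ∀ (u : ℕ → Lp ℝ 2 μ) (p : Lp ℝ 2 μ),
      (∀ q, Tendsto (fun n => inner ℝ (u n) q) atTop (𝓝 (inner ℝ p q))) →
      V p ≤ liminf (fun n => V (u n)) atTop := by
    intro u p hup
    calc V p = ∫⁻ r, liminf (fun n => ENNReal.ofReal (potential t r (profile R (u n) r))) atTop ∂μ := by
          refine setLIntegral_congr_fun measurableSet_Ioc fun r hr => ?_
          have h1 := tendsto_profile hup hr
          have h2 : Continuous (potential t r) := by
            have := continuous_bulk t
            unfold potential; fun_prop
          exact (ENNReal.tendsto_ofReal ((h2.tendsto _).comp h1)).liminf_eq.symm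
      _ ≤ _ := lintegral_liminf_le' fun n =>
          (aestronglyMeasurable_potential_profile t (Lp.memLp (u n))).aemeasurable.ennreal_ofReal
  have hfin : ∀ q : ℝ → ℝ, ∀ hq : FiniteEnergy t R q,
      ENNReal.ofReal (‖hq.memLp.toLp q‖ ^ 2 / 2) + V (hq.memLp.toLp q) =
        ENNReal.ofReal (weightedEnergy t R q) := by
    intro q hq
    have hae := hq.memLp.coeFn_toLp
    have h1 : ‖hq.memLp.toLp q‖ ^ 2 = ∫ r in Ioc 0 R, q r ^ 2 := by
      rw [← real_inner_self_eq_norm_sq, L2.inner_def]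
      refine integral_congr_ae ?_
      filter_upwards [hae] with r hr
      rw [hr]; simp [sq]
    have h2 : V (hq.memLp.toLp q) = ENNReal.ofReal (∫ r in Ioc 0 R, potential t r (profile R q r)) := by
      rw [ofReal_integral_eq_lintegral_ofReal hq.integrableOn
        (Eventually.of_forall fun r => potential_nonneg ht _ _)]
      refine setLIntegral_congr_fun measurableSet_Ioc fun r hr => ?_
      simp only [profile_congr hae r hr]
    rw [h1, h2, ← ENNReal.ofReal_add, weightedEnergy]
    · exact div_nonneg (integral_nonneg fun r => sq_nonneg _) two_pos.le
    · exact integral_nonneg fun r => potential_nonneg ht _ _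
  have hnonneg : ∀ q, 0 ≤ weightedEnergy t R q := fun q =>
    add_nonneg (div_nonneg (integral_nonneg fun r => sq_nonneg _) two_pos.le)
      (integral_nonneg fun r => potential_nonneg ht _ _)
  have h0 := hfin 0 (finiteEnergy_zero t R)
  obtain ⟨p, hp⟩ := exists_forall_norm_sq_add_le V hlsc
    ((finiteEnergy_zero t R).memLp.toLp 0)
    (ne_top_of_le_ne_top (h0 ▸ ENNReal.ofReal_ne_top) le_add_self)
  have hpV : V p ≠ ⊤ := ne_top_of_le_ne_top
    (ne_top_of_le_ne_top (h0 ▸ ENNReal.ofReal_ne_top) (hp _)) le_add_self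
  have hpf : FiniteEnergy t R p := by
    refine ⟨Lp.memLp p, aestronglyMeasurable_potential_profile t (Lp.memLp p), ?_⟩
    rw [hasFiniteIntegral_iff_ofReal (Eventually.of_forall fun r => potential_nonneg ht _ _)]
    exact hpV.lt_top
  refine ⟨p, hpf, fun q hq => ?_⟩
  have h1 := hp (hq.memLp.toLp q)
  have h2 := hfin p hpf
  rw [Lp.toLp_coeFn] at h2
  rw [hfin q hq, h2] at h1
  exact (ENNReal.ofReal_le_ofReal_iff (hnonneg q)).1 h1

end Hedgehog

/-! ### First variation and the integrated Euler–Lagrange equation. -/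

namespace Hedgehog

open Filter Topology
open scoped ENNReal

/-- The derivative of the bulk density. -/
noncomputable def bulkDeriv (t x : ℝ) : ℝ :=
  -x - 3 * coupling t * x ^ 2 + (1 + 3 * coupling t) * x ^ 3

/-- The right-hand side of the Euler–Lagrange equation in divergence form. -/
noncomputable def force (t : ℝ) (h : ℝ → ℝ) (r : ℝ) : ℝ := 6 * h r + r ^ 2 * bulkDeriv t (h r)

/-- The flux `r² h'(r)` of a solution of the radial Euler–Lagrange equation. -/
noncomputable def flux (t : ℝ) (h : ℝ → ℝ) (r : ℝ) : ℝ := ∫ s in (0 : ℝ)..r, force t h s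

theorem eq_zero_of_forall_quartic_nonneg {a b c d : ℝ}
    (h : ∀ x : ℝ, 0 ≤ a * x + b * x ^ 2 + c * x ^ 3 + d * x ^ 4) : a = 0 := by
  have hmin : IsLocalMin (fun x : ℝ => a * x + b * x ^ 2 + c * x ^ 3 + d * x ^ 4) 0 :=
    Eventually.of_forall fun x => by simpa using h x
  have hd : HasDerivAt (fun x : ℝ => a * x + b * x ^ 2 + c * x ^ 3 + d * x ^ 4) a 0 := by
    have := ((((hasDerivAt_id (0 : ℝ)).const_mul a).add ((hasDerivAt_pow 2 (0 : ℝ)).const_mul b)).add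
      ((hasDerivAt_pow 3 (0 : ℝ)).const_mul c)).add ((hasDerivAt_pow 4 (0 : ℝ)).const_mul d)
    refine this.congr_deriv ?_
    simp
  exact hmin.hasDerivAt_eq_zero hd

theorem integral_quartic {α : Type*} [MeasurableSpace α] {μ : Measure α} {f₀ f₁ f₂ f₃ f₄ : α → ℝ}
    (h₀ : Integrable f₀ μ) (h₁ : Integrable f₁ μ) (h₂ : Integrable f₂ μ) (h₃ : Integrable f₃ μ)
    (h₄ : Integrable f₄ μ) (l : ℝ) :
    Integrable (fun x => f₀ x + l * f₁ x + l ^ 2 * f₂ x + l ^ 3 * f₃ x + l ^ 4 * f₄ x) μ ∧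
    ∫ x, (f₀ x + l * f₁ x + l ^ 2 * f₂ x + l ^ 3 * f₃ x + l ^ 4 * f₄ x) ∂μ =
      (∫ x, f₀ x ∂μ) + l * (∫ x, f₁ x ∂μ) + l ^ 2 * (∫ x, f₂ x ∂μ) + l ^ 3 * (∫ x, f₃ x ∂μ)
        + l ^ 4 * ∫ x, f₄ x ∂μ := by
  have j1 := h₀.add (h₁.const_mul l)
  have j2 := j1.add (h₂.const_mul (l ^ 2))
  have j3 := j2.add (h₃.const_mul (l ^ 3))
  have j4 := j3.add (h₄.const_mul (l ^ 4))
  refine ⟨j4, ?_⟩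
  have e := integral_add' j3 (h₄.const_mul (l ^ 4))
  rw [integral_add' j2 (h₃.const_mul (l ^ 3)), integral_add' j1 (h₂.const_mul (l ^ 2)),
    integral_add' h₀ (h₁.const_mul l)] at e
  simp only [integral_const_mul] at e
  exact e

/-- The potential is a quartic, so its Taylor expansion is finite; the linear coefficient is `y`
times the force. No differentiation under the integral is then needed. -/
theorem potential_add {t : ℝ} (ht : 0 < t) (r x y : ℝ) (l : ℝ) :
    potential t r (x + l * y) = potential t r x + l * (y * (6 * x + r ^ 2 * bulkDeriv t x))
      + l ^ 2 * (y ^ 2 * (3 + r ^ 2 * (-1 / 2 - 3 * coupling t * x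
        + 3 / 2 * (1 + 3 * coupling t) * x ^ 2)))
      + l ^ 3 * (y ^ 3 * (r ^ 2 * (-coupling t + (1 + 3 * coupling t) * x)))
      + l ^ 4 * (y ^ 4 * (r ^ 2 * ((1 + 3 * coupling t) / 4))) := by
  simp only [potential, bulk_eq ht, bulkDeriv]; ring

/-- Coercivity: finite energy controls `∫ r² h⁴`, and therefore the cubic term of the force. -/
theorem sq_mul_pow_four_le_potential {t : ℝ} (ht : 0 < t) {r R : ℝ} (h0 : 0 ≤ r) (hr : r ≤ R)
    (x : ℝ) : r ^ 2 * x ^ 4 ≤ (4 + R ^ 2) * potential t r x := by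
  have hs := coupling_pos ht
  have h1 : x ^ 4 ≤ 4 * bulk t x + 2 * x ^ 2 := by
    have hb := bulk_nonneg ht x
    have h2 : (1 + coupling t) * x ^ 4 ≤ 4 * bulk t x + 2 * (1 + coupling t) * x ^ 2 := by
      rw [bulk_eq ht]
      -- With `s` the coupling, the difference of the two sides is `2 s x² (x - 1)² + 1 + s`.
      nlinarith [mul_nonneg hs.le (sq_nonneg (x * (x - 1)))]
    have h3 : (1 + coupling t) * x ^ 4 ≤ (1 + coupling t) * (4 * bulk t x + 2 * x ^ 2) := by
      nlinarith [mul_nonneg hs.le hb]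
    exact le_of_mul_le_mul_left h3 (by linarith)
  have hR : r ^ 2 ≤ R ^ 2 := pow_le_pow_left₀ h0 hr 2
  have hp := potential_nonneg ht r x
  have h4 : r ^ 2 * x ^ 4 ≤ r ^ 2 * (4 * bulk t x + 2 * x ^ 2) := by gcongr
  have h5 : 0 ≤ (R ^ 2 - r ^ 2) * potential t r x := mul_nonneg (by linarith) hp
  have h6 : 0 ≤ r ^ 2 * (potential t r x - 3 * x ^ 2) := by
    unfold potential
    have := bulk_nonneg ht x
    ring_nf; positivity
  have h7 : potential t r x = 3 * x ^ 2 + r ^ 2 * bulk t x := rfl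
  nlinarith [mul_nonneg (sq_nonneg r) (sq_nonneg x)]

section Integrability

variable {t R : ℝ} {p : ℝ → ℝ}

theorem FiniteEnergy.integrableOn_sq (ht : 0 < t) (h : FiniteEnergy t R p) :
    IntegrableOn (fun r => profile R p r ^ 2) (Ioc 0 R) := by
  refine h.integrableOn.mono' ((aestronglyMeasurable_profile h.memLp).pow 2)
    (Eventually.of_forall fun r => ?_)
  rw [Real.norm_of_nonneg (sq_nonneg _), potential]
  have := mul_nonneg (sq_nonneg r) (bulk_nonneg ht (profile R p r))
  nlinarith [sq_nonneg (profile R p r)]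

theorem FiniteEnergy.integrableOn_profile (ht : 0 < t) (h : FiniteEnergy t R p) :
    IntegrableOn (profile R p) (Ioc 0 R) := by
  have h1 : IntegrableOn (fun _ : ℝ => (1 : ℝ)) (Ioc 0 R) := by simp
  refine (h1.add (h.integrableOn_sq ht)).mono' (aestronglyMeasurable_profile h.memLp)
    (Eventually.of_forall fun r => ?_)
  rw [Real.norm_eq_abs, Pi.add_apply]
  nlinarith [sq_abs (profile R p r), sq_nonneg (|profile R p r| - 1)]

/-- `2|x|³ ≤ x² + x⁴`, and both weighted powers are integrable. -/
theorem FiniteEnergy.integrableOn_cube (ht : 0 < t) (h : FiniteEnergy t R p) :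
    IntegrableOn (fun r => r ^ 2 * profile R p r ^ 3) (Ioc 0 R) := by
  refine ((h.integrableOn.const_mul (4 + R ^ 2)).add
    ((h.integrableOn_sq ht).const_mul (R ^ 2))).mono'
    ((continuous_id.pow 2).aestronglyMeasurable.mul ((aestronglyMeasurable_profile h.memLp).pow 3)) ?_
  filter_upwards [ae_restrict_mem measurableSet_Ioc] with r hr
  have h1 := sq_mul_pow_four_le_potential ht hr.1.le hr.2 (profile R p r)
  have h2 : r ^ 2 ≤ R ^ 2 := pow_le_pow_left₀ hr.1.le hr.2 2
  have h3 : r ^ 2 * profile R p r ^ 2 ≤ R ^ 2 * profile R p r ^ 2 := by gcongr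
  simp only [Pi.add_apply]
  rw [Real.norm_eq_abs, abs_le]
  constructor <;>
  nlinarith [mul_nonneg (sq_nonneg r) (sq_nonneg (profile R p r * (profile R p r - 1))),
    mul_nonneg (sq_nonneg r) (sq_nonneg (profile R p r * (profile R p r + 1))),
    mul_nonneg (sq_nonneg r) (sq_nonneg (profile R p r)), sq_nonneg (r * profile R p r ^ 2)]

theorem integrableOn_sq_mul {f : ℝ → ℝ} (hf : IntegrableOn f (Ioc 0 R)) :
    IntegrableOn (fun r => r ^ 2 * f r) (Ioc 0 R) := by
  refine hf.bdd_mul (c := R ^ 2) ((continuous_id.pow 2).aestronglyMeasurable) ?_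
  filter_upwards [ae_restrict_mem measurableSet_Ioc] with r hr
  rw [norm_pow, Real.norm_of_nonneg hr.1.le]
  exact pow_le_pow_left₀ hr.1.le hr.2 2

theorem FiniteEnergy.integrableOn_force (ht : 0 < t) (h : FiniteEnergy t R p) :
    IntegrableOn (force t (profile R p)) (Ioc 0 R) := by
  have h1 := h.integrableOn_profile ht
  refine (((h1.const_mul 6).add ((integrableOn_sq_mul h1).neg)).add
    (((integrableOn_sq_mul (h.integrableOn_sq ht)).const_mul (-(3 * coupling t))).add
    ((h.integrableOn_cube ht).const_mul (1 + 3 * coupling t)))).congr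
    (Eventually.of_forall fun r => ?_)
  simp only [Pi.add_apply, Pi.neg_apply, force, bulkDeriv]; ring

/-- The energy along the line `p + λ q` is a polynomial in `λ`. -/
theorem FiniteEnergy.line (ht : 0 < t) (h : FiniteEnergy t R p) {q : ℝ → ℝ}
    (hq : MemLp q 2 (volume.restrict (Ioc 0 R))) {M : ℝ}
    (hM : ∀ r ∈ Ioc 0 R, |profile R q r - 1| ≤ M) :
    ∃ a b c : ℝ, ∀ l : ℝ, FiniteEnergy t R (p + l • q) ∧
      weightedEnergy t R (p + l • q) = weightedEnergy t R p
        + ((∫ r in Ioc 0 R, p r * q r) + ∫ r in Ioc 0 R, (profile R q r - 1) *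
          force t (profile R p) r) * l + a * l ^ 2 + b * l ^ 3 + c * l ^ 4 := by
  set y : ℝ → ℝ := fun r => profile R q r - 1 with hy
  have hym : AEStronglyMeasurable y (volume.restrict (Ioc 0 R)) :=
    (aestronglyMeasurable_profile hq).sub aestronglyMeasurable_const
  have hyb : ∀ n : ℕ, ∀ᵐ r ∂volume.restrict (Ioc 0 R), ‖y r ^ n‖ ≤ M ^ n := fun n => by
    filter_upwards [ae_restrict_mem measurableSet_Ioc] with r hr
    rw [norm_pow]
    exact pow_le_pow_left₀ (norm_nonneg _) (hM r hr) n
  have hprof : ∀ l : ℝ, ∀ r ∈ Ioc 0 R, profile R (p + l • q) r = profile R p r + l * y r := by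
    intro l r hr
    have e : ∀ s, (p + l • q) s / s = p s / s + l * (q s / s) := fun s => by
      simp only [Pi.add_apply, Pi.smul_apply, smul_eq_mul]; ring
    simp only [hy, profile, e]
    rw [intervalIntegral.integral_add (intervalIntegrable_div_id hr.1 hr.2 le_rfl h.memLp)
      ((intervalIntegrable_div_id hr.1 hr.2 le_rfl hq).const_mul l),
      intervalIntegral.integral_const_mul]
    ring
  have one : IntegrableOn (fun _ : ℝ => (1 : ℝ)) (Ioc 0 R) := by simp
  have h1 := h.integrableOn_profile ht
  have i1 : IntegrableOn (fun r => y r * force t (profile R p) r) (Ioc 0 R) := by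
    refine (h.integrableOn_force ht).bdd_mul hym (c := M) ?_
    filter_upwards [hyb 1] with r hr using by simpa using hr
  have i2 : IntegrableOn (fun r => y r ^ 2 * (3 + r ^ 2 * (-1 / 2 - 3 * coupling t * profile R p r
        + 3 / 2 * (1 + 3 * coupling t) * profile R p r ^ 2))) (Ioc 0 R) := by
    refine Integrable.bdd_mul ?_ (hym.pow 2) (hyb 2)
    exact (one.const_mul 3 |>.add (integrableOn_sq_mul (((one.const_mul (-1 / 2)).sub
      (h1.const_mul (3 * coupling t))).add ((h.integrableOn_sq ht).const_mul
      (3 / 2 * (1 + 3 * coupling t)))))).congr (Eventually.of_forall fun r => by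
        simp only [Pi.add_apply, Pi.sub_apply]; ring)
  have i3 : IntegrableOn (fun r => y r ^ 3 * (r ^ 2 * (-coupling t + (1 + 3 * coupling t) *
      profile R p r))) (Ioc 0 R) := by
    refine Integrable.bdd_mul ?_ (hym.pow 3) (hyb 3)
    exact (integrableOn_sq_mul ((one.const_mul (-coupling t)).add
      (h1.const_mul (1 + 3 * coupling t)))).congr (Eventually.of_forall fun r => by
        simp only [Pi.add_apply]; ring)
  have i4 : IntegrableOn (fun r => y r ^ 4 * (r ^ 2 * ((1 + 3 * coupling t) / 4))) (Ioc 0 R) := by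
    refine Integrable.bdd_mul ?_ (hym.pow 4) (hyb 4)
    exact integrableOn_sq_mul ((one.const_mul ((1 + 3 * coupling t) / 4)).congr
      (Eventually.of_forall fun r => by simp))
  refine ⟨(∫ r in Ioc 0 R, q r ^ 2) / 2 + ∫ r in Ioc 0 R, y r ^ 2 * (3 + r ^ 2 * (-1 / 2 -
    3 * coupling t * profile R p r + 3 / 2 * (1 + 3 * coupling t) * profile R p r ^ 2)),
    ∫ r in Ioc 0 R, y r ^ 3 * (r ^ 2 * (-coupling t + (1 + 3 * coupling t) * profile R p r)),
    ∫ r in Ioc 0 R, y r ^ 4 * (r ^ 2 * ((1 + 3 * coupling t) / 4)), fun l => ?_⟩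
  have hexp : ∀ r ∈ Ioc 0 R, potential t r (profile R (p + l • q) r) = _ := fun r hr => by
    rw [hprof l r hr, potential_add ht]
  obtain ⟨j1, j2⟩ := integral_quartic h.integrableOn i1 i2 i3 i4 l
  refine ⟨⟨h.memLp.add (hq.const_smul l), j1.congr ?_⟩, ?_⟩
  · filter_upwards [ae_restrict_mem measurableSet_Ioc] with r hr
    rw [hexp r hr]; rfl
  · have e1 := (setIntegral_congr_fun measurableSet_Ioc hexp).trans j2
    have hp2 := h.memLp.integrable_sq
    have hq2 := hq.integrable_sq
    have hpq := h.memLp.integrable_mul hq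
    have e2 : ∫ r in Ioc 0 R, (p + l • q) r ^ 2 = (∫ r in Ioc 0 R, p r ^ 2) +
        2 * l * (∫ r in Ioc 0 R, p r * q r) + l ^ 2 * ∫ r in Ioc 0 R, q r ^ 2 := by
      have e := integral_add' (hp2.add (hpq.const_mul (2 * l))) (hq2.const_mul (l ^ 2))
      rw [integral_add' hp2 (hpq.const_mul (2 * l))] at e
      simp only [integral_const_mul] at e
      refine Eq.trans (integral_congr_ae (Eventually.of_forall fun r => ?_)) e
      simp only [Pi.add_apply, Pi.smul_apply, Pi.mul_apply, smul_eq_mul]; ring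
    rw [weightedEnergy, weightedEnergy, e1, e2]
    ring

end Integrability

/-- The Euler–Lagrange equation of the weighted problem, including the natural boundary condition
at the origin. -/
theorem IsWeightedMinimizer.ae_eq_flux {t R : ℝ} (ht : 0 < t) (hR : 0 < R) {p : ℝ → ℝ}
    (h : IsWeightedMinimizer t R p) :
    ∀ᵐ s ∂volume.restrict (Ioc 0 R), s * p s = flux t (profile R p) s := by
  set μ := volume.restrict (Ioc 0 R) with hμ
  have hk := h.1.integrableOn_force ht
  have hp1 : IntegrableOn p (Ioc 0 R) := h.1.memLp.integrable (by norm_num)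
  have hsp : Integrable (fun s => s * p s) μ := by
    refine hp1.bdd_mul (c := R) continuous_id.aestronglyMeasurable ?_
    filter_upwards [ae_restrict_mem measurableSet_Ioc] with r hr
    rw [Real.norm_of_nonneg hr.1.le]; exact hr.2
  have hflux : ContinuousOn (flux t (profile R p)) (Icc 0 R) := by
    have := intervalIntegral.continuousOn_primitive_interval' (a := 0)
      ((intervalIntegrable_iff_integrableOn_Ioc_of_le hR.le).2 hk) left_mem_uIcc
    rwa [uIcc_of_le hR.le] at this
  have hfi : Integrable (flux t (profile R p)) μ :=
    hflux.integrableOn_Icc.mono_set Ioc_subset_Icc_self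
  suffices hae : (fun s => s * p s - flux t (profile R p) s) =ᵐ[μ] 0 by
    filter_upwards [hae] with s hs using sub_eq_zero.1 hs
  refine (hsp.sub hfi).ae_eq_zero_of_forall_setIntegral_eq_zero fun A hA _ => ?_
  -- The factor `s` cancels the weight: `q/s = 1_A`, so the profile moves by minus the measure of `A
  -- ∩ (r, R]`, which is at most `R`.
  set q : ℝ → ℝ := A.indicator fun s => s with hqdef
  have hq : MemLp q 2 μ := by
    refine MemLp.of_bound (measurable_id.indicator hA).aestronglyMeasurable R ?_
    filter_upwards [ae_restrict_mem measurableSet_Ioc] with r hr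
    by_cases hrA : r ∈ A
    · rw [hqdef, indicator_of_mem hrA, Real.norm_of_nonneg hr.1.le]; exact hr.2
    · rw [hqdef, indicator_of_notMem hrA, norm_zero]; exact hR.le
  have hone : IntegrableOn (A.indicator fun _ => (1 : ℝ)) (Ioc 0 R) := by
    refine Integrable.indicator ?_ hA; simp
  have hprof : ∀ r ∈ Ioc 0 R, profile R q r - 1 = -∫ s in r..R, A.indicator (fun _ => (1 : ℝ)) s := by
    intro r hr
    rw [profile, sub_sub_cancel_left]
    congr 1
    refine intervalIntegral.integral_congr_ae (Eventually.of_forall fun s hs => ?_)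
    rw [uIoc_of_le hr.2] at hs
    have : s ≠ 0 := (hr.1.trans hs.1).ne'
    by_cases hsA : s ∈ A <;> simp [hqdef, hsA, this]
  obtain ⟨a, b, c, hline⟩ := h.1.line ht hq (M := R) fun r hr => by
    rw [hprof r hr, abs_neg]
    have := intervalIntegral.norm_integral_le_of_norm_le_const (a := r) (b := R) (C := 1)
      (f := A.indicator fun _ => (1 : ℝ)) fun s _ => by
        by_cases hsA : s ∈ A <;> simp [hsA]
    rw [Real.norm_eq_abs, one_mul, abs_of_nonneg (a := R - r) (sub_nonneg.2 hr.2)] at this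
    linarith [hr.1]
  -- Along `p + l q` the energy is a quartic in `l` minimal at `l = 0`, so its linear coefficient
  -- vanishes.
  have hz : (∫ r in Ioc 0 R, p r * q r) + ∫ r in Ioc 0 R, (profile R q r - 1) *
      force t (profile R p) r = 0 := by
    refine eq_zero_of_forall_quartic_nonneg (b := a) (c := b) (d := c) fun l => ?_
    have h1 := h.2 _ (hline l).1
    rw [(hline l).2] at h1
    linarith
  -- Fubini moves the inner integral from `1_A` to the force and produces the flux, which starts at
  -- `0`.
  have hF := integral_mul_integral_right_eq hR.le hk hone
  rw [intervalIntegral.integral_of_le hR.le, intervalIntegral.integral_of_le hR.le] at hF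
  have e1 : ∫ r in Ioc 0 R, p r * q r = ∫ s in A, s * p s ∂μ := by
    rw [← integral_indicator hA]
    refine integral_congr_ae (Eventually.of_forall fun s => ?_)
    by_cases hsA : s ∈ A <;> simp [hqdef, hsA, mul_comm]
  have e2 : ∫ r in Ioc 0 R, (profile R q r - 1) * force t (profile R p) r =
      -∫ s in A, flux t (profile R p) s ∂μ := by
    rw [← integral_indicator hA]
    calc _ = -∫ r in Ioc 0 R, force t (profile R p) r *
          ∫ s in r..R, A.indicator (fun _ => (1 : ℝ)) s := by
          rw [← integral_neg]
          refine setIntegral_congr_fun measurableSet_Ioc fun r hr => ?_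
          simp only [hprof r hr]; ring
      _ = _ := by
          rw [hF]; congr 1
          refine integral_congr_ae (Eventually.of_forall fun s => ?_)
          by_cases hsA : s ∈ A <;> simp [hsA, flux]
  simp only [Pi.sub_apply]
  rw [integral_sub hsp.integrableOn hfi.integrableOn]
  linarith [hz, e1, e2]

/-- Continuous solutions on `(0, R]` of the integrated Euler–Lagrange equation
`r² h' = ∫₀ʳ (6 h + s² f'(h)) ds` with `h(R) = 1`. -/
structure IsRadialSolution (t R : ℝ) (h : ℝ → ℝ) : Prop where
  continuousOn : ContinuousOn h (Ioc 0 R)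
  boundary : h R = 1
  integrableOn_force : IntegrableOn (force t h) (Ioc 0 R)
  sub_eq : ∀ a b, 0 < a → a ≤ b → b ≤ R → h b - h a = ∫ s in a..b, flux t h s / s ^ 2

theorem IsWeightedMinimizer.isRadialSolution {t R : ℝ} (ht : 0 < t) (hR : 0 < R) {p : ℝ → ℝ}
    (h : IsWeightedMinimizer t R p) : IsRadialSolution t R (profile R p) := by
  refine ⟨continuousOn_profile h.1.memLp, profile_right R p, h.1.integrableOn_force ht,
    fun a b ha hab hb => ?_⟩
  rw [profile_sub_profile ha hab hb h.1.memLp]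
  refine intervalIntegral.integral_congr_ae ?_
  have := h.ae_eq_flux ht hR
  rw [ae_restrict_iff' measurableSet_Ioc] at this
  filter_upwards [this] with s hs hs'
  rw [uIoc_of_le hab] at hs'
  have h0 : 0 < s := ha.trans hs'.1
  rw [← hs ⟨h0, hs'.2.trans hb⟩]
  field_simp

end Hedgehog

/-! ### Maximum principle and regularity of `h/r²` at the origin. -/

namespace Hedgehog

open Filter Topology
open scoped ENNReal

/-- The factors show the signs used by the maximum principle: positive for `x > 1`, negative for `x
< -1`. -/
theorem bulkDeriv_eq (t x : ℝ) :
    bulkDeriv t x = x * (x - 1) * ((1 + 3 * coupling t) * x + 1) := by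
  unfold bulkDeriv; ring

theorem continuous_bulkDeriv (t : ℝ) : Continuous (bulkDeriv t) := by
  unfold bulkDeriv; fun_prop

theorem abs_bulkDeriv_le {t : ℝ} (ht : 0 < t) {x : ℝ} (hx : |x| ≤ 1) :
    |bulkDeriv t x| ≤ (2 * (2 + 3 * coupling t)) * |x| := by
  have hs := coupling_pos ht
  have h1 : |x - 1| ≤ 2 := by rw [abs_le] at *; constructor <;> linarith [hx.1, hx.2]
  have h2 : |(1 + 3 * coupling t) * x + 1| ≤ 2 + 3 * coupling t := by
    rw [abs_le] at *; constructor <;> nlinarith [hx.1, hx.2]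
  rw [bulkDeriv_eq, abs_mul, abs_mul]
  calc |x| * |x - 1| * |(1 + 3 * coupling t) * x + 1| ≤ |x| * 2 * (2 + 3 * coupling t) := by gcongr
    _ = _ := by ring

/-- A weak maximum principle for `(r² h')' = k` with vanishing flux at the origin. -/
theorem le_of_force_pos {R M : ℝ} {h k : ℝ → ℝ} (hc : ContinuousOn h (Ioc 0 R))
    (hk : IntegrableOn k (Ioc 0 R))
    (heq : ∀ a b, 0 < a → a ≤ b → b ≤ R →
      h b - h a = ∫ s in a..b, (∫ τ in (0 : ℝ)..s, k τ) / s ^ 2)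
    (hR : h R ≤ M) (hpos : ∀ r ∈ Ioc 0 R, M < h r → 0 < k r) : ∀ r ∈ Ioc 0 R, h r ≤ M := by
  intro r₀ hr₀
  by_contra! hgt
  set K : ℝ → ℝ := fun s => ∫ τ in (0 : ℝ)..s, k τ with hK
  have hki : ∀ a b, 0 ≤ a → a ≤ b → b ≤ R → IntervalIntegrable k volume a b := fun a b ha hab hb =>
    (intervalIntegrable_iff_integrableOn_Ioc_of_le hab).2 (hk.mono_set (Ioc_subset_Ioc ha hb))
  have hKsub : ∀ a b, 0 ≤ a → a ≤ b → b ≤ R → K b - K a = ∫ s in a..b, k s := fun a b ha hab hb => by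
    simp only [hK]
    rw [← intervalIntegral.integral_add_adjacent_intervals (hki 0 a le_rfl ha (hab.trans hb))
      (hki a b ha hab hb)]
    ring
  have hmono : ∀ a b, 0 < a → a ≤ b → b ≤ R → (∀ x ∈ Ioc a b, M < h x) → K a ≤ K b := by
    intro a b ha hab hb hx
    rw [← sub_nonneg, hKsub a b ha.le hab hb]
    refine intervalIntegral.integral_nonneg_of_ae_restrict hab ?_
    rw [EventuallyLE, ae_restrict_iff' measurableSet_Icc]
    have hne : ∀ᵐ x : ℝ, x ≠ a := by simp [ae_iff]
    filter_upwards [hne] with x hxa hx'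
    have hxm : x ∈ Ioc a b := ⟨lt_of_le_of_ne hx'.1 (Ne.symm hxa), hx'.2⟩
    exact (hpos x ⟨ha.trans hxm.1, hxm.2.trans hb⟩ (hx x hxm)).le
  have hclosed : ∀ a b, 0 < a → b ≤ R → IsCompact (Icc a b ∩ h ⁻¹' Iic M) := fun a b ha hb =>
    isCompact_Icc.of_isClosed_subset ((hc.mono fun x hx => ⟨ha.trans_le hx.1, hx.2.trans hb⟩
      : ContinuousOn h (Icc a b)).preimage_isClosed_of_isClosed isClosed_Icc isClosed_Iic)
      inter_subset_left
  -- If the flux were nonnegative at `r₀`, then `h` could not decrease while above `M`, and so could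
  -- not come back below `M` at the next contact point `b`.
  have hneg : K r₀ < 0 := by
    by_contra! hK0
    have hne : (Icc r₀ R ∩ h ⁻¹' Iic M).Nonempty := ⟨R, ⟨hr₀.2, le_rfl⟩, hR⟩
    set b := sInf (Icc r₀ R ∩ h ⁻¹' Iic M) with hb
    obtain ⟨⟨hb1, hb2⟩, hb3⟩ := (hclosed r₀ R hr₀.1 le_rfl).sInf_mem hne
    have hbd := (hclosed r₀ R hr₀.1 le_rfl).bddBelow
    have hlt : ∀ x ∈ Ico r₀ b, M < h x := fun x hx => by
      by_contra! hxM
      exact absurd (csInf_le hbd ⟨⟨hx.1, hx.2.le.trans hb2⟩, hxM⟩) (not_le.2 hx.2)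
    have h1 : 0 ≤ h b - h r₀ := by
      rw [heq r₀ b hr₀.1 hb1 hb2]
      refine intervalIntegral.integral_nonneg_of_ae_restrict hb1 ?_
      rw [EventuallyLE, ae_restrict_iff' measurableSet_Icc]
      have hne : ∀ᵐ x : ℝ, x ≠ b := by simp [ae_iff]
      filter_upwards [hne] with x hxb hx
      have hxb' : x < b := lt_of_le_of_ne hx.2 hxb
      exact div_nonneg (hK0.trans (hmono r₀ x hr₀.1 hx.1 (hxb'.le.trans hb2) fun y hy =>
        hlt y ⟨hy.1.le, hy.2.trans_lt hxb'⟩)) (sq_nonneg x)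
    have h2 : h b ≤ M := hb3
    linarith
  -- Going left the flux only becomes more negative while `h > M`, so `h` is at least `h r₀` there
  -- and never reaches `M`.
  have hall : ∀ x ∈ Ioc 0 r₀, M < h x := by
    intro x₁ hx₁
    by_contra! hle
    have hne : (Icc x₁ r₀ ∩ h ⁻¹' Iic M).Nonempty := ⟨x₁, ⟨le_rfl, hx₁.2⟩, hle⟩
    set a := sSup (Icc x₁ r₀ ∩ h ⁻¹' Iic M) with ha
    obtain ⟨⟨ha1, ha2⟩, ha3⟩ := (hclosed x₁ r₀ hx₁.1 hr₀.2).sSup_mem hne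
    have hbd := (hclosed x₁ r₀ hx₁.1 hr₀.2).bddAbove
    have ha0 : 0 < a := hx₁.1.trans_le ha1
    have hlt : ∀ x ∈ Ioc a r₀, M < h x := fun x hx => by
      by_contra! hxM
      exact absurd (le_csSup hbd ⟨⟨ha1.trans hx.1.le, hx.2⟩, hxM⟩) (not_le.2 hx.1)
    have h1 : 0 ≤ -(h r₀ - h a) := by
      rw [heq a r₀ ha0 ha2 hr₀.2, ← intervalIntegral.integral_neg]
      refine intervalIntegral.integral_nonneg ha2 fun x hx => ?_
      rw [neg_nonneg]
      exact div_nonpos_of_nonpos_of_nonneg ((hmono x r₀ (ha0.trans_le hx.1) hx.2 hr₀.2 fun y hy =>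
        hlt y ⟨hx.1.trans_lt hy.1, hy.2⟩).trans hneg.le) (sq_nonneg x)
    have h2 : h a ≤ M := ha3
    linarith
  -- The force is then positive on all of `(0, r₀]`, and the flux is its integral from `0`: this
  -- contradicts `hneg`.
  have : 0 ≤ K r₀ := by
    simp only [hK]
    rw [intervalIntegral.integral_of_le hr₀.1.le]
    exact setIntegral_nonneg measurableSet_Ioc fun x hx =>
      (hpos x ⟨hx.1, hx.2.trans hr₀.2⟩ (hall x hx)).le
  linarith

namespace IsRadialSolution

variable {t R : ℝ} {h : ℝ → ℝ}

theorem le_one (ht : 0 < t) (S : IsRadialSolution t R h) : ∀ r ∈ Ioc 0 R, h r ≤ 1 := by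
  have hs := coupling_pos ht
  refine le_of_force_pos S.continuousOn S.integrableOn_force S.sub_eq S.boundary.le fun r _ h1 => ?_
  have : 0 < bulkDeriv t (h r) := by
    rw [bulkDeriv_eq]
    have h2 : 0 < h r - 1 := by linarith
    have h3 : 0 < h r := by linarith
    positivity
  unfold force; positivity

/-- The maximum principle is applied to `-h`. This crude lower bound holds for every solution;
nonnegativity will need minimality. -/
theorem neg_one_le (ht : 0 < t) (S : IsRadialSolution t R h) : ∀ r ∈ Ioc 0 R, -1 ≤ h r := by
  have hs := coupling_pos ht
  intro r hr
  have key := le_of_force_pos (R := R) (M := 1) (h := fun r => -h r) (k := fun r => -force t h r)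
    S.continuousOn.neg S.integrableOn_force.neg (fun a b ha hab hb => by
      have := S.sub_eq a b ha hab hb
      have e : ∀ s, (∫ τ in (0 : ℝ)..s, -force t h τ) / s ^ 2 = -(flux t h s / s ^ 2) := fun s => by
        rw [intervalIntegral.integral_neg, flux, neg_div]
      simp only [e]
      rw [intervalIntegral.integral_neg, ← this]; ring) (by simp [S.boundary]) (fun r _ h1 => by
      have h2 : 0 < -h r := by linarith
      have h3 : 0 < 1 - h r := by linarith
      have h4 : 0 < -((1 + 3 * coupling t) * h r + 1) := by nlinarith
      have : 0 < -bulkDeriv t (h r) := by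
        have e : -bulkDeriv t (h r) = (-h r) * (1 - h r) * (-((1 + 3 * coupling t) * h r + 1)) := by
          rw [bulkDeriv_eq]; ring
        rw [e]; positivity
      have e : -force t h r = 6 * (-h r) + r ^ 2 * (-bulkDeriv t (h r)) := by unfold force; ring
      rw [e]; positivity) r hr
  linarith

theorem abs_le_one (ht : 0 < t) (S : IsRadialSolution t R h) : ∀ r ∈ Ioc 0 R, |h r| ≤ 1 :=
  fun r hr => abs_le.2 ⟨S.neg_one_le ht r hr, S.le_one ht r hr⟩

theorem continuousOn_force (S : IsRadialSolution t R h) : ContinuousOn (force t h) (Ioc 0 R) :=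
  (S.continuousOn.const_mul 6).add
    ((continuous_id.pow 2).continuousOn.mul ((continuous_bulkDeriv t).comp_continuousOn S.continuousOn))

theorem continuousOn_flux (hR : 0 < R) (S : IsRadialSolution t R h) :
    ContinuousOn (flux t h) (Icc 0 R) := by
  have := intervalIntegral.continuousOn_primitive_interval' (a := 0)
    ((intervalIntegrable_iff_integrableOn_Ioc_of_le hR.le).2 S.integrableOn_force) left_mem_uIcc
  rwa [uIcc_of_le hR.le] at this

theorem hasDerivAt_flux (S : IsRadialSolution t R h) {r : ℝ} (hr : r ∈ Ioo 0 R) :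
    HasDerivAt (flux t h) (force t h r) r := by
  have hc : ContinuousOn (force t h) (Ioo 0 R) := S.continuousOn_force.mono Ioo_subset_Ioc_self
  refine intervalIntegral.integral_hasDerivAt_right ?_
    (hc.stronglyMeasurableAtFilter isOpen_Ioo r hr) (hc.continuousAt (isOpen_Ioo.mem_nhds hr))
  exact (intervalIntegrable_iff_integrableOn_Ioc_of_le hr.1.le).2
    (S.integrableOn_force.mono_set (Ioc_subset_Ioc_right hr.2.le))

theorem hasDerivAt (S : IsRadialSolution t R h) {r : ℝ} (hr : r ∈ Ioo 0 R) :
    HasDerivAt h (flux t h r / r ^ 2) r := by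
  have hR : 0 < R := hr.1.trans hr.2
  have hc : ContinuousOn (fun s => flux t h s / s ^ 2) (Ioc 0 R) :=
    ((S.continuousOn_flux hR).mono Ioc_subset_Icc_self).div (continuous_id.pow 2).continuousOn
      fun x hx => pow_ne_zero 2 hx.1.ne'
  have hc' := hc.mono Ioo_subset_Ioc_self
  have ha : 0 < r / 2 := half_pos hr.1
  have hd : HasDerivAt (fun x => ∫ s in (r / 2)..x, flux t h s / s ^ 2) (flux t h r / r ^ 2) r := by
    refine intervalIntegral.integral_hasDerivAt_right ?_
      (hc'.stronglyMeasurableAtFilter isOpen_Ioo r hr) (hc'.continuousAt (isOpen_Ioo.mem_nhds hr))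
    refine ContinuousOn.intervalIntegrable (hc.mono ?_)
    rw [uIcc_of_le (by linarith [hr.1])]
    exact fun x hx => ⟨ha.trans_le hx.1, hx.2.trans hr.2.le⟩
  refine (hd.const_add (h (r / 2))).congr_of_eventuallyEq ?_
  filter_upwards [Ioo_mem_nhds (show r / 2 < r by linarith [hr.1]) hr.2] with x hx
  rw [← S.sub_eq (r / 2) x ha hx.1.le hx.2.le]; ring

/-- In terms of `w = h / r²` the equation reads `(r⁶ w')' = r⁴ f'(h)`, and `r⁶ w'` vanishes at the
origin. -/
theorem integral_pow_four_mul_bulkDeriv (ht : 0 < t) (S : IsRadialSolution t R h) {r : ℝ}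
    (hr : r ∈ Ioo 0 R) :
    ∫ s in (0 : ℝ)..r, s ^ 4 * bulkDeriv t (h s) = r ^ 2 * flux t h r - 2 * r ^ 3 * h r := by
  have hR : 0 < R := hr.1.trans hr.2
  -- This primitive is `r⁶ w'`, written without dividing by `r`.
  have hd : ∀ x ∈ Ioo 0 R, HasDerivAt (fun r => r ^ 2 * flux t h r - 2 * r ^ 3 * h r)
      (x ^ 4 * bulkDeriv t (h x)) x := by
    intro x hx
    have hx0 : x ≠ 0 := hx.1.ne'
    have h1 := ((hasDerivAt_pow 2 x).mul (S.hasDerivAt_flux hx)).sub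
      (((hasDerivAt_pow 3 x).const_mul 2).mul (S.hasDerivAt hx))
    refine h1.congr_deriv ?_
    simp only [force]
    field_simp
    ring
  have hb := S.abs_le_one ht
  -- The singular mode `r⁻³` would leave a nonzero constant here; boundedness of `h` excludes it.
  have hlim : Tendsto (fun r => r ^ 2 * flux t h r - 2 * r ^ 3 * h r) (𝓝[>] 0) (𝓝 0) := by
    have hf : Tendsto (flux t h) (𝓝[>] 0) (𝓝 (flux t h 0)) :=
      ((S.continuousOn_flux hR 0 ⟨le_rfl, hR.le⟩).mono_of_mem_nhdsWithin
        (mem_of_superset (Ioo_mem_nhdsGT hR) Ioo_subset_Icc_self))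
    have hpow : ∀ n : ℕ, n ≠ 0 → Tendsto (fun r : ℝ => r ^ n) (𝓝[>] 0) (𝓝 0) := fun n hn => by
      have := ((continuous_pow n : Continuous fun r : ℝ => r ^ n).tendsto 0).mono_left
        (nhdsWithin_le_nhds (s := Ioi 0))
      simpa [hn] using this
    have h1 := (hpow 2 two_ne_zero).mul hf
    have h2 : Tendsto (fun r => 2 * r ^ 3 * h r) (𝓝[>] 0) (𝓝 0) := by
      have h3 := (hpow 3 three_ne_zero).const_mul 2
      rw [mul_zero] at h3
      refine squeeze_zero_norm' ?_ h3
      filter_upwards [Ioo_mem_nhdsGT hR] with x hx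
      have hx' := hb x ⟨hx.1, hx.2.le⟩
      have h0 : 0 ≤ 2 * x ^ 3 := by have := hx.1; positivity
      rw [norm_mul, Real.norm_of_nonneg h0, Real.norm_eq_abs]
      exact mul_le_of_le_one_right h0 hx'
    simpa using h1.sub h2
  have hint : IntervalIntegrable (fun s => s ^ 4 * bulkDeriv t (h s)) volume 0 r := by
    rw [intervalIntegrable_iff_integrableOn_Ioc_of_le hr.1.le]
    have hsub : Ioc 0 r ⊆ Ioc 0 R := Ioc_subset_Ioc_right hr.2.le
    have hcont : ContinuousOn (fun s => s ^ 4 * bulkDeriv t (h s)) (Ioc 0 r) :=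
      (continuous_pow 4).continuousOn.mul
        ((continuous_bulkDeriv t).comp_continuousOn (S.continuousOn.mono hsub))
    refine IntegrableOn.of_bound (by simp)
      (hcont.aestronglyMeasurable measurableSet_Ioc) (r ^ 4 * (2 * (2 + 3 * coupling t))) ?_
    filter_upwards [ae_restrict_mem measurableSet_Ioc] with x hx
    have h1 := abs_bulkDeriv_le ht (hb x (hsub hx))
    have hs := coupling_pos ht
    rw [norm_mul, norm_pow, Real.norm_of_nonneg hx.1.le, Real.norm_eq_abs]
    have h2 : |bulkDeriv t (h x)| ≤ 2 * (2 + 3 * coupling t) :=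
      h1.trans (mul_le_of_le_one_right (by positivity) (hb x (hsub hx)))
    have := hx.1
    gcongr
    exact hx.2
  rw [intervalIntegral.integral_eq_sub_of_hasDerivAt_of_tendsto hr.1
    (fun x hx => hd x ⟨hx.1, hx.2.trans hr.2⟩) hint hlim
    ((hd r hr).continuousAt.tendsto.mono_left nhdsWithin_le_nhds), sub_zero]

theorem hasDerivAt_div_sq (ht : 0 < t) (S : IsRadialSolution t R h) {r : ℝ} (hr : r ∈ Ioo 0 R) :
    HasDerivAt (fun r => h r / r ^ 2) ((∫ s in (0 : ℝ)..r, s ^ 4 * bulkDeriv t (h s)) / r ^ 6) r := by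
  have hr0 : r ≠ 0 := hr.1.ne'
  refine ((S.hasDerivAt hr).div (hasDerivAt_pow 2 r) (pow_ne_zero 2 hr0)).congr_deriv ?_
  rw [S.integral_pow_four_mul_bulkDeriv ht hr]
  field_simp
  ring

/-- The bound `B` is kept free for the bootstrap: first `B = 1`, then `B` proportional to `r`. -/
theorem abs_integral_pow_four_le (ht : 0 < t) (S : IsRadialSolution t R h) {r B : ℝ}
    (hr : r ∈ Ioo 0 R) (hB : ∀ s ∈ Ioc 0 r, |h s| ≤ B) :
    |∫ s in (0 : ℝ)..r, s ^ 4 * bulkDeriv t (h s)| ≤ 2 * (2 + 3 * coupling t) * B * r ^ 5 := by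
  have hs := coupling_pos ht
  have := intervalIntegral.norm_integral_le_of_norm_le_const (a := 0) (b := r)
    (f := fun s => s ^ 4 * bulkDeriv t (h s)) (C := r ^ 4 * (2 * (2 + 3 * coupling t) * B)) fun x hx => by
      rw [uIoc_of_le hr.1.le] at hx
      have h1 := abs_bulkDeriv_le ht (S.abs_le_one ht x ⟨hx.1, hx.2.trans hr.2.le⟩)
      rw [norm_mul, norm_pow, Real.norm_of_nonneg hx.1.le, Real.norm_eq_abs]
      have h2 : |bulkDeriv t (h x)| ≤ 2 * (2 + 3 * coupling t) * B :=
        h1.trans (mul_le_mul_of_nonneg_left (hB x hx) (by positivity))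
      have := hx.1
      gcongr
      exact hx.2
  rw [sub_zero, abs_of_pos hr.1, Real.norm_eq_abs] at this
  linarith

/-- The nonlinearity in the equation for `w = h / r²`. -/
noncomputable def _root_.Hedgehog.quotientForce (t : ℝ) (w : ℝ → ℝ) (r : ℝ) : ℝ :=
  -w r - 3 * coupling t * r ^ 2 * w r ^ 2 + (1 + 3 * coupling t) * r ^ 4 * w r ^ 3

/-- The quotient `w = h / r²` is continuous up to the origin and solves a regular integral
equation. -/
theorem exists_quotient (ht : 0 < t) (hR : 0 < R) (S : IsRadialSolution t R h) :
    ∃ r₁ ∈ Ioo 0 R, ∃ w : ℝ → ℝ, ContinuousOn w (Icc 0 r₁) ∧ (∀ r ∈ Ioc 0 r₁, h r = r ^ 2 * w r) ∧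
      ∀ r ∈ Icc 0 r₁, w r = w 0 + r ^ 2 * ∫ x in (0 : ℝ)..1, x ^ 1 *
        ∫ y in (0 : ℝ)..1, y ^ 6 * quotientForce t w (r * (x * y)) := by
  have hs := coupling_pos ht
  set M := 2 * (2 + 3 * coupling t) with hM
  have hM0 : 0 < M := by positivity
  -- Any radius strictly inside `(0, R)` would do.
  set r₁ := R / 2 with hr₁
  have hr₁R : r₁ ∈ Ioo 0 R := ⟨by positivity, by rw [hr₁]; linarith⟩
  have hsub : Ioc 0 r₁ ⊆ Ioo 0 R := fun x hx => ⟨hx.1, hx.2.trans_lt hr₁R.2⟩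
  set F : ℝ → ℝ := fun r => ∫ s in (0 : ℝ)..r, s ^ 4 * bulkDeriv t (h s) with hF
  have hFc : ContinuousOn (fun r => F r / r ^ 6) (Ioc 0 r₁) := by
    have h1 : ContinuousOn (fun r => (r ^ 2 * flux t h r - 2 * r ^ 3 * h r) / r ^ 6) (Ioc 0 r₁) := by
      refine ContinuousOn.div (((continuous_pow 2).continuousOn.mul
        ((S.continuousOn_flux hR).mono fun x hx => ⟨hx.1.le, (hsub hx).2.le⟩)).sub
        ((continuous_const.mul (continuous_pow 3)).continuousOn.mul
        (S.continuousOn.mono (hsub.trans Ioo_subset_Ioc_self)))) (continuous_pow 6).continuousOn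
        fun x hx => pow_ne_zero 6 hx.1.ne'
    refine h1.congr fun x hx => ?_
    simp only [hF]
    rw [S.integral_pow_four_mul_bulkDeriv ht (hsub hx)]
  have hdiff : ∀ r ∈ Ioc 0 r₁, h r₁ / r₁ ^ 2 - h r / r ^ 2 = ∫ s in r..r₁, F s / s ^ 6 := by
    intro r hr
    have hss : Icc r r₁ ⊆ Ioc 0 r₁ := fun x hx => ⟨hr.1.trans_le hx.1, hx.2⟩
    refine (intervalIntegral.integral_eq_sub_of_hasDerivAt (f := fun r => h r / r ^ 2)
      (fun x hx => ?_) ?_).symm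
    · rw [uIcc_of_le hr.2] at hx
      exact S.hasDerivAt_div_sq ht (hsub (hss hx))
    · refine ContinuousOn.intervalIntegrable ?_
      rw [uIcc_of_le hr.2]; exact hFc.mono hss
  have hF1 : ∀ s ∈ Ioc 0 r₁, |F s| ≤ M * s ^ 5 := fun s hs' => by
    have := S.abs_integral_pow_four_le ht (hsub hs') (B := 1) fun x hx =>
      S.abs_le_one ht x ⟨hx.1, hx.2.trans (hsub hs').2.le⟩
    simpa [hM] using this
  set C := |h r₁ / r₁ ^ 2| * r₁ + M * r₁ with hC
  -- From `|h| ≤ 1` follows `|w'| ≤ M/s`; estimating `1/s` crudely by `1/r` already gives linear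
  -- decay of `h`.
  have hlin : ∀ r ∈ Ioc 0 r₁, |h r| ≤ C * r := by
    intro r hr
    have hr0 := hr.1
    have h1 : |∫ s in r..r₁, F s / s ^ 6| ≤ M / r * r₁ := by
      have := intervalIntegral.norm_integral_le_of_norm_le_const (a := r) (b := r₁)
        (f := fun s => F s / s ^ 6) (C := M / r) fun s hs' => by
          rw [uIoc_of_le hr.2] at hs'
          have hs0 : 0 < s := hr.1.trans hs'.1
          rw [norm_div, norm_pow, Real.norm_of_nonneg hs0.le, Real.norm_eq_abs]
          calc |F s| / s ^ 6 ≤ M * s ^ 5 / s ^ 6 := by gcongr; exact hF1 s ⟨hs0, hs'.2⟩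
            _ = M / s := by field_simp
            _ ≤ M / r := by gcongr; exact hs'.1.le
      rw [abs_of_nonneg (sub_nonneg.2 hr.2), Real.norm_eq_abs] at this
      refine this.trans (mul_le_mul_of_nonneg_left (by linarith) (by positivity))
    have h2 : |h r / r ^ 2| ≤ |h r₁ / r₁ ^ 2| + M / r * r₁ := by
      have e : h r / r ^ 2 = h r₁ / r₁ ^ 2 - ∫ s in r..r₁, F s / s ^ 6 := by
        rw [← hdiff r hr]; ring
      rw [e]; exact (abs_sub _ _).trans (by gcongr)
    have h3 : |h r| = r ^ 2 * |h r / r ^ 2| := by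
      rw [abs_div, abs_of_pos (pow_pos hr0 2)]; field_simp
    rw [h3]
    calc r ^ 2 * |h r / r ^ 2| ≤ r ^ 2 * (|h r₁ / r₁ ^ 2| + M / r * r₁) := by gcongr
      _ = (|h r₁ / r₁ ^ 2| * r + M * r₁) * r := by field_simp
      _ ≤ C * r := by rw [hC]; gcongr; exact hr.2
  have hC0 : 0 ≤ C := by have := hr₁R.1; positivity
  -- Linear decay gains one more power, so `w'` is bounded and `w` extends continuously to `0`.
  have hF2 : ∀ s ∈ Ioc 0 r₁, ‖F s / s ^ 6‖ ≤ M * C := fun s hs' => by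
    have hs0 := hs'.1
    have := S.abs_integral_pow_four_le ht (hsub hs') (B := C * s) fun x hx =>
      (hlin x ⟨hx.1, hx.2.trans hs'.2⟩).trans (by gcongr; exact hx.2)
    rw [norm_div, norm_pow, Real.norm_of_nonneg hs0.le, Real.norm_eq_abs,
      div_le_iff₀ (pow_pos hs0 6)]
    calc |F s| ≤ 2 * (2 + 3 * coupling t) * (C * s) * s ^ 5 := this
      _ = M * C * s ^ 6 := by rw [hM]; ring
  have hint : IntegrableOn (fun s => F s / s ^ 6) (Ioc 0 r₁) :=
    IntegrableOn.of_bound (by simp) (hFc.aestronglyMeasurable measurableSet_Ioc) _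
      ((ae_restrict_iff' measurableSet_Ioc).2 (Eventually.of_forall hF2))
  have hii : ∀ r ∈ Icc 0 r₁, IntervalIntegrable (fun s => F s / s ^ 6) volume 0 r := fun r hr =>
    (intervalIntegrable_iff_integrableOn_Ioc_of_le hr.1).2
      (hint.mono_set (Ioc_subset_Ioc_right hr.2))
  set w : ℝ → ℝ := fun r => h r₁ / r₁ ^ 2 - (∫ s in (0 : ℝ)..r₁, F s / s ^ 6)
    + ∫ s in (0 : ℝ)..r, F s / s ^ 6 with hw
  have hwh : ∀ r ∈ Ioc 0 r₁, h r = r ^ 2 * w r := by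
    intro r hr
    have h1 := intervalIntegral.integral_add_adjacent_intervals (hii r ⟨hr.1.le, hr.2⟩)
      ((intervalIntegrable_iff_integrableOn_Ioc_of_le hr.2).2
        (hint.mono_set (Ioc_subset_Ioc_left hr.1.le)))
    have h2 : w r = h r / r ^ 2 := by
      simp only [hw]; rw [← h1, ← hdiff r hr]; ring
    have := hr.1
    rw [h2]; field_simp
  -- Since `r⁴ f'(r² w)` equals `r⁶` times `quotientForce`, rescaling the integral to `[0,1]`
  -- cancels the singular factor `s⁻⁶`.
  have hFw : ∀ s ∈ Ioc 0 r₁, F s / s ^ 6 = s * ∫ y in (0 : ℝ)..1, y ^ 6 * quotientForce t w (s * y) := by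
    intro s hs'
    have hs0 := hs'.1
    have h1 : F s = ∫ x in (0 : ℝ)..s, x ^ 6 * quotientForce t w x := by
      refine intervalIntegral.integral_congr_ae (Eventually.of_forall fun x hx => ?_)
      rw [uIoc_of_le hs0.le] at hx
      rw [hwh x ⟨hx.1, hx.2.trans hs'.2⟩]
      simp only [bulkDeriv, quotientForce]; ring
    have h2 := intervalIntegral.integral_comp_mul_left (a := 0) (b := 1)
      (fun x => x ^ 6 * quotientForce t w x) hs0.ne'
    simp only [mul_zero, mul_one, mul_pow, mul_assoc] at h2
    rw [intervalIntegral.integral_const_mul, ← h1, smul_eq_mul] at h2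
    rw [← mul_right_inj' (pow_ne_zero 6 hs0.ne'), mul_left_comm, h2]
    field_simp
  refine ⟨r₁, hr₁R, w, ?_, hwh, fun r hr => ?_⟩
  · have := intervalIntegral.continuousOn_primitive_interval' (a := 0)
      (hii r₁ ⟨hr₁R.1.le, le_rfl⟩) left_mem_uIcc
    rw [uIcc_of_le hr₁R.1.le] at this
    exact this.const_add _
  · have h0 : w 0 = h r₁ / r₁ ^ 2 - ∫ s in (0 : ℝ)..r₁, F s / s ^ 6 := by simp [hw]
    have h1 : w r = w 0 + ∫ s in (0 : ℝ)..r, F s / s ^ 6 := by rw [h0]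
    rw [h1]
    congr 1
    rcases hr.1.eq_or_lt with hr0 | hr0
    · simp [← hr0]
    have h2 := intervalIntegral.integral_comp_mul_left (a := 0) (b := 1)
      (fun s => s * ∫ y in (0 : ℝ)..1, y ^ 6 * quotientForce t w (s * y)) hr0.ne'
    simp only [mul_zero, mul_one, mul_assoc] at h2
    rw [intervalIntegral.integral_const_mul, smul_eq_mul] at h2
    have h3 : ∫ s in (0 : ℝ)..r, F s / s ^ 6 = ∫ s in (0 : ℝ)..r, s *
        ∫ y in (0 : ℝ)..1, y ^ 6 * quotientForce t w (s * y) := by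
      refine intervalIntegral.integral_congr_ae (Eventually.of_forall fun x hx => ?_)
      rw [uIoc_of_le hr0.le] at hx
      exact hFw x ⟨hx.1, hx.2.trans hr.2⟩
    rw [h3]
    simp only [pow_one]
    rw [sq, mul_assoc, h2]
    field_simp

end IsRadialSolution

end Hedgehog

/-! ### Analyticity through the implicit function theorem in `C([0,1])`. -/

namespace Hedgehog

open Filter Topology
open scoped unitInterval

/-- A continuous family of fixed points of `Φ (x, ·)` depends analytically on `x` if `Φ` is analytic
and `Φ (x₀, ·)` is constant. -/
theorem exists_contDiffAt_of_eq_fixedPoint {E : Type*} [NormedAddCommGroup E] [NormedSpace ℝ E]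
    [CompleteSpace E] {Φ : ℝ × E → E} {x₀ : ℝ} {e₀ : E} (hΦ : ContDiffAt ℝ ω Φ (x₀, e₀))
    (hconst : ∀ e, Φ (x₀, e) = e₀) {S : Set ℝ} {y : ℝ → E}
    (hy : Tendsto y (𝓝[S] x₀) (𝓝 e₀)) (hfix : ∀ᶠ x in 𝓝[S] x₀, y x = Φ (x, y x)) :
    ∃ Y : ℝ → E, ContDiffAt ℝ ω Y x₀ ∧ ∀ᶠ x in 𝓝[S] x₀, y x = Y x := by
  set f : ℝ × E → E := fun v => v.2 - Φ v with hf
  have hcd : ContDiffAt ℝ ω f (x₀, e₀) := contDiffAt_snd.sub hΦ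
  -- As `Φ (x₀, ·)` is constant, the partial derivative of `e - Φ (x, e)` in `e` is the identity: no
  -- smallness or spectral condition is needed.
  have hpart : fderiv ℝ f (x₀, e₀) ∘L .inr ℝ ℝ E = ContinuousLinearMap.id ℝ E := by
    have h1 : HasFDerivAt f (fderiv ℝ f (x₀, e₀)) (x₀, e₀) :=
      (hcd.differentiableAt (by simp)).hasFDerivAt
    have h2 : HasFDerivAt (fun e : E => (x₀, e)) (ContinuousLinearMap.inr ℝ ℝ E) e₀ :=
      hasFDerivAt_prodMk_right x₀ e₀
    have h3 : HasFDerivAt (f ∘ fun e : E => (x₀, e)) _ e₀ := h1.comp e₀ h2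
    have h4 : (f ∘ fun e : E => (x₀, e)) = fun e => e - e₀ := by
      ext e; simp [hf, hconst]
    rw [h4] at h3
    exact h3.unique ((hasFDerivAt_id e₀).sub_const e₀)
  have hinv : (fderiv ℝ f (x₀, e₀) ∘L .inr ℝ ℝ E).IsInvertible := by
    rw [hpart]; exact ⟨ContinuousLinearEquiv.refl ℝ E, rfl⟩
  have hn : (ω : WithTop ℕ∞) ≠ 0 := by simp
  refine ⟨hcd.implicitFunction hn hinv, hcd.contDiffAt_implicitFunction hn hinv, ?_⟩
  have hev := hcd.eventually_apply_eq_iff_implicitFunction hn hinv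
  have ht : Tendsto (fun x => (x, y x)) (𝓝[S] x₀) (𝓝 (x₀, e₀)) :=
    (tendsto_id.mono_left nhdsWithin_le_nhds).prodMk_nhds hy
  filter_upwards [ht.eventually hev, hfix] with x hx hx'
  exact (hx.1 (by simp [hf, hconst, ← hx'])).symm

/-- The weighted averaging operator `v ↦ (θ ↦ ∫₀¹ xᵏ v(θ x) dx)` on continuous functions. -/
noncomputable def averaging (k : ℕ) : C(I, ℝ) →L[ℝ] C(I, ℝ) :=
  LinearMap.mkContinuous
    { toFun := fun v =>
        -- `projIcc` only makes the integrand total in `x`; on `[0,1]` it changes nothing.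
        ⟨fun θ => ∫ x in (0 : ℝ)..1, x ^ k * v (θ * projIcc 0 1 zero_le_one x),
          intervalIntegral.continuous_parametric_intervalIntegral_of_continuous'
            (f := fun θ x => x ^ k * v (θ * projIcc 0 1 zero_le_one x)) (by
              have := continuous_projIcc (h := zero_le_one (α := ℝ))
              fun_prop) 0 1⟩
      map_add' := fun u v => by
        have := continuous_projIcc (h := zero_le_one (α := ℝ))
        ext θ
        simp only [ContinuousMap.coe_mk, ContinuousMap.add_apply, mul_add]
        exact intervalIntegral.integral_add (Continuous.intervalIntegrable (by fun_prop) _ _)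
          (Continuous.intervalIntegrable (by fun_prop) _ _)
      map_smul' := fun c v => by
        ext θ
        simp only [ContinuousMap.coe_mk, ContinuousMap.smul_apply, smul_eq_mul, RingHom.id_apply,
          mul_left_comm _ c, intervalIntegral.integral_const_mul] }
    1 fun v => by
      rw [one_mul, ContinuousMap.norm_le _ (norm_nonneg v)]
      intro θ
      have := intervalIntegral.norm_integral_le_of_norm_le_const (a := 0) (b := 1) (C := ‖v‖)
        (f := fun x : ℝ => x ^ k * v (θ * projIcc 0 1 zero_le_one x)) fun x hx => by
          rw [uIoc_of_le zero_le_one] at hx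
          rw [norm_mul, norm_pow, Real.norm_of_nonneg hx.1.le]
          exact (mul_le_of_le_one_left (norm_nonneg _) (pow_le_one₀ hx.1.le hx.2)).trans
            (v.norm_coe_le_norm _)
      simpa using this

theorem averaging_apply {k : ℕ} {v : C(I, ℝ)} {f : ℝ → ℝ} {c : ℝ} {θ : I}
    (hv : ∀ τ : I, v τ = f (c * τ)) :
    averaging k v θ = ∫ x in (0 : ℝ)..1, x ^ k * f (c * (θ * x)) := by
  have e : averaging k v θ = ∫ x in (0 : ℝ)..1, x ^ k * v (θ * projIcc 0 1 zero_le_one x) := rfl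
  rw [e]
  refine intervalIntegral.integral_congr fun x hx => ?_
  rw [uIcc_of_le zero_le_one] at hx
  simp only [hv, projIcc_of_mem zero_le_one hx]
  rfl

/-- The coordinate function on the unit interval. -/
noncomputable def coordinate : C(I, ℝ) := ⟨Subtype.val, continuous_subtype_val⟩

theorem coordinate_apply (θ : I) : coordinate θ = θ := rfl

theorem contDiffAt_eval_comp {Y : ℝ → C(I, ℝ)} {x : ℝ} (h : ContDiffAt ℝ ω Y x) (θ : I) :
    AnalyticAt ℝ (fun z => Y z θ) x :=
  ((ContinuousMap.evalCLM ℝ θ : C(I, ℝ) →L[ℝ] ℝ).contDiff.contDiffAt.comp x h).analyticAt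

namespace IsRadialSolution

variable {t R : ℝ} {h : ℝ → ℝ}

/-- Near the origin, `h(r) = r² W(r²)` with `W` analytic. -/
theorem exists_analyticAt_zero (ht : 0 < t) (hR : 0 < R) (S : IsRadialSolution t R h) :
    ∃ W : ℝ → ℝ, AnalyticAt ℝ W 0 ∧ ∀ᶠ r in 𝓝[>] 0, h r = r ^ 2 * W (r ^ 2) := by
  obtain ⟨r₁, hr₁, w, hwc, hwh, hw⟩ := S.exists_quotient ht hR
  have h01 : (0 : ℝ) ≤ r₁ := hr₁.1.le
  -- Constant extension of `w` beyond `[0, r₁]`, so that the family below is continuous on the whole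
  -- line.
  set v : ℝ → ℝ := fun x => w (projIcc 0 r₁ h01 x) with hv
  have hvc : Continuous v :=
    (continuousOn_iff_continuous_domRestrict.1 hwc).comp continuous_projIcc
  have hvw : ∀ x ∈ Icc 0 r₁, v x = w x := fun x hx => by simp [hv, projIcc_of_mem h01 hx]
  -- The family is indexed by `ρ = r²`. A priori it is only continuous in `ρ`; its analyticity will
  -- come from the fixed point equation.
  set y : C(ℝ, C(I, ℝ)) := ContinuousMap.curry ⟨fun z : ℝ × I => v (√z.1 * z.2), by
    have := Real.continuous_sqrt; fun_prop⟩ with hy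
  have hyv : ∀ (ρ : ℝ) (θ : I), y ρ θ = v (√ρ * θ) := fun _ _ => rfl
  set s := coupling t with hs
  -- The integral equation for `w` at `r = √ρ θ`. Only even powers of `r` occur, so `Φ` is
  -- polynomial in `ρ` and in the function.
  set Φ : ℝ × C(I, ℝ) → C(I, ℝ) := fun z => ContinuousMap.const I (w 0) + z.1 • (coordinate ^ 2 *
    averaging 1 (averaging 6 (-z.2 - (3 * s * z.1) • (coordinate ^ 2 * z.2 ^ 2)
      + ((1 + 3 * s) * z.1 ^ 2) • (coordinate ^ 4 * z.2 ^ 3)))) with hΦ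
  have hΦc : ContDiff ℝ ω Φ := by fun_prop
  obtain ⟨Y, hY, hYy⟩ := exists_contDiffAt_of_eq_fixedPoint (x₀ := 0) (S := Ici 0) (y := y)
    (e₀ := ContinuousMap.const I (w 0)) hΦc.contDiffAt (fun e => by simp [hΦ]) (by
      have h1 := (y.continuous.tendsto 0).mono_left (nhdsWithin_le_nhds (s := Ici 0))
      have h2 : y 0 = ContinuousMap.const I (w 0) := by
        ext θ
        simp only [hyv, ContinuousMap.const_apply, Real.sqrt_zero, zero_mul]
        exact hvw 0 ⟨le_rfl, h01⟩
      rwa [h2] at h1) (by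
      have hmem : ∀ᶠ ρ in 𝓝[≥] (0 : ℝ), ρ ∈ Icc 0 (r₁ ^ 2) :=
        Icc_mem_nhdsGE (pow_pos hr₁.1 2)
      filter_upwards [hmem] with ρ hρ
      have hsq : √ρ ^ 2 = ρ := Real.sq_sqrt hρ.1
      have hle : √ρ ≤ r₁ := (Real.sqrt_le_left h01).2 hρ.2
      have hin : ∀ x : I, √ρ * x ∈ Icc 0 r₁ := fun x =>
        ⟨mul_nonneg (Real.sqrt_nonneg _) x.2.1,
          (mul_le_of_le_one_right (Real.sqrt_nonneg _) x.2.2).trans hle⟩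
      ext θ
      have e6 : ∀ τ : I, averaging 6 (-y ρ - (3 * s * ρ) • (coordinate ^ 2 * y ρ ^ 2)
          + ((1 + 3 * s) * ρ ^ 2) • (coordinate ^ 4 * y ρ ^ 3)) τ =
          (fun z => ∫ x in (0 : ℝ)..1, x ^ 6 * quotientForce t v (z * x)) (√ρ * τ) := by
        intro τ
        rw [averaging_apply (f := quotientForce t v) (c := √ρ)]
        · simp only [mul_assoc]
        intro τ'
        simp only [ContinuousMap.add_apply, ContinuousMap.sub_apply, ContinuousMap.neg_apply,
          ContinuousMap.smul_apply, ContinuousMap.mul_apply, ContinuousMap.pow_apply, smul_eq_mul,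
          hyv, coordinate_apply, quotientForce, mul_pow, hsq]
        rw [show √ρ ^ 4 = (√ρ ^ 2) ^ 2 by ring, hsq]
        ring
      have e1 := averaging_apply (k := 1) (c := √ρ) (θ := θ)
        (f := fun z => ∫ x in (0 : ℝ)..1, x ^ 6 * quotientForce t v (z * x)) e6
      simp only [hΦ, ContinuousMap.add_apply, ContinuousMap.const_apply, ContinuousMap.smul_apply,
        ContinuousMap.mul_apply, ContinuousMap.pow_apply, smul_eq_mul, coordinate_apply, e1]
      rw [hyv, hvw _ (hin θ), hw _ (hin θ), mul_pow, hsq, mul_assoc]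
      congr 3
      refine intervalIntegral.integral_congr fun x hx => ?_
      rw [uIcc_of_le zero_le_one] at hx
      congr 1
      refine intervalIntegral.integral_congr fun x' hx' => ?_
      rw [uIcc_of_le zero_le_one] at hx'
      have := hvw _ (hin (θ * (⟨x, hx⟩ * ⟨x', hx'⟩)))
      simp only [Icc.coe_mul] at this
      simp only [quotientForce]
      rw [show √ρ * (θ * x) * x' = √ρ * (θ * (x * x')) by ring,
        show √ρ * θ * (x * x') = √ρ * (θ * (x * x')) by ring, this])
  refine ⟨fun ρ => Y ρ 1, contDiffAt_eval_comp hY 1, ?_⟩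
  have htend : Tendsto (fun r : ℝ => r ^ 2) (𝓝[>] 0) (𝓝[≥] 0) := by
    refine tendsto_nhdsWithin_iff.2 ⟨?_, Eventually.of_forall fun r => sq_nonneg r⟩
    have := (continuous_pow 2 : Continuous fun r : ℝ => r ^ 2).tendsto 0
    simp only [ne_eq, OfNat.ofNat_ne_zero, not_false_eq_true, zero_pow] at this
    exact this.mono_left nhdsWithin_le_nhds
  filter_upwards [htend.eventually hYy, Ioc_mem_nhdsGT hr₁.1] with r hr hr'
  rw [hwh r hr', ← hr, hyv, Real.sqrt_sq hr'.1.le]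
  simp [hvw r ⟨hr'.1.le, hr'.2⟩]

theorem sub_eq_integral (S : IsRadialSolution t R h) {a b : ℝ} (ha : a ∈ Ioc 0 R)
    (hb : b ∈ Ioc 0 R) : h b - h a = ∫ s in a..b, flux t h s / s ^ 2 := by
  rcases le_total a b with hab | hab
  · exact S.sub_eq a b ha.1 hab hb.2
  · rw [intervalIntegral.integral_symm, ← S.sub_eq b a hb.1 hab ha.2]; ring

theorem flux_sub_eq_integral (S : IsRadialSolution t R h) {a b : ℝ} (ha : a ∈ Ioc 0 R)
    (hb : b ∈ Ioc 0 R) : flux t h b - flux t h a = ∫ s in a..b, force t h s := by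
  have hi : ∀ x ∈ Ioc 0 R, IntervalIntegrable (force t h) volume 0 x := fun x hx =>
    (intervalIntegrable_iff_integrableOn_Ioc_of_le hx.1.le).2
      (S.integrableOn_force.mono_set (Ioc_subset_Ioc_right hx.2))
  exact intervalIntegral.integral_interval_sub_left (hi b hb) (hi a ha)

/-- Away from the origin and up to `r = R`, the solution is analytic. -/
theorem exists_analyticAt (hR : 0 < R) (S : IsRadialSolution t R h) {r₀ : ℝ}
    (hr₀ : r₀ ∈ Ioc 0 R) :
    ∃ Y : ℝ → ℝ, AnalyticAt ℝ Y r₀ ∧ ∀ᶠ r in 𝓝[Iic R] r₀, h r = Y r := by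
  obtain ⟨hr0, hrR⟩ := hr₀
  have hlt : r₀ / 2 < r₀ := by linarith
  have hle : r₀ / 2 ≤ R := by linarith
  have hsub : Icc (r₀ / 2) R ⊆ Ioc 0 R := fun x hx => ⟨by linarith [hx.1], hx.2⟩
  set H : ℝ → ℝ := fun x => h (projIcc (r₀ / 2) R hle x) with hH
  set K : ℝ → ℝ := fun x => flux t h (projIcc (r₀ / 2) R hle x) with hK
  have hHc : Continuous H :=
    (continuousOn_iff_continuous_domRestrict.1 (S.continuousOn.mono hsub)).comp continuous_projIcc
  have hKc : Continuous K :=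
    (continuousOn_iff_continuous_domRestrict.1 ((S.continuousOn_flux hR).mono
      (hsub.trans Ioc_subset_Icc_self))).comp continuous_projIcc
  have hHh : ∀ x ∈ Icc (r₀ / 2) R, H x = h x := fun x hx => by simp [hH, projIcc_of_mem hle hx]
  have hKk : ∀ x ∈ Icc (r₀ / 2) R, K x = flux t h x := fun x hx => by
    simp [hK, projIcc_of_mem hle hx]
  -- Here the unknown is the pair of `h` and its flux on the segment from `r₀` to `r₀ + x`, rescaled
  -- to `[0,1]`.
  set y₁ : C(ℝ, C(I, ℝ)) := ContinuousMap.curry ⟨fun z : ℝ × I => H (r₀ + z.1 * z.2), by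
    fun_prop⟩ with hy₁
  set y₂ : C(ℝ, C(I, ℝ)) := ContinuousMap.curry ⟨fun z : ℝ × I => K (r₀ + z.1 * z.2), by
    fun_prop⟩ with hy₂
  have hy₁v : ∀ (x : ℝ) (θ : I), y₁ x θ = H (r₀ + x * θ) := fun _ _ => rfl
  have hy₂v : ∀ (x : ℝ) (θ : I), y₂ x θ = K (r₀ + x * θ) := fun _ _ => rfl
  set s := coupling t with hs
  set X : ℝ → C(I, ℝ) := fun x => ContinuousMap.const I r₀ + x • coordinate with hX
  have hXc : ContDiff ℝ ω X := by fun_prop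
  have hX0 : X 0 = ContinuousMap.const I r₀ := by simp [hX]
  have hXu : IsUnit (X 0) := by
    rw [hX0, ContinuousMap.isUnit_iff_forall_ne_zero]
    exact fun _ => hr0.ne'
  have hinv : ContDiffAt ℝ ω (fun x => Ring.inverse (X x)) 0 := by
    obtain ⟨u, hu⟩ := hXu
    have h1 := contDiffAt_ringInverse ℝ u (n := ω)
    rw [hu] at h1
    exact h1.comp 0 hXc.contDiffAt
  have hXv : ∀ (x : ℝ) (θ : I), X x θ = r₀ + x * θ := fun x θ => by
    simp [hX, coordinate_apply]
  -- The first order system `h' = flux / r²`, `flux' = force` in integrated form. `X` stands for the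
  -- radius, invertible near `x = 0` because `r₀ > 0`.
  set Φ : ℝ × C(I, ℝ) × C(I, ℝ) → C(I, ℝ) × C(I, ℝ) := fun z =>
    (ContinuousMap.const I (h r₀) + z.1 • (coordinate * averaging 0
        (z.2.2 * Ring.inverse (X z.1) ^ 2)),
      ContinuousMap.const I (flux t h r₀) + z.1 • (coordinate * averaging 0
        ((6 : ℝ) • z.2.1 + X z.1 ^ 2 * (-z.2.1 - (3 * s) • z.2.1 ^ 2 + (1 + 3 * s) • z.2.1 ^ 3))))
    with hΦ
  have hfst : ContDiffAt ℝ ω (fun z : ℝ × C(I, ℝ) × C(I, ℝ) => Ring.inverse (X z.1))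
      (0, (ContinuousMap.const I (h r₀), ContinuousMap.const I (flux t h r₀))) :=
    hinv.comp (0, (ContinuousMap.const I (h r₀), ContinuousMap.const I (flux t h r₀)))
      contDiffAt_fst
  have hΦc : ContDiffAt ℝ ω Φ
      (0, (ContinuousMap.const I (h r₀), ContinuousMap.const I (flux t h r₀))) := by
    refine ContDiffAt.prodMk ?_ ?_
    · exact contDiffAt_const.add (contDiffAt_fst.smul (contDiffAt_const.mul
        ((averaging 0).contDiff.contDiffAt.comp _ ((contDiffAt_snd.snd).mul (hfst.pow 2)))))
    · exact ContDiff.contDiffAt (by fun_prop)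
  have hIcc : Icc (r₀ / 2) R ∈ 𝓝[Iic R] r₀ := by
    filter_upwards [self_mem_nhdsWithin, nhdsWithin_le_nhds (Ici_mem_nhds hlt)] with x h1 h2
    exact ⟨h2, h1⟩
  -- At `r₀ = R` this is a one-sided neighbourhood, so the endpoint is covered by the same argument.
  set T : Set ℝ := {x | r₀ + x ≤ R} with hT
  have hmem : ∀ᶠ x in 𝓝[T] 0, r₀ + x ∈ Icc (r₀ / 2) R := by
    have h1 : ∀ᶠ x in 𝓝 (0 : ℝ), r₀ / 2 < r₀ + x :=
      (continuous_const.add continuous_id).continuousAt.eventually_const_lt (by simpa using hlt)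
    filter_upwards [self_mem_nhdsWithin, nhdsWithin_le_nhds h1] with x h2 h3
    exact ⟨h3.le, h2⟩
  have hunit : ∀ᶠ x in 𝓝[T] 0, IsUnit (X x) :=
    nhdsWithin_le_nhds (hXc.continuous.continuousAt.eventually
      (by obtain ⟨u, hu⟩ := hXu; rw [← hu]; exact Units.nhds u))
  obtain ⟨Y, hY, hYy⟩ := exists_contDiffAt_of_eq_fixedPoint (x₀ := 0) (S := T)
    (y := fun x => (y₁ x, y₂ x)) hΦc (fun e => by simp [hΦ]) (by
      have h1 := ((y₁.continuous.prodMk y₂.continuous).tendsto 0).mono_left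
        (nhdsWithin_le_nhds (s := T))
      have hm : r₀ ∈ Icc (r₀ / 2) R := ⟨hlt.le, hrR⟩
      have h2 : y₁ 0 = ContinuousMap.const I (h r₀) := by
        ext θ
        simp only [hy₁v, ContinuousMap.const_apply, zero_mul, add_zero, hHh r₀ hm]
      have h3 : y₂ 0 = ContinuousMap.const I (flux t h r₀) := by
        ext θ
        simp only [hy₂v, ContinuousMap.const_apply, zero_mul, add_zero, hKk r₀ hm]
      rwa [h2, h3] at h1) (by
      filter_upwards [hmem, hunit] with x hx hxu
      have hin : ∀ θ : I, r₀ + x * θ ∈ Icc (r₀ / 2) R := by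
        intro θ
        have h1 := θ.2.1
        have h2 := θ.2.2
        rcases le_total 0 x with h3 | h3
        · exact ⟨by nlinarith, by nlinarith [hx.2]⟩
        · exact ⟨by nlinarith [hx.1], by nlinarith⟩
      have hrI : r₀ ∈ Ioc 0 R := ⟨hr0, hrR⟩
      have hinvv : ∀ θ : I, Ring.inverse (X x) θ = (r₀ + x * θ)⁻¹ := by
        intro θ
        have h1 := congrArg (fun f : C(I, ℝ) => f θ) (Ring.inverse_mul_cancel (X x) hxu)
        simp only [ContinuousMap.mul_apply, ContinuousMap.one_apply, hXv] at h1
        exact eq_inv_of_mul_eq_one_left h1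
      have hscale : ∀ (f : ℝ → ℝ) (θ : I), ∫ z in r₀..(r₀ + x * θ), f z =
          x * (θ * ∫ z in (0 : ℝ)..1, z ^ 0 * f (r₀ + x * (θ * z))) := by
        intro f θ
        have h1 := intervalIntegral.mul_integral_comp_add_mul (a := 0) (b := 1) (f := f) (x * θ) r₀
        simp only [mul_zero, add_zero, mul_one] at h1
        rw [← h1, mul_assoc]
        simp only [pow_zero, one_mul, mul_assoc]
      have hcongr : ∀ (f g : ℝ → ℝ), (∀ z ∈ Icc (r₀ / 2) R, f z = g z) → ∀ θ : I,
          ∫ z in r₀..(r₀ + x * θ), f z = ∫ z in r₀..(r₀ + x * θ), g z := by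
        intro f g hfg θ
        refine intervalIntegral.integral_congr fun z hz => hfg z ?_
        exact ordConnected_Icc.uIcc_subset ⟨hlt.le, hrR⟩ (hin θ) hz
      refine Prod.ext ?_ ?_
      · ext θ
        have e := averaging_apply (k := 0) (v := y₂ x * Ring.inverse (X x) ^ 2)
          (f := fun z => K (r₀ + z) / (r₀ + z) ^ 2) (c := x) (θ := θ) fun τ => by
            simp only [ContinuousMap.mul_apply, ContinuousMap.pow_apply, hinvv, hy₂v]
            rw [inv_pow, div_eq_mul_inv]
        simp only [hΦ, ContinuousMap.add_apply, ContinuousMap.const_apply,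
          ContinuousMap.smul_apply, ContinuousMap.mul_apply, smul_eq_mul, coordinate_apply, e]
        rw [← hscale fun z => K z / z ^ 2, hcongr _ (fun z => flux t h z / z ^ 2)
          (fun z hz => by rw [hKk z hz]) θ, ← S.sub_eq_integral hrI (hsub (hin θ)), hy₁v,
          hHh _ (hin θ)]
        ring
      · ext θ
        have e := averaging_apply (k := 0) (v := (6 : ℝ) • y₁ x + X x ^ 2 * (-y₁ x -
          (3 * s) • y₁ x ^ 2 + (1 + 3 * s) • y₁ x ^ 3)) (f := fun z => force t H (r₀ + z)) (c := x)
          (θ := θ) fun τ => by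
            simp only [ContinuousMap.add_apply, ContinuousMap.sub_apply, ContinuousMap.neg_apply,
              ContinuousMap.smul_apply, ContinuousMap.mul_apply, ContinuousMap.pow_apply,
              smul_eq_mul, hXv, hy₁v, force, bulkDeriv, hs]
        simp only [hΦ, ContinuousMap.add_apply (ContinuousMap.const I (flux t h r₀)),
          ContinuousMap.const_apply, ContinuousMap.smul_apply _ (coordinate * _),
          ContinuousMap.mul_apply coordinate, smul_eq_mul, coordinate_apply, e]
        rw [← hscale fun z => force t H z, hcongr _ (fun z => force t h z)
          (fun z hz => by simp only [force, hHh z hz]) θ,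
          ← S.flux_sub_eq_integral hrI (hsub (hin θ)), hy₂v, hKk _ (hin θ)]
        ring)
  refine ⟨fun r => (Y (r - r₀)).1 1, ?_, ?_⟩
  · have h1 : AnalyticAt ℝ (fun x => (Y x).1 1) 0 := contDiffAt_eval_comp hY.fst 1
    have h2 : AnalyticAt ℝ (fun r : ℝ => r - r₀) r₀ := analyticAt_id.sub analyticAt_const
    exact AnalyticAt.fun_comp (by simpa using h1) h2
  · have htend : Tendsto (fun r => r - r₀) (𝓝[Iic R] r₀) (𝓝[T] 0) := by
      refine tendsto_nhdsWithin_iff.2 ⟨?_, ?_⟩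
      · have := (continuous_sub_right r₀).tendsto r₀
        rw [sub_self] at this
        exact this.mono_left nhdsWithin_le_nhds
      · filter_upwards [self_mem_nhdsWithin] with r hr
        simpa [hT] using hr
    filter_upwards [htend.eventually hYy, hIcc] with r hr hr'
    have h1 := congrArg (fun f : C(I, ℝ) × C(I, ℝ) => f.1 1) hr
    simp only [hy₁v, Icc.coe_one, mul_one, add_sub_cancel] at h1
    rw [← h1, hHh r hr']

end IsRadialSolution

end Hedgehog

/-! ### Nonnegativity, and the return from the weighted to the admissible problem. -/

namespace Hedgehog

open Filter Topology

/-- Only the cubic term is odd; hence changing the sign of a negative value strictly lowers the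
potential for `r > 0`. -/
theorem potential_neg {t : ℝ} (ht : 0 < t) (r x : ℝ) :
    potential t r (-x) = potential t r x + 2 * coupling t * (r ^ 2 * x ^ 3) := by
  simp only [potential, bulk_eq ht]; ring

/-- A weighted minimizer has a nonnegative profile: reflecting a negative nodal piece would lower
the energy. -/
theorem IsWeightedMinimizer.profile_nonneg {t R : ℝ} (ht : 0 < t) {p h : ℝ → ℝ}
    (hp : IsWeightedMinimizer t R p) (hh : EqOn h (profile R p) (Ioc 0 R))
    (hc : ContinuousOn h (Icc 0 R)) (h0 : h 0 = 0) (hR1 : h R = 1) :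
    ∀ r ∈ Icc 0 R, 0 ≤ h r := by
  intro x₀ hx₀
  by_contra! hneg
  have hm := hp.1.memLp
  have hs := coupling_pos ht
  have hclosed : ∀ a b, 0 ≤ a → b ≤ R → IsCompact (Icc a b ∩ h ⁻¹' {0}) := fun a b ha hb =>
    isCompact_Icc.of_isClosed_subset ((hc.mono (Icc_subset_Icc ha hb)).preimage_isClosed_of_isClosed
      isClosed_Icc isClosed_singleton) inter_subset_left
  have hivt : ∀ u v, 0 ≤ u → u ≤ v → v ≤ R → h u ≤ 0 → 0 ≤ h v → ∃ z ∈ Icc u v, h z = 0 :=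
    fun u v hu huv hv h1 h2 =>
      intermediate_value_Icc huv (hc.mono (Icc_subset_Icc hu hv)) ⟨h1, h2⟩
  have hivt' : ∀ u v, 0 ≤ u → u ≤ v → v ≤ R → 0 ≤ h u → h v ≤ 0 → ∃ z ∈ Icc u v, h z = 0 :=
    fun u v hu huv hv h1 h2 =>
      intermediate_value_Icc' huv (hc.mono (Icc_subset_Icc hu hv)) ⟨h2, h1⟩
  have hA := hclosed 0 x₀ le_rfl hx₀.2
  have hB := hclosed x₀ R hx₀.1 le_rfl
  -- `a` is the last zero before `x₀` and `b` the first one after it; `a = 0` is allowed, thanks to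
  -- `h 0 = 0`.
  obtain ⟨⟨ha0, hax⟩, ha⟩ := hA.sSup_mem ⟨0, ⟨le_rfl, hx₀.1⟩, h0⟩
  obtain ⟨⟨hxb, hbR⟩, hb⟩ := hB.sInf_mem (by
    obtain ⟨z, hz, hz0⟩ := hivt x₀ R hx₀.1 hx₀.2 le_rfl hneg.le (by rw [hR1]; exact zero_le_one)
    exact ⟨z, hz, hz0⟩)
  set a := sSup (Icc 0 x₀ ∩ h ⁻¹' {0}) with had
  set b := sInf (Icc x₀ R ∩ h ⁻¹' {0}) with hbd
  simp only [mem_preimage, mem_singleton_iff] at ha hb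
  have hax' : a < x₀ := lt_of_le_of_ne hax fun h' => by rw [h'] at ha; linarith
  have hxb' : x₀ < b := lt_of_le_of_ne hxb fun h' => by rw [← h'] at hb; linarith
  have hab : a < b := hax'.trans hxb'
  have hlt : ∀ r ∈ Ioo a b, h r < 0 := by
    intro r hr
    by_contra! hr0
    rcases le_total r x₀ with hrx | hrx
    · obtain ⟨z, hz, hz0⟩ := hivt' r x₀ (ha0.trans hr.1.le) hrx hx₀.2 hr0 hneg.le
      exact absurd (le_csSup hA.bddAbove ⟨⟨(ha0.trans hr.1.le).trans hz.1, hz.2⟩, hz0⟩)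
        (not_le.2 (hr.1.trans_le hz.1))
    · obtain ⟨z, hz, hz0⟩ := hivt x₀ r hx₀.1 hrx (hr.2.le.trans hbR) hneg.le hr0
      exact absurd (csInf_le hB.bddBelow ⟨⟨hz.1, hz.2.trans (hr.2.le.trans hbR)⟩, hz0⟩)
        (not_le.2 (hz.2.trans_lt hr.2))
  -- Reversing the slope on the nodal interval keeps `p²` and reflects the profile exactly there, as
  -- it vanishes at both ends.
  set q : ℝ → ℝ := fun s => if s ∈ Ioc a b then -p s else p s with hq
  have hqe : q = p - (2 : ℝ) • (Ioc a b).indicator p := by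
    ext s
    by_cases hs : s ∈ Ioc a b
    · simp only [hq, hs, if_true, Pi.sub_apply, Pi.smul_apply, indicator_of_mem, smul_eq_mul]; ring
    · simp only [hq, hs, if_false, Pi.sub_apply, Pi.smul_apply, indicator_of_notMem,
        not_false_eq_true, smul_eq_mul]; ring
  have hqm : MemLp q 2 (volume.restrict (Ioc 0 R)) := by
    rw [hqe]; exact hm.sub ((hm.indicator measurableSet_Ioc).const_smul 2)
  have hpiece : ∀ u v, 0 < u → u ≤ v → v ≤ R → ∫ s in u..v, p s / s = h v - h u :=
    fun u v hu huv hv => by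
      rw [hh ⟨hu, huv.trans hv⟩, hh ⟨hu.trans_le huv, hv⟩, profile_sub_profile hu huv hv hm]
  have hin : ∀ u v, a ≤ u → 0 < u → u ≤ v → v ≤ b → ∫ s in u..v, q s / s = h u - h v := by
    intro u v hau hu huv hvb
    have : ∫ s in u..v, q s / s = ∫ s in u..v, -(p s / s) := by
      refine intervalIntegral.integral_congr_ae (Eventually.of_forall fun s hs => ?_)
      rw [uIoc_of_le huv] at hs
      simp only [hq]
      rw [if_pos ⟨hau.trans_lt hs.1, hs.2.trans hvb⟩, neg_div]
    rw [this, intervalIntegral.integral_neg, hpiece u v hu huv (hvb.trans hbR)]; ring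
  have hout : ∀ u v, 0 < u → u ≤ v → v ≤ R → (v ≤ a ∨ b ≤ u) →
      ∫ s in u..v, q s / s = h v - h u := by
    intro u v hu huv hv hor
    rw [← hpiece u v hu huv hv]
    refine intervalIntegral.integral_congr_ae (Eventually.of_forall fun s hs => ?_)
    rw [uIoc_of_le huv] at hs
    simp only [hq]
    rw [if_neg]
    rintro ⟨h1, h2⟩
    rcases hor with h' | h'
    · linarith [hs.2]
    · linarith [hs.1]
  have hb0 : 0 < b := ha0.trans_lt hab
  have hprofb : ∀ r, 0 < r → r ≤ b → profile R q r = -∫ s in r..b, q s / s := by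
    intro r hr hrb
    rw [profile, ← intervalIntegral.integral_add_adjacent_intervals
      (intervalIntegrable_div_id hr hrb hbR hqm) (intervalIntegrable_div_id hb0 hbR le_rfl hqm),
      hout b R hb0 hbR le_rfl (Or.inr le_rfl), hR1, hb]
    ring
  have hprof : ∀ r ∈ Ioc 0 R, profile R q r = if r ∈ Ioc a b then -h r else h r := by
    intro r hr
    rcases le_or_gt r b with hrb | hrb
    · rw [hprofb r hr.1 hrb]
      rcases lt_or_ge a r with har | har
      · rw [if_pos ⟨har, hrb⟩, hin r b har.le hr.1 hrb le_rfl, hb, sub_zero]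
      · rw [if_neg fun h' => (not_lt.2 har) h'.1]
        have ha' : 0 < a := hr.1.trans_le har
        rw [← intervalIntegral.integral_add_adjacent_intervals
          (intervalIntegrable_div_id hr.1 har (hab.le.trans hbR) hqm)
          (intervalIntegrable_div_id ha' hab.le hbR hqm), hin a b le_rfl ha' hab.le le_rfl,
          hout r a hr.1 har (hab.le.trans hbR) (Or.inl le_rfl), ha, hb]
        ring
    · rw [if_neg fun h' => (not_le.2 hrb) h'.2, profile,
        hout r R hr.1 hr.2 le_rfl (Or.inr hrb.le), hR1]
      ring
  set D : ℝ → ℝ := fun r => 2 * coupling t * (r ^ 2 * h r ^ 3) with hD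
  have hsubR : Icc a b ⊆ Icc 0 R := Icc_subset_Icc ha0 hbR
  have hDc : ContinuousOn D (Icc a b) :=
    continuousOn_const.mul ((continuous_pow 2).continuousOn.mul ((hc.mono hsubR).pow 3))
  have hDi : IntegrableOn D (Ioc a b) := hDc.integrableOn_Icc.mono_set Ioc_subset_Icc_self
  have hpot : ∀ r ∈ Ioc 0 R, potential t r (profile R q r) =
      potential t r (profile R p r) + (Ioc a b).indicator D r := by
    intro r hr
    rw [hprof r hr, ← hh hr]
    by_cases hrab : r ∈ Ioc a b
    · rw [if_pos hrab, indicator_of_mem hrab, potential_neg ht]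
    · rw [if_neg hrab, indicator_of_notMem hrab, add_zero]
  have hDi' : IntegrableOn ((Ioc a b).indicator D) (Ioc 0 R) :=
    ((integrable_indicator_iff measurableSet_Ioc).2 hDi).integrableOn
  have hqf : FiniteEnergy t R q := by
    refine ⟨hqm, (hp.1.integrableOn.add hDi').congr ?_⟩
    filter_upwards [ae_restrict_mem measurableSet_Ioc] with r hr using (hpot r hr).symm
  have hle := hp.2 q hqf
  have e1 : ∫ r in Ioc 0 R, q r ^ 2 = ∫ r in Ioc 0 R, p r ^ 2 := by
    congr 1; ext r
    simp only [hq]; split_ifs <;> ring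
  have e2 : ∫ r in Ioc 0 R, potential t r (profile R q r) =
      (∫ r in Ioc 0 R, potential t r (profile R p r)) + ∫ r in a..b, D r := by
    rw [setIntegral_congr_fun measurableSet_Ioc hpot, integral_add hp.1.integrableOn hDi',
      integral_indicator measurableSet_Ioc, Measure.restrict_restrict measurableSet_Ioc,
      inter_eq_left.2 (Ioc_subset_Ioc ha0 hbR), intervalIntegral.integral_of_le hab.le]
  have hpos : 0 < ∫ r in a..b, -D r := by
    refine intervalIntegral.intervalIntegral_pos_of_pos_on ?_ (fun r hr => ?_) hab
    · exact ((intervalIntegrable_iff_integrableOn_Ioc_of_le hab.le).2 hDi).neg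
    · have h1 : 0 < -h r := neg_pos.2 (hlt r hr)
      have h2 : 0 < r := ha0.trans_lt hr.1
      have e : -D r = 2 * coupling t * (r ^ 2 * (-h r) ^ 3) := by simp only [hD]; ring
      rw [e]; positivity
  rw [intervalIntegral.integral_neg] at hpos
  rw [weightedEnergy, weightedEnergy, e1, e2] at hle
  linarith

namespace IsRadialSolution

variable {t R : ℝ} {h h' : ℝ → ℝ}

/-- The solution concept does not see the value at `0`, which can be prescribed freely. -/
theorem congr (hR : 0 < R) (S : IsRadialSolution t R h) (hh : EqOn h' h (Ioc 0 R)) :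
    IsRadialSolution t R h' := by
  have hf : EqOn (force t h') (force t h) (Ioc 0 R) := fun r hr => by simp only [force, hh hr]
  have hfl : EqOn (flux t h') (flux t h) (Ioc 0 R) := fun r hr => by
    refine intervalIntegral.integral_congr_ae (Eventually.of_forall fun s hs => ?_)
    rw [uIoc_of_le hr.1.le] at hs
    exact hf ⟨hs.1, hs.2.trans hr.2⟩
  refine ⟨S.continuousOn.congr hh, by rw [hh ⟨hR, le_rfl⟩, S.boundary],
    S.integrableOn_force.congr_fun hf.symm measurableSet_Ioc, fun a b ha hab hb => ?_⟩
  rw [hh ⟨ha, hab.trans hb⟩, hh ⟨ha.trans_le hab, hb⟩, S.sub_eq a b ha hab hb]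
  refine intervalIntegral.integral_congr_ae (Eventually.of_forall fun s hs => ?_)
  rw [uIoc_of_le hab] at hs
  rw [hfl ⟨ha.trans hs.1, hs.2.trans hb⟩]

theorem tendsto_zero (ht : 0 < t) (hR : 0 < R) (S : IsRadialSolution t R h) :
    Tendsto h (𝓝[>] 0) (𝓝 0) := by
  obtain ⟨W, hW, hWh⟩ := S.exists_analyticAt_zero ht hR
  have h1 : ContinuousAt (fun r : ℝ => r ^ 2 * W (r ^ 2)) 0 := by
    refine (continuous_pow 2).continuousAt.mul (ContinuousAt.comp' ?_ (continuous_pow 2).continuousAt)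
    simpa using hW.continuousAt
  have h2 := h1.tendsto.mono_left (nhdsWithin_le_nhds (s := Ioi 0))
  simp only [ne_eq, OfNat.ofNat_ne_zero, not_false_eq_true, zero_pow, zero_mul] at h2
  exact h2.congr' (hWh.mono fun r hr => hr.symm)

theorem analyticAt (S : IsRadialSolution t R h) {r : ℝ} (hr : r ∈ Ioo 0 R) :
    AnalyticAt ℝ h r := by
  obtain ⟨Y, hY, hYh⟩ := S.exists_analyticAt (hr.1.trans hr.2) ⟨hr.1, hr.2.le⟩
  rw [nhdsWithin_eq_nhds.2 (Iic_mem_nhds hr.2)] at hYh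
  exact hY.congr (hYh.mono fun x hx => hx.symm)

theorem analyticOn (ht : 0 < t) (hR : 0 < R) (S : IsRadialSolution t R h) (h0 : h 0 = 0) :
    AnalyticOn ℝ h (Icc 0 R) := by
  intro r hr
  rcases hr.1.eq_or_lt with hr0 | hr0
  · subst hr0
    obtain ⟨W, hW, hWh⟩ := S.exists_analyticAt_zero ht hR
    have h1 : AnalyticAt ℝ (fun r : ℝ => r ^ 2 * W (r ^ 2)) 0 :=
      (analyticAt_id.pow 2).mul (AnalyticAt.fun_comp (by simpa using hW) (analyticAt_id.pow 2))
    refine h1.analyticWithinAt.congr_of_eventuallyEq ?_ (by simp [h0])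
    have h2 : ∀ᶠ r in 𝓝[≥] (0 : ℝ), h r = r ^ 2 * W (r ^ 2) := by
      rw [← Ioi_insert, nhdsWithin_insert, eventually_sup]
      exact ⟨by simp [h0], hWh⟩
    exact h2.filter_mono (nhdsWithin_mono _ fun x hx => hx.1)
  · obtain ⟨Y, hY, hYh⟩ := S.exists_analyticAt hR ⟨hr0, hr.2⟩
    exact hY.analyticWithinAt.congr_of_eventuallyEq
      (hYh.filter_mono (nhdsWithin_mono _ fun x hx => hx.2))
      (hYh.self_of_nhdsWithin hr.2)

theorem deriv_eq (S : IsRadialSolution t R h) {r : ℝ} (hr : r ∈ Ioo 0 R) :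
    deriv h r = flux t h r / r ^ 2 := (S.hasDerivAt hr).deriv

theorem euler_lagrange (S : IsRadialSolution t R h) {r : ℝ} (hr : r ∈ Ioo 0 R) :
    deriv (deriv h) r + 2 / r * deriv h r - 6 * h r / r ^ 2 = bulkDeriv t (h r) := by
  have hr0 : r ≠ 0 := hr.1.ne'
  have h1 : deriv h =ᶠ[𝓝 r] fun x => flux t h x / x ^ 2 := by
    filter_upwards [isOpen_Ioo.mem_nhds hr] with x hx using S.deriv_eq hx
  have h2 := (S.hasDerivAt_flux hr).div (hasDerivAt_pow 2 r) (pow_ne_zero 2 hr0)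
  have h3 : deriv (fun x => flux t h x / x ^ 2) r = _ := h2.deriv
  rw [h1.deriv_eq, h3, S.deriv_eq hr, force]
  field_simp
  ring

end IsRadialSolution

/-- The slope density of an admissible function. -/
theorem Admissible.profile_eq {R : ℝ} (hR : 0 < R) {h g : ℝ → ℝ} (H : Admissible R h g) :
    EqOn h (profile R fun r => r * g r) (Ioc 0 R) := by
  intro r hr
  have hg : IntegrableOn g (Ioc 0 R) :=
    (show IntegrableOn g (Icc 0 R) volume from
      H.memW12.memLp_deriv.integrable (by norm_num)).mono_set Ioc_subset_Icc_self
  rw [H.memW12.weakDeriv.eq_integral hR hg H.continuousOn r ⟨hr.1.le, hr.2⟩, H.boundary, profile]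
  congr 1
  refine intervalIntegral.integral_congr_ae (Eventually.of_forall fun s hs => ?_)
  rw [uIoc_of_le hr.2] at hs
  have : s ≠ 0 := (hr.1.trans hs.1).ne'
  field_simp

theorem Admissible.finiteEnergy (t : ℝ) {R : ℝ} (hR : 0 < R) {h g : ℝ → ℝ}
    (H : Admissible R h g) : FiniteEnergy t R fun r => r * g r := by
  refine ⟨?_, ?_⟩
  · have h1 : MemLp g 2 (volume.restrict (Ioc 0 R)) :=
      H.memW12.memLp_deriv.mono_measure (Measure.restrict_mono Ioc_subset_Icc_self le_rfl)
    refine (h1.const_mul R).mono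
      (continuous_id.aestronglyMeasurable.mul h1.aestronglyMeasurable) ?_
    filter_upwards [ae_restrict_mem measurableSet_Ioc] with r hr
    rw [norm_mul, norm_mul, Real.norm_of_nonneg hr.1.le, Real.norm_of_nonneg hR.le]
    gcongr
    exact hr.2
  · have h1 : ContinuousOn (fun r => potential t r (h r)) (Icc 0 R) :=
      (continuousOn_const.mul (H.continuousOn.pow 2)).add ((continuous_pow 2).continuousOn.mul
        ((continuous_bulk t).comp_continuousOn H.continuousOn))
    refine (h1.integrableOn_Icc.mono_set Ioc_subset_Icc_self).congr_fun (fun r hr => ?_)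
      measurableSet_Ioc
    simp only [H.profile_eq hR hr]

theorem Admissible.radialEnergy_eq (t : ℝ) {R : ℝ} (hR : 0 < R) {h g : ℝ → ℝ}
    (H : Admissible R h g) : radialEnergy t R h g = weightedEnergy t R fun r => r * g r := by
  have hf := H.finiteEnergy t hR
  rw [radialEnergy, intervalIntegral.integral_of_le hR.le, weightedEnergy, ← integral_div,
    ← integral_add (hf.memLp.integrable_sq.div_const 2) hf.integrableOn]
  refine setIntegral_congr_fun measurableSet_Ioc fun r hr => ?_
  have : r ≠ 0 := hr.1.ne'
  simp only [← H.profile_eq hR hr, potential]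
  field_simp
  ring

/-- The minimizer of the weighted problem is an admissible function. -/
theorem IsWeightedMinimizer.exists_admissible {t R : ℝ} (ht : 0 < t) (hR : 0 < R) {p : ℝ → ℝ}
    (hp : IsWeightedMinimizer t R p) :
    ∃ h g, Admissible R h g ∧ radialEnergy t R h g = weightedEnergy t R p := by
  have S₀ := hp.isRadialSolution ht hR
  -- The value at `0` is the limit of the profile; the integral defining the profile need not give
  -- it directly.
  set h : ℝ → ℝ := fun r => if r = 0 then 0 else profile R p r with hh
  have hhp : EqOn h (profile R p) (Ioc 0 R) := fun r hr => by simp [hh, hr.1.ne']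
  have S := S₀.congr hR hhp
  have hA := S.analyticOn ht hR (by simp [hh])
  have hu : UniqueDiffOn ℝ (Icc 0 R) := uniqueDiffOn_Icc hR
  set g : ℝ → ℝ := derivWithin h (Icc 0 R) with hg
  have hgc : ContinuousOn g (Icc 0 R) :=
    (hA.contDiffOn hu (n := 1)).continuousOn_derivWithin hu le_rfl
  have hgd : ∀ r ∈ Ioo 0 R, HasDerivAt h (g r) r := fun r hr => by
    rw [hg, derivWithin_of_mem_nhds (Icc_mem_nhds hr.1 hr.2)]
    exact (S.hasDerivAt hr).differentiableAt.hasDerivAt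
  have hLp : ∀ f : ℝ → ℝ, ContinuousOn f (Icc 0 R) → MemLp f 2 (volume.restrict (Icc 0 R)) := by
    intro f hf
    obtain ⟨C, hC⟩ := isCompact_Icc.exists_bound_of_continuousOn hf
    exact MemLp.of_bound (hf.aestronglyMeasurable measurableSet_Icc) C
      ((ae_restrict_iff' measurableSet_Icc).2 (Eventually.of_forall hC))
  have hadm : Admissible R h g := by
    refine ⟨⟨hLp h hA.continuousOn, hLp g hgc, ?_⟩, hA.continuousOn, S.boundary⟩
    refine IsWeakDeriv.of_eq_integral hR (hgc.integrableOn_Icc.mono_set Ioc_subset_Icc_self)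
      fun r hr => ?_
    have hsub : Icc r R ⊆ Icc 0 R := Icc_subset_Icc_left hr.1.le
    rw [intervalIntegral.integral_eq_sub_of_hasDerivAt_of_le hr.2 (hA.continuousOn.mono hsub)
      (fun x hx => hgd x ⟨hr.1.trans hx.1, hx.2⟩)]
    · ring
    · exact ContinuousOn.intervalIntegrable (by rw [uIcc_of_le hr.2]; exact hgc.mono hsub)
  refine ⟨h, g, hadm, ?_⟩
  rw [hadm.radialEnergy_eq t hR]
  refine weightedEnergy_congr ?_
  have hne : ∀ᵐ r ∂volume.restrict (Ioc 0 R), r ≠ R :=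
    ae_restrict_of_ae (by simp [ae_iff])
  filter_upwards [hp.ae_eq_flux ht hR, ae_restrict_mem measurableSet_Ioc, hne] with r hr hr' hrR
  have hrI : r ∈ Ioo 0 R := ⟨hr'.1, lt_of_le_of_ne hr'.2 hrR⟩
  have h1 : HasDerivAt h (flux t (profile R p) r / r ^ 2) r := by
    refine (S₀.hasDerivAt hrI).congr_of_eventuallyEq ?_
    filter_upwards [Ioc_mem_nhds hrI.1 hrI.2] with x hx using hhp hx
  rw [(hgd r hrI).unique h1, ← hr]
  have := hr'.1
  field_simp

/-- Every admissible function competes in the larger weighted class, whose minimizer is itself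
admissible by regularity. -/
theorem exists_isGlobalMinimizer {t R : ℝ} (ht : 0 < t) (hR : 0 < R) :
    ∃ h, IsGlobalMinimizer t R h := by
  obtain ⟨p, hp⟩ := exists_isWeightedMinimizer ht R
  obtain ⟨h, g, hadm, he⟩ := hp.exists_admissible ht hR
  refine ⟨h, g, hadm, fun k k' hk => ?_⟩
  rw [he, hk.radialEnergy_eq t hR]
  exact hp.2 _ (hk.finiteEnergy t hR)

/-- What the analysis of the radial problem yields about a global minimizer. -/
theorem IsGlobalMinimizer.properties {t R : ℝ} (ht : 0 < t) (hR : 0 < R) {h : ℝ → ℝ}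
    (H : IsGlobalMinimizer t R h) :
    IsRadialSolution t R h ∧ h 0 = 0 ∧ (∀ r ∈ Icc 0 R, 0 ≤ h r ∧ h r ≤ 1) ∧
      IntegrableOn (fun r => (r * deriv h r) ^ 2) (Ioc 0 R) ∧
      IntegrableOn (fun r => potential t r (h r)) (Ioc 0 R) ∧
      (∫ r in Ioc 0 R, (r * deriv h r) ^ 2) / 2 + ∫ r in Ioc 0 R, potential t r (h r) ≤ 3 * R := by
  obtain ⟨g, hadm, hmin⟩ := H
  -- Both problems have the same minimum, so an arbitrary global minimizer also minimizes in the
  -- larger class and inherits its regularity theory.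
  have hp : IsWeightedMinimizer t R fun r => r * g r := by
    refine ⟨hadm.finiteEnergy t hR, fun q hq => ?_⟩
    obtain ⟨p, hp⟩ := exists_isWeightedMinimizer ht R
    obtain ⟨k, k', hk, he⟩ := hp.exists_admissible ht hR
    calc _ = radialEnergy t R h g := (hadm.radialEnergy_eq t hR).symm
      _ ≤ radialEnergy t R k k' := hmin k k' hk
      _ = weightedEnergy t R p := he
      _ ≤ weightedEnergy t R q := hp.2 q hq
  have hprof := hadm.profile_eq hR
  have S := (hp.isRadialSolution ht hR).congr hR hprof
  have h0 : h 0 = 0 := by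
    have h1 : Tendsto h (𝓝[>] 0) (𝓝 (h 0)) :=
      (hadm.continuousOn 0 ⟨le_rfl, hR.le⟩).mono_of_mem_nhdsWithin
        (mem_of_superset (Ioo_mem_nhdsGT hR) Ioo_subset_Icc_self)
    exact tendsto_nhds_unique h1 (S.tendsto_zero ht hR)
  have hnn := hp.profile_nonneg ht hprof hadm.continuousOn h0 hadm.boundary
  have hne : ∀ᵐ r ∂volume.restrict (Ioc 0 R), r ≠ R := ae_restrict_of_ae (by simp [ae_iff])
  have hae : (fun r => (r * g r) ^ 2) =ᵐ[volume.restrict (Ioc 0 R)] fun r => (r * deriv h r) ^ 2 := by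
    filter_upwards [hp.ae_eq_flux ht hR, ae_restrict_mem measurableSet_Ioc, hne] with r hr hr' hrR
    have hrI : r ∈ Ioo 0 R := ⟨hr'.1, lt_of_le_of_ne hr'.2 hrR⟩
    have hfl : flux t h r = flux t (profile R fun r => r * g r) r := by
      refine intervalIntegral.integral_congr_ae (Eventually.of_forall fun s hs => ?_)
      rw [uIoc_of_le hr'.1.le] at hs
      simp only [force, hprof ⟨hs.1, hs.2.trans hr'.2⟩]
    have hr0 : r ≠ 0 := hr'.1.ne'
    rw [S.deriv_eq hrI, hfl, ← hr]
    field_simp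
  have hpot : EqOn (fun r => potential t r (profile R (fun r => r * g r) r))
      (fun r => potential t r (h r)) (Ioc 0 R) := fun r hr => by simp only [hprof hr]
  refine ⟨S, h0, fun r hr => ⟨hnn r hr, ?_⟩, hp.1.memLp.integrable_sq.congr hae,
    hp.1.integrableOn.congr_fun hpot measurableSet_Ioc, ?_⟩
  · rcases hr.1.eq_or_lt with hr0 | hr0
    · rw [← hr0, h0]; exact zero_le_one
    · exact S.le_one ht r ⟨hr0, hr.2⟩
  -- Comparison with `h ≡ 1`.
  · rw [← integral_congr_ae hae, ← setIntegral_congr_fun measurableSet_Ioc hpot,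
      ← weightedEnergy_zero (t := t) hR.le]
    exact hp.2 0 (finiteEnergy_zero t R)

end Hedgehog

/-! ### Calculus of a radial factor times a harmonic quadratic form. -/

namespace Hedgehog

open Filter Topology

theorem norm_sq_eq (x : E3) : ‖x‖ ^ 2 = x 0 ^ 2 + x 1 ^ 2 + x 2 ^ 2 := by
  rw [EuclideanSpace.real_norm_sq_eq, Fin.sum_univ_three]

/-- The components of the harmonic quadratic form `x ⊗ x - |x|² I / 3`. -/
noncomputable def quad (i j : Fin 3) (y : E3) : ℝ := y i * y j - (1 : M3) i j / 3 * ‖y‖ ^ 2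

/-- The partial derivatives of `quad`. -/
noncomputable def quadGrad (i j k : Fin 3) (y : E3) : ℝ :=
  (1 : M3) i k * y j + y i * (1 : M3) j k - 2 / 3 * (1 : M3) i j * y k

theorem hasFDerivAt_coord (i : Fin 3) (x : E3) :
    HasFDerivAt (fun y : E3 => y i) (EuclideanSpace.proj i : E3 →L[ℝ] ℝ) x :=
  (EuclideanSpace.proj i : E3 →L[ℝ] ℝ).hasFDerivAt

theorem proj_single (i k : Fin 3) :
    (EuclideanSpace.proj i : E3 →L[ℝ] ℝ) (EuclideanSpace.single k 1) = (1 : M3) i k := by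
  simp [Matrix.one_apply]

theorem inner_single (x : E3) (k : Fin 3) : inner ℝ x (EuclideanSpace.single k (1 : ℝ)) = x k := by
  simp [EuclideanSpace.inner_single_right]

theorem hasFDerivAt_radial {V : ℝ → ℝ} {V' : ℝ} {x : E3} (hV : HasDerivAt V V' (‖x‖ ^ 2)) :
    HasFDerivAt (fun y : E3 => V (‖y‖ ^ 2)) (V' • (2 • (innerSL ℝ x))) x :=
  hV.comp_hasFDerivAt x (hasStrictFDerivAt_norm_sq x).hasFDerivAt

theorem fderiv_radial_mul {V : ℝ → ℝ} {V' : ℝ} {x : E3} {f : E3 → ℝ}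
    (hV : HasDerivAt V V' (‖x‖ ^ 2)) (hf : DifferentiableAt ℝ f x) (k : Fin 3) :
    fderiv ℝ (fun y => V (‖y‖ ^ 2) * f y) x (EuclideanSpace.single k 1) =
      2 * x k * V' * f x + V (‖x‖ ^ 2) * fderiv ℝ f x (EuclideanSpace.single k 1) := by
  have h := (hasFDerivAt_radial hV).mul hf.hasFDerivAt
  have h' : fderiv ℝ (fun y => V (‖y‖ ^ 2) * f y) x = _ := h.fderiv
  rw [h']
  simp only [add_apply, smul_apply, innerSL_apply_apply,
    inner_single, smul_eq_mul, nsmul_eq_mul]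
  push_cast
  ring

theorem contDiff_quad (i j : Fin 3) : ContDiff ℝ ω (quad i j) := by
  have h1 : ∀ i : Fin 3, ContDiff ℝ ω fun y : E3 => y i := fun i =>
    (EuclideanSpace.proj i : E3 →L[ℝ] ℝ).contDiff
  exact ((h1 i).mul (h1 j)).sub (contDiff_const.mul (contDiff_norm_sq ℝ))

theorem contDiff_quadGrad (i j k : Fin 3) : ContDiff ℝ ω (quadGrad i j k) := by
  have h1 : ∀ i : Fin 3, ContDiff ℝ ω fun y : E3 => y i := fun i =>
    (EuclideanSpace.proj i : E3 →L[ℝ] ℝ).contDiff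
  exact ((contDiff_const.mul (h1 j)).add ((h1 i).mul contDiff_const)).sub
    (contDiff_const.mul (h1 k))

theorem fderiv_quad (i j k : Fin 3) (x : E3) :
    fderiv ℝ (quad i j) x (EuclideanSpace.single k 1) = quadGrad i j k x := by
  have h := ((hasFDerivAt_coord i x).mul (hasFDerivAt_coord j x)).sub
    ((hasStrictFDerivAt_norm_sq x).hasFDerivAt.const_mul ((1 : M3) i j / 3))
  have h' : fderiv ℝ (quad i j) x = _ := h.fderiv
  rw [h']
  simp only [sub_apply, add_apply,
    smul_apply, innerSL_apply_apply, inner_single, smul_eq_mul, nsmul_eq_mul,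
    proj_single, quadGrad]
  push_cast
  ring

theorem fderiv_quadGrad (i j k : Fin 3) (x : E3) :
    fderiv ℝ (quadGrad i j k) x (EuclideanSpace.single k 1) =
      2 * ((1 : M3) i k * (1 : M3) j k) - 2 / 3 * (1 : M3) i j := by
  have h := (((hasFDerivAt_coord j x).const_mul ((1 : M3) i k)).add
    ((hasFDerivAt_coord i x).mul_const ((1 : M3) j k))).sub
    ((hasFDerivAt_coord k x).const_mul (2 / 3 * (1 : M3) i j))
  have h' : fderiv ℝ (quadGrad i j k) x = _ := h.fderiv
  rw [h']
  simp only [sub_apply, add_apply,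
    smul_apply, smul_eq_mul, proj_single, Matrix.one_apply_eq]
  ring

theorem contDiffAt_radial_mul_quad {W : ℝ → ℝ} {x : E3} (hW : AnalyticAt ℝ W (‖x‖ ^ 2))
    (i j : Fin 3) : ContDiffAt ℝ ω (fun y : E3 => W (‖y‖ ^ 2) * quad i j y) x :=
  (ContDiffAt.comp x hW.contDiffAt (contDiff_norm_sq ℝ).contDiffAt).mul (contDiff_quad i j).contDiffAt

theorem fderiv_radial_mul_quad {W : ℝ → ℝ} {x : E3} (hW : AnalyticAt ℝ W (‖x‖ ^ 2))
    (i j k : Fin 3) :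
    fderiv ℝ (fun y : E3 => W (‖y‖ ^ 2) * quad i j y) x (EuclideanSpace.single k 1) =
      deriv W (‖x‖ ^ 2) * (2 * x k * quad i j x) + W (‖x‖ ^ 2) * quadGrad i j k x := by
  rw [fderiv_radial_mul hW.differentiableAt.hasDerivAt
    ((contDiff_quad i j).differentiable (by simp) x), fderiv_quad]
  ring

theorem laplacian_eq_sum_fderiv {f : E3 → ℝ} {x : E3} (hf : ContDiffAt ℝ 2 f x) :
    (Δ f) x = ∑ k, fderiv ℝ (fun y => fderiv ℝ f y (EuclideanSpace.single k 1)) x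
      (EuclideanSpace.single k 1) := by
  rw [InnerProductSpace.laplacian_eq_iteratedFDeriv_orthonormalBasis f
    (EuclideanSpace.basisFun (Fin 3) ℝ)]
  refine Finset.sum_congr rfl fun k _ => ?_
  have hd : DifferentiableAt ℝ (fderiv ℝ f) x :=
    (hf.fderiv_right (m := 1) (by norm_num)).differentiableAt (by simp)
  rw [iteratedFDeriv_two_apply, fderiv_clm_apply hd (differentiableAt_const _)]
  simp

/-- The form is harmonic and homogeneous of degree 2. The coefficient is `14 = 6 + 8`: `6` from
`Δ|x|²`, and `8` from the cross term by Euler's identity. -/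
theorem laplacian_radial_mul_quad {W : ℝ → ℝ} {x : E3} (hW : AnalyticAt ℝ W (‖x‖ ^ 2))
    (i j : Fin 3) :
    (Δ (fun y : E3 => W (‖y‖ ^ 2) * quad i j y)) x =
      (4 * ‖x‖ ^ 2 * deriv (deriv W) (‖x‖ ^ 2) + 14 * deriv W (‖x‖ ^ 2)) * quad i j x := by
  have hcd := (contDiffAt_radial_mul_quad hW i j).of_le (m := 2) (by simp)
  have hev : ∀ᶠ y in 𝓝 x, AnalyticAt ℝ W (‖y‖ ^ 2) :=
    ((continuous_norm.pow 2).continuousAt (x := x)).eventually hW.eventually_analyticAt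
  have key : ∀ k, fderiv ℝ (fun y => fderiv ℝ (fun y : E3 => W (‖y‖ ^ 2) * quad i j y) y
      (EuclideanSpace.single k 1)) x (EuclideanSpace.single k 1) =
      2 * x k * deriv (deriv W) (‖x‖ ^ 2) * (2 * x k * quad i j x)
        + deriv W (‖x‖ ^ 2) * (2 * quad i j x + 2 * x k * quadGrad i j k x)
        + (2 * x k * deriv W (‖x‖ ^ 2) * quadGrad i j k x
        + W (‖x‖ ^ 2) * (2 * ((1 : M3) i k * (1 : M3) j k) - 2 / 3 * (1 : M3) i j)) := by
    intro k
    have e1 : (fun y => fderiv ℝ (fun y : E3 => W (‖y‖ ^ 2) * quad i j y) y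
        (EuclideanSpace.single k 1)) =ᶠ[𝓝 x] fun y =>
        deriv W (‖y‖ ^ 2) * (2 * y k * quad i j y) + W (‖y‖ ^ 2) * quadGrad i j k y := by
      filter_upwards [hev] with y hy using fderiv_radial_mul_quad hy i j k
    have hW' := hW.deriv
    have hq : DifferentiableAt ℝ (quad i j) x := (contDiff_quad i j).differentiable (by simp) x
    have hqg : DifferentiableAt ℝ (quadGrad i j k) x :=
      (contDiff_quadGrad i j k).differentiable (by simp) x
    have hk2 : DifferentiableAt ℝ (fun y : E3 => 2 * y k) x :=
      ((hasFDerivAt_coord k x).const_mul 2).differentiableAt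
    have h2q : DifferentiableAt ℝ (fun y : E3 => 2 * y k * quad i j y) x := hk2.mul hq
    have e2 : fderiv ℝ (fun y : E3 => 2 * y k * quad i j y) x (EuclideanSpace.single k 1) =
        2 * quad i j x + 2 * x k * quadGrad i j k x := by
      have h := ((hasFDerivAt_coord k x).const_mul 2).mul hq.hasFDerivAt
      have h' : fderiv ℝ (fun y : E3 => 2 * y k * quad i j y) x = _ := h.fderiv
      rw [h']
      simp only [add_apply, smul_apply, smul_eq_mul,
        proj_single, Matrix.one_apply_eq, fderiv_quad]
      ring
    have hr : ∀ {V : ℝ → ℝ}, AnalyticAt ℝ V (‖x‖ ^ 2) →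
        DifferentiableAt ℝ (fun y : E3 => V (‖y‖ ^ 2)) x := fun hV =>
      (hasFDerivAt_radial hV.differentiableAt.hasDerivAt).differentiableAt
    have d1 : DifferentiableAt ℝ (fun y : E3 => deriv W (‖y‖ ^ 2) * (2 * y k * quad i j y)) x :=
      (hr hW').mul h2q
    have d2 : DifferentiableAt ℝ (fun y : E3 => W (‖y‖ ^ 2) * quadGrad i j k y) x :=
      (hr hW).mul hqg
    rw [e1.fderiv_eq, fderiv_fun_add d1 d2,
      add_apply, fderiv_radial_mul hW'.differentiableAt.hasDerivAt h2q, e2,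
      fderiv_radial_mul hW.differentiableAt.hasDerivAt hqg, fderiv_quadGrad]
  rw [laplacian_eq_sum_fderiv hcd]
  simp only [key, Fin.sum_univ_three, norm_sq_eq x]
  -- With the values of `W` and its derivatives made opaque, a polynomial identity in the
  -- coordinates remains.
  generalize W (x 0 ^ 2 + x 1 ^ 2 + x 2 ^ 2) = w₀
  generalize deriv W (x 0 ^ 2 + x 1 ^ 2 + x 2 ^ 2) = w₁
  generalize deriv (deriv W) (x 0 ^ 2 + x 1 ^ 2 + x 2 ^ 2) = w₂
  simp only [quad, quadGrad, norm_sq_eq x]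
  fin_cases i <;> fin_cases j <;> simp [Matrix.one_apply] <;> ring

/-- With `h = r² W(r²)` the bracket is `h'² + 6 h²/r²`; the `6` is the eigenvalue `2·3` of degree 2
spherical harmonics. -/
theorem gradSq_radial_mul_quad {W : ℝ → ℝ} {x : E3} (hW : AnalyticAt ℝ W (‖x‖ ^ 2)) {c : ℝ}
    {Q : E3 → M3} (hQ : ∀ i j, (fun y => Q y i j) =ᶠ[𝓝 x] fun y => c * (W (‖y‖ ^ 2) * quad i j y)) :
    gradSq Q x = 2 / 3 * c ^ 2 * ((2 * ‖x‖ * W (‖x‖ ^ 2) + 2 * ‖x‖ ^ 3 * deriv W (‖x‖ ^ 2)) ^ 2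
      + 6 * ‖x‖ ^ 2 * W (‖x‖ ^ 2) ^ 2) := by
  have e : ∀ i j k, fderiv ℝ (fun y => Q y i j) x (EuclideanSpace.single k 1) =
      c * (deriv W (‖x‖ ^ 2) * (2 * x k * quad i j x) + W (‖x‖ ^ 2) * quadGrad i j k x) := by
    intro i j k
    rw [(hQ i j).fderiv_eq, fderiv_const_mul
      ((contDiffAt_radial_mul_quad hW i j).differentiableAt (by simp)),
      smul_apply, fderiv_radial_mul_quad hW, smul_eq_mul]
  have e2 : 2 / 3 * c ^ 2 * ((2 * ‖x‖ * W (‖x‖ ^ 2) + 2 * ‖x‖ ^ 3 * deriv W (‖x‖ ^ 2)) ^ 2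
      + 6 * ‖x‖ ^ 2 * W (‖x‖ ^ 2) ^ 2) = 2 / 3 * c ^ 2 * (10 * ‖x‖ ^ 2 * W (‖x‖ ^ 2) ^ 2
      + 8 * (‖x‖ ^ 2) ^ 2 * W (‖x‖ ^ 2) * deriv W (‖x‖ ^ 2)
      + 4 * (‖x‖ ^ 2) ^ 3 * deriv W (‖x‖ ^ 2) ^ 2) := by ring
  rw [e2, gradSq]
  simp only [e, Fin.sum_univ_three, norm_sq_eq x]
  generalize W (x 0 ^ 2 + x 1 ^ 2 + x 2 ^ 2) = w₀
  generalize deriv W (x 0 ^ 2 + x 1 ^ 2 + x 2 ^ 2) = w₁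
  simp only [quad, quadGrad, norm_sq_eq x]
  simp
  ring

section Algebra

variable {c : ℝ} {x : E3} {A : M3}

/-- The eigenvalues of the form are `|x|²` times `2/3, -1/3, -1/3`; this gives `2/3` here and `2/9`
for the cube. -/
theorem trace_sq_of_quad (hA : ∀ i j, A i j = c * quad i j x) :
    (A ^ 2).trace = 2 / 3 * c ^ 2 * (‖x‖ ^ 2) ^ 2 := by
  rw [sq, Matrix.trace_fin_three]
  simp only [Matrix.mul_apply, Fin.sum_univ_three, hA, quad, norm_sq_eq x]
  simp
  ring

theorem trace_cube_of_quad (hA : ∀ i j, A i j = c * quad i j x) :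
    (A ^ 3).trace = 2 / 9 * c ^ 3 * (‖x‖ ^ 2) ^ 3 := by
  rw [pow_succ, sq, Matrix.trace_fin_three]
  simp only [Matrix.mul_apply, Fin.sum_univ_three, hA, quad, norm_sq_eq x]
  simp
  ring

/-- Uniaxial tensors are closed under the traceless square, which is why a scalar ansatz solves the
tensor system. -/
theorem mul_self_of_quad (hA : ∀ i j, A i j = c * quad i j x) (i j : Fin 3) :
    (A * A) i j - (1 : M3) i j / 3 * (A ^ 2).trace = c ^ 2 * ‖x‖ ^ 2 / 3 * quad i j x := by
  rw [trace_sq_of_quad hA]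
  simp only [Matrix.mul_apply, Fin.sum_univ_three, hA, quad, norm_sq_eq x]
  fin_cases i <;> fin_cases j <;> simp [Matrix.one_apply] <;> ring

end Algebra

end Hedgehog

/-! ### The hedgehog as a classical solution, and its energy. -/

namespace Hedgehog

open Filter Topology

theorem hedgehog_apply_of_ne_zero (h : ℝ → ℝ) {y : E3} (hy : y ≠ 0) (i j : Fin 3) :
    hedgehog h y i j = √(3 / 2) * (h ‖y‖ / ‖y‖ ^ 2 * quad i j y) := by
  have : ‖y‖ ≠ 0 := norm_ne_zero_iff.2 hy
  simp only [hedgehog, Matrix.of_apply, quad]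
  field_simp

namespace IsRadialSolution

variable {t R : ℝ} {h : ℝ → ℝ}

/-- Near a point of the punctured ball, `h(r) = r² W(r²)` with an analytic solution `W` of the
equation in the variable `r²`. -/
theorem exists_quotient_of_pos (S : IsRadialSolution t R h) {r : ℝ} (hr : r ∈ Ioo 0 R) :
    ∃ W : ℝ → ℝ, AnalyticAt ℝ W (r ^ 2) ∧ (∀ z, 0 < z → h z / z ^ 2 = W (z ^ 2)) ∧
      deriv h r = 2 * r * W (r ^ 2) + 2 * r ^ 3 * deriv W (r ^ 2) ∧
      4 * r ^ 2 * deriv (deriv W) (r ^ 2) + 14 * deriv W (r ^ 2) =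
        -W (r ^ 2) - 3 * coupling t * r ^ 2 * W (r ^ 2) ^ 2
          + (1 + 3 * coupling t) * (r ^ 2) ^ 2 * W (r ^ 2) ^ 3 := by
  have hr0 : 0 < r := hr.1
  have hWh : ∀ z, 0 < z → h z / z ^ 2 = h √(z ^ 2) / z ^ 2 := fun z hz => by
    rw [Real.sqrt_sq hz.le]
  have hW : AnalyticAt ℝ (fun ρ => h √ρ / ρ) (r ^ 2) := by
    have h1 : AnalyticAt ℝ Real.sqrt (r ^ 2) :=
      (Real.contDiffAt_sqrt (pow_pos hr0 2).ne' : ContDiffAt ℝ ω _ _).analyticAt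
    have h2 : AnalyticAt ℝ h √(r ^ 2) := by rw [Real.sqrt_sq hr0.le]; exact S.analyticAt hr
    exact (h2.fun_comp h1).div analyticAt_id (pow_pos hr0 2).ne'
  refine ⟨fun ρ => h √ρ / ρ, hW, hWh, ?_⟩
  generalize hWdef : (fun ρ => h √ρ / ρ) = W at hW
  have hWh' : ∀ z, 0 < z → h z = z ^ 2 * W (z ^ 2) := fun z hz => by
    rw [← hWdef]
    simp only
    rw [← hWh z hz]
    field_simp
  have hsq : ∀ z : ℝ, HasDerivAt (fun z : ℝ => z ^ 2) (2 * z) z := fun z => by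
    simpa using hasDerivAt_pow 2 z
  have hcube : ∀ z : ℝ, HasDerivAt (fun z : ℝ => z ^ 3) (3 * z ^ 2) z := fun z => by
    simpa using hasDerivAt_pow 3 z
  have hcomp : ∀ {V : ℝ → ℝ} {z : ℝ}, AnalyticAt ℝ V (z ^ 2) →
      HasDerivAt (fun z => V (z ^ 2)) (deriv V (z ^ 2) * (2 * z)) z := fun {V z} hV =>
    HasDerivAt.comp (h₂ := V) (h := fun z => z ^ 2) z hV.differentiableAt.hasDerivAt (hsq z)
  have hd1 : ∀ z, 0 < z → AnalyticAt ℝ W (z ^ 2) →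
      deriv h z = 2 * z * W (z ^ 2) + 2 * z ^ 3 * deriv W (z ^ 2) := by
    intro z hz hWz
    have e : h =ᶠ[𝓝 z] fun z => z ^ 2 * W (z ^ 2) := by
      filter_upwards [Ioi_mem_nhds hz] with y hy using hWh' y hy
    have h1 : deriv (fun z => z ^ 2 * W (z ^ 2)) z = _ := ((hsq z).mul (hcomp hWz)).deriv
    rw [e.deriv_eq, h1]; ring
  have hev : ∀ᶠ z in 𝓝 r, AnalyticAt ℝ W (z ^ 2) :=
    ((continuous_pow 2).continuousAt (x := r)).eventually hW.eventually_analyticAt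
  have hd2 : deriv (deriv h) r = 2 * W (r ^ 2) + 10 * r ^ 2 * deriv W (r ^ 2)
      + 4 * r ^ 4 * deriv (deriv W) (r ^ 2) := by
    have e : deriv h =ᶠ[𝓝 r] fun z => 2 * z * W (z ^ 2) + 2 * z ^ 3 * deriv W (z ^ 2) := by
      filter_upwards [hev, Ioi_mem_nhds hr0] with z h1 h2 using hd1 z h2 h1
    have h1 : deriv (fun z => 2 * z * W (z ^ 2) + 2 * z ^ 3 * deriv W (z ^ 2)) r = _ :=
      ((((hasDerivAt_id r).const_mul 2).mul (hcomp hW)).add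
        (((hcube r).const_mul 2).mul (hcomp hW.deriv))).deriv
    rw [e.deriv_eq, h1]
    simp only [id_eq]
    ring
  refine ⟨hd1 r hr0 hW, ?_⟩
  have hel := S.euler_lagrange hr
  rw [hd2, hd1 r hr0 hW, hWh' r hr0, bulkDeriv] at hel
  have hrne : r ≠ 0 := hr0.ne'
  field_simp at hel
  refine mul_left_cancel₀ (pow_ne_zero 2 hrne) ?_
  linear_combination hel

/-- The hedgehog is, near each point of the open ball, an analytic function of `|x|²` times a
harmonic quadratic form. -/
theorem hedgehog_eventuallyEq (ht : 0 < t) (hR : 0 < R) (S : IsRadialSolution t R h)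
    (h0 : h 0 = 0) {x : E3} (hx : x ∈ Metric.ball (0 : E3) R) :
    ∃ W : ℝ → ℝ, AnalyticAt ℝ W (‖x‖ ^ 2) ∧
      (∀ᶠ y in 𝓝 x, ∀ i j, hedgehog h y i j = √(3 / 2) * (W (‖y‖ ^ 2) * quad i j y)) ∧
      (x ≠ 0 → h ‖x‖ = ‖x‖ ^ 2 * W (‖x‖ ^ 2) ∧
        deriv h ‖x‖ = 2 * ‖x‖ * W (‖x‖ ^ 2) + 2 * ‖x‖ ^ 3 * deriv W (‖x‖ ^ 2) ∧
        4 * ‖x‖ ^ 2 * deriv (deriv W) (‖x‖ ^ 2) + 14 * deriv W (‖x‖ ^ 2) =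
          -W (‖x‖ ^ 2) - 3 * coupling t * ‖x‖ ^ 2 * W (‖x‖ ^ 2) ^ 2
            + (1 + 3 * coupling t) * (‖x‖ ^ 2) ^ 2 * W (‖x‖ ^ 2) ^ 3) := by
  rw [mem_ball_zero_iff] at hx
  rcases eq_or_ne x 0 with rfl | hx0
  · obtain ⟨W, hW, hWh⟩ := S.exists_analyticAt_zero ht hR
    refine ⟨W, by simpa using hW, ?_, fun h => absurd rfl h⟩
    obtain ⟨ε, hε, hsub⟩ := mem_nhdsGT_iff_exists_Ioo_subset.1 hWh
    filter_upwards [Metric.ball_mem_nhds (0 : E3) hε] with y hy i j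
    rw [mem_ball_zero_iff] at hy
    rcases eq_or_ne y 0 with rfl | hy0
    · simp [hedgehog, h0, quad]
    · have h1 : h ‖y‖ = ‖y‖ ^ 2 * W (‖y‖ ^ 2) := hsub ⟨norm_pos_iff.2 hy0, hy⟩
      have : ‖y‖ ≠ 0 := norm_ne_zero_iff.2 hy0
      rw [hedgehog_apply_of_ne_zero h hy0, h1]
      field_simp
  · have hpos : 0 < ‖x‖ := norm_pos_iff.2 hx0
    obtain ⟨W, hW, hWh, hd, hode⟩ := S.exists_quotient_of_pos ⟨hpos, hx⟩
    refine ⟨W, hW, ?_, fun _ => ⟨?_, hd, hode⟩⟩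
    · filter_upwards [isOpen_ne.mem_nhds hx0] with y hy i j
      rw [hedgehog_apply_of_ne_zero h hy, hWh _ (norm_pos_iff.2 hy)]
    · rw [← hWh _ hpos]; field_simp

/-- Locally every component is an analytic function of `|x|²` times the quadratic form, also at the
origin, so the singular direction `x/|x|` does no harm. -/
theorem isClassicalSolution (ht : 0 < t) (hR : 0 < R) (S : IsRadialSolution t R h)
    (h0 : h 0 = 0) : IsClassicalSolution t R (hedgehog h) := by
  have hdiff : ∀ i j, ContDiffOn ℝ 2 (fun x => hedgehog h x i j) (Metric.ball 0 R) := by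
    intro i j x hx
    obtain ⟨W, hW, hev, -⟩ := S.hedgehog_eventuallyEq ht hR h0 hx
    have h1 : ContDiffAt ℝ ω (fun y : E3 => √(3 / 2) * (W (‖y‖ ^ 2) * quad i j y)) x :=
      contDiffAt_const.mul (contDiffAt_radial_mul_quad hW i j)
    exact ((h1.congr_of_eventuallyEq (hev.mono fun y hy => hy i j)).of_le
      (by simp)).contDiffWithinAt
  refine ⟨fun x _ => ?_, hdiff, fun i j x hx => ?_, fun x hx i j => ?_, fun x hx i j => ?_⟩
  · refine ⟨?_, ?_⟩
    · ext i j
      simp only [hedgehog, Matrix.transpose_apply, Matrix.of_apply]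
      rw [mul_comm (x j), Matrix.one_apply, Matrix.one_apply]
      simp only [eq_comm]
    · rcases eq_or_ne x 0 with rfl | hx0
      · simp [Matrix.trace_fin_three, hedgehog, h0]
      · rw [Matrix.trace_fin_three]
        simp only [hedgehog_apply_of_ne_zero h hx0, quad, Matrix.one_apply_eq, norm_sq_eq x]
        ring
  · rcases eq_or_ne x 0 with rfl | hx0
    · exact ((hdiff i j).contDiffAt (Metric.ball_mem_nhds _ hR)).continuousAt.continuousWithinAt
    · have hxn : ‖x‖ ∈ Ioc 0 R := ⟨norm_pos_iff.2 hx0, mem_closedBall_zero_iff.1 hx⟩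
      have h1 : ContinuousWithinAt (fun y : E3 => h ‖y‖) (Metric.closedBall 0 R ∩ {0}ᶜ) x :=
        (S.continuousOn ‖x‖ hxn).comp continuous_norm.continuousWithinAt fun y hy =>
          ⟨norm_pos_iff.2 hy.2, mem_closedBall_zero_iff.1 hy.1⟩
      have h2 : ContinuousWithinAt (fun y : E3 => h ‖y‖) (Metric.closedBall 0 R) x :=
        h1.mono_of_mem_nhdsWithin (inter_mem self_mem_nhdsWithin
          (nhdsWithin_le_nhds (isOpen_compl_singleton.mem_nhds hx0)))
      have h3 : ContinuousAt (fun y : E3 => y i * y j / ‖y‖ ^ 2 - (1 : M3) i j / 3) x := by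
        have hc : ∀ i : Fin 3, Continuous fun y : E3 => y i := fun i =>
          (EuclideanSpace.proj i : E3 →L[ℝ] ℝ).continuous
        exact (((hc i).mul (hc j)).continuousAt.div (continuous_norm.pow 2).continuousAt
          (pow_ne_zero 2 (norm_ne_zero_iff.2 hx0))).sub continuousAt_const
      exact (h2.const_mul _).mul h3.continuousWithinAt
  · have hxR : ‖x‖ = R := mem_sphere_zero_iff_norm.1 hx
    simp only [hedgehog, Matrix.of_apply]
    rw [hxR, S.boundary, mul_one, div_mul_div_comm, ← sq]
  · obtain ⟨W, hW, hev, hprop⟩ := S.hedgehog_eventuallyEq ht hR h0 hx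
    have hev' : (fun y => hedgehog h y i j) =ᶠ[𝓝 x]
        √(3 / 2) • fun y => W (‖y‖ ^ 2) * quad i j y := hev.mono fun y hy => hy i j
    have hA : ∀ i j, hedgehog h x i j = (√(3 / 2) * W (‖x‖ ^ 2)) * quad i j x := fun i j => by
      rw [hev.self_of_nhds i j]; ring
    have hlap := InnerProductSpace.laplacian_smul √(3 / 2)
      ((contDiffAt_radial_mul_quad hW i j).of_le (m := 2) (by simp))
    rw [InnerProductSpace.laplacian_congr_nhds hev' |>.self_of_nhds, hlap,
      laplacian_radial_mul_quad hW, mul_self_of_quad hA, trace_sq_of_quad hA, hA i j, smul_eq_mul]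
    rcases eq_or_ne x 0 with rfl | hx0
    -- At the origin both sides are multiples of the form, which vanishes there.
    · simp [quad]
    obtain ⟨-, -, hode⟩ := hprop hx0
    have e32 : √(3 / 2) ^ 2 = (3 / 2 : ℝ) := Real.sq_sqrt (by norm_num)
    have e63 : √6 * √(3 / 2) = 3 := by
      rw [← Real.sqrt_mul (by norm_num), show (6 * (3 / 2) : ℝ) = 3 ^ 2 by norm_num,
        Real.sqrt_sq (by norm_num)]
    have eh : 2 * hPlus t ^ 2 / t = 1 + 3 * coupling t := by
      rw [mul_div_assoc, hPlus_sq_div ht]; ring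
    have ec : 3 * √6 * hPlus t / t = 3 * √6 * coupling t := by rw [mul_div_assoc, coupling]
    rw [hode, eh, ec, mul_pow, e32]
    generalize W (‖x‖ ^ 2) = w
    -- The only irrational relation needed: it matches the quadratic term of the tensor equations
    -- with that of the radial one.
    have e6 : √6 = 2 * √(3 / 2) := by
      linear_combination 2 / 3 * √(3 / 2) * e63 - 2 / 3 * √6 * e32
    linear_combination 3 / 2 * w ^ 2 * coupling t * ‖x‖ ^ 2 * quad i j x * e6

theorem gradSq_hedgehog (ht : 0 < t) (hR : 0 < R) (S : IsRadialSolution t R h)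
    (h0 : h 0 = 0) {x : E3} (hx : x ∈ Metric.ball (0 : E3) R) (hx0 : x ≠ 0) :
    gradSq (hedgehog h) x = deriv h ‖x‖ ^ 2 + 6 * h ‖x‖ ^ 2 / ‖x‖ ^ 2 := by
  obtain ⟨W, hW, hev, hprop⟩ := S.hedgehog_eventuallyEq ht hR h0 hx
  obtain ⟨h1, h2, -⟩ := hprop hx0
  have hne : ‖x‖ ≠ 0 := norm_ne_zero_iff.2 hx0
  rw [gradSq_radial_mul_quad hW fun i j => hev.mono fun y hy => hy i j,
    Real.sq_sqrt (by norm_num), h1, h2]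
  field_simp

/-- The prefactor `√(3/2)` normalizes `tr Q² = h²` and `√6 tr Q³ = h³`, so the bulk part is exactly
`f(h)`. -/
theorem ldgDensity_hedgehog (ht : 0 < t) (hR : 0 < R) (S : IsRadialSolution t R h)
    (h0 : h 0 = 0) {x : E3} (hx : x ∈ Metric.ball (0 : E3) R) (hx0 : x ≠ 0) :
    ldgDensity t (hedgehog h) x + bulkConst t =
      deriv h ‖x‖ ^ 2 / 2 + 3 * h ‖x‖ ^ 2 / ‖x‖ ^ 2 + bulk t (h ‖x‖) := by
  have hne : ‖x‖ ≠ 0 := norm_ne_zero_iff.2 hx0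
  set c := √(3 / 2) * (h ‖x‖ / ‖x‖ ^ 2) with hc
  have hA : ∀ i j, hedgehog h x i j = c * quad i j x := fun i j => by
    rw [hedgehog_apply_of_ne_zero h hx0]; ring
  have e32 : √(3 / 2) ^ 2 = (3 / 2 : ℝ) := Real.sq_sqrt (by norm_num)
  have e63 : √6 * √(3 / 2) = 3 := by
    rw [← Real.sqrt_mul (by norm_num), show (6 * (3 / 2) : ℝ) = 3 ^ 2 by norm_num,
      Real.sqrt_sq (by norm_num)]
  have e2 : (hedgehog h x ^ 2).trace = h ‖x‖ ^ 2 := by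
    rw [trace_sq_of_quad hA, hc, mul_pow, e32]; field_simp
  have e3 : √6 * hPlus t / t * (hedgehog h x ^ 3).trace = hPlus t / t * h ‖x‖ ^ 3 := by
    have : √6 * √(3 / 2) ^ 3 = 9 / 2 := by linear_combination √(3 / 2) ^ 2 * e63 + 3 * e32
    rw [trace_cube_of_quad hA]
    calc _ = hPlus t / t * (2 / 9 * (√6 * √(3 / 2) ^ 3)) * (h ‖x‖ / ‖x‖ ^ 2 * ‖x‖ ^ 2) ^ 3 := by
          rw [hc]; ring
      _ = _ := by rw [this, div_mul_cancel₀ _ (pow_ne_zero 2 hne)]; ring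
  rw [ldgDensity, S.gradSq_hedgehog ht hR h0 hx hx0, e2, e3, bulk]
  ring

end IsRadialSolution

/-- Integration in polar coordinates of a radial function on a ball in three dimensions. -/
theorem integral_ball_of_radial {R : ℝ} {f : E3 → ℝ} {D : ℝ → ℝ}
    (hf : ∀ x ∈ Metric.ball (0 : E3) R, x ≠ 0 → f x = D ‖x‖)
    (hD : IntegrableOn (fun r => r ^ 2 * D r) (Ioc 0 R)) :
    IntegrableOn f (Metric.ball 0 R) ∧
      ∫ x in Metric.ball (0 : E3) R, f x = 4 * Real.pi * ∫ r in Ioc 0 R, r ^ 2 * D r := by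
  have hdim : Module.finrank ℝ E3 = 3 := by simp
  have hne : ∀ᵐ x : E3, x ≠ 0 := by simp [ae_iff]
  have hae : ∀ᵐ x ∂volume.restrict (Metric.ball (0 : E3) R), D ‖x‖ = f x := by
    filter_upwards [ae_restrict_mem measurableSet_ball, ae_restrict_of_ae hne] with x hx hx0
      using (hf x hx hx0).symm
  have hint : IntegrableOn (fun x : E3 => D ‖x‖) (Metric.ball 0 R) := by
    rw [integrableOn_fun_norm_addHaar, hdim]
    exact hD.mono_set Ioo_subset_Ioc_self
  refine ⟨hint.congr hae, ?_⟩
  have hvol : (volume : Measure E3).real (Metric.ball 0 1) = 4 * Real.pi / 3 := by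
    rw [Measure.real, EuclideanSpace.volume_ball_fin_three]
    simp only [ENNReal.ofReal_one, one_pow, one_mul]
    rw [ENNReal.toReal_ofReal (by positivity)]
    ring
  have h1 : ∫ x in Metric.ball (0 : E3) R, D ‖x‖ =
      ∫ x : E3, (Iio R).indicator D ‖x‖ := by
    rw [← integral_indicator measurableSet_ball]
    refine integral_congr_ae (Eventually.of_forall fun x => ?_)
    by_cases hx : ‖x‖ < R <;> simp [indicator, hx]
  have h2 : ∫ y in Ioi (0 : ℝ), y ^ 2 • (Iio R).indicator D y = ∫ r in Ioc 0 R, r ^ 2 * D r := by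
    have e : (fun y : ℝ => y ^ 2 • (Iio R).indicator D y) =
        (Iio R).indicator fun y => y ^ 2 * D y := by
      ext y
      by_cases hy : y < R <;> simp [hy]
    rw [e, integral_indicator measurableSet_Iio, Measure.restrict_restrict measurableSet_Iio,
      integral_Ioc_eq_integral_Ioo, inter_comm, Ioi_inter_Iio]
  rw [← integral_congr_ae hae, h1, integral_fun_norm_addHaar volume, hdim, hvol, h2, nsmul_eq_mul,
    smul_eq_mul]
  push_cast
  ring

/-- Polar coordinates turn the radial bound `3R` into `4π · 3R`. -/
theorem IsGlobalMinimizer.energy_bounds {t R : ℝ} (ht : 0 < t) (hR : 0 < R) {h : ℝ → ℝ}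
    (H : IsGlobalMinimizer t R h) :
    IntegrableOn (gradSq (hedgehog h)) (Metric.ball 0 R) ∧
      IntegrableOn (ldgDensity t (hedgehog h)) (Metric.ball 0 R) ∧
      ldgEnergy t R (hedgehog h) ≤ 12 * Real.pi * R ∧
      ∫ x in Metric.ball (0 : E3) R, (ldgDensity t (hedgehog h) x + bulkConst t) ≤
        12 * Real.pi * R := by
  obtain ⟨S, h0, -, hi1, hi2, hle⟩ := H.properties ht hR
  have hc := (S.analyticOn ht hR h0).continuousOn
  have hsq : IntegrableOn (fun r => 6 * h r ^ 2) (Ioc 0 R) :=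
    (continuousOn_const.mul (hc.pow 2)).integrableOn_Icc.mono_set Ioc_subset_Icc_self
  have hgrad := integral_ball_of_radial (R := R)
    (D := fun r => deriv h r ^ 2 + 6 * h r ^ 2 / r ^ 2)
    (fun x hx hx0 => S.gradSq_hedgehog ht hR h0 hx hx0)
    ((hi1.add hsq).congr_fun (fun r hr => by
      have := hr.1.ne'
      simp only [Pi.add_apply]
      field_simp) measurableSet_Ioc)
  have hEq : EqOn (fun r => (r * deriv h r) ^ 2 / 2 + potential t r (h r))
      (fun r => r ^ 2 * (deriv h r ^ 2 / 2 + 3 * h r ^ 2 / r ^ 2 + bulk t (h r))) (Ioc 0 R) := by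
    intro r hr
    have := hr.1.ne'
    simp only [potential]
    field_simp
    ring
  have hsum : IntegrableOn (fun r => (r * deriv h r) ^ 2 / 2 + potential t r (h r)) (Ioc 0 R) :=
    (hi1.div_const 2).add hi2
  have hden := integral_ball_of_radial (R := R)
    (D := fun r => deriv h r ^ 2 / 2 + 3 * h r ^ 2 / r ^ 2 + bulk t (h r))
    (fun x hx hx0 => S.ldgDensity_hedgehog ht hR h0 hx hx0)
    (hsum.congr_fun hEq measurableSet_Ioc)
  have hconst : IntegrableOn (fun _ : E3 => bulkConst t) (Metric.ball 0 R) :=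
    integrableOn_const measure_ball_lt_top.ne
  have hd : IntegrableOn (ldgDensity t (hedgehog h)) (Metric.ball 0 R) :=
    (hden.1.sub hconst).congr (Eventually.of_forall fun x => by simp)
  have hbound : ∫ x in Metric.ball (0 : E3) R, (ldgDensity t (hedgehog h) x + bulkConst t) ≤
      12 * Real.pi * R := by
    rw [hden.2, ← setIntegral_congr_fun measurableSet_Ioc hEq, integral_add (hi1.div_const 2) hi2,
      integral_div]
    nlinarith [Real.pi_pos]
  refine ⟨hgrad.1, hd, le_trans ?_ hbound, hbound⟩
  -- Dropping the constant only lowers the energy, because `C(t) > 0`.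
  exact integral_mono hd hden.1 fun x => by simp [(bulkConst_pos ht).le]

end Hedgehog

/-! ### Stationarity of the Landau–de Gennes energy. -/

namespace Hedgehog

open Filter Topology

theorem integrable_of_eq_zero_off_compact {f : E3 → ℝ} {K U : Set E3} (hK : IsCompact K)
    (hKU : K ⊆ U) (hf : ContinuousOn f U) (h0 : ∀ x ∉ K, f x = 0) : Integrable f :=
  ((hf.mono hKU).integrableOn_compact hK).integrable_of_forall_notMem_eq_zero h0

/-- The partial derivative `∂ₖ A_ij` of a matrix field. -/
noncomputable def partialDeriv (A : E3 → M3) (i j k : Fin 3) (x : E3) : ℝ :=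
  fderiv ℝ (fun y => A y i j) x (EuclideanSpace.single k 1)

/-- The pointwise inner product `∑ ∂ₖ Q_ij ∂ₖ V_ij` of two gradients. -/
noncomputable def gradInner (Q V : E3 → M3) (x : E3) : ℝ :=
  ∑ i, ∑ j, ∑ k, partialDeriv Q i j k x * partialDeriv V i j k x

theorem gradInner_self (Q : E3 → M3) (x : E3) : gradInner Q Q x = gradSq Q x := by
  simp only [gradInner, gradSq, partialDeriv, sq]

theorem gradSq_add_smul {Q V : E3 → M3} {x : E3}
    (hQ : ∀ i j, DifferentiableAt ℝ (fun y => Q y i j) x)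
    (hV : ∀ i j, DifferentiableAt ℝ (fun y => V y i j) x) (s : ℝ) :
    gradSq (fun y => Q y + s • V y) x =
      gradSq Q x + 2 * s * gradInner Q V x + s ^ 2 * gradSq V x := by
  have h : ∀ i j k, partialDeriv (fun y => Q y + s • V y) i j k x =
      partialDeriv Q i j k x + s * partialDeriv V i j k x := by
    intro i j k
    have e := (hQ i j).hasFDerivAt.add ((hV i j).hasFDerivAt.const_mul s)
    have e' : fderiv ℝ (fun y => (Q y + s • V y) i j) x = _ := e.fderiv
    rw [partialDeriv, e']
    simp [partialDeriv]
  simp only [← gradInner_self]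
  simp only [gradInner, h, Finset.mul_sum, ← Finset.sum_add_distrib]
  refine Finset.sum_congr rfl fun i _ => Finset.sum_congr rfl fun j _ =>
    Finset.sum_congr rfl fun k _ => by ring

theorem trace_sq_add_smul (A B : M3) (s : ℝ) :
    ((A + s • B) ^ 2).trace =
      (A ^ 2).trace + 2 * s * (A * B).trace + s ^ 2 * (B ^ 2).trace := by
  have h : (A + s • B) ^ 2 = A ^ 2 + s • (A * B) + s • (B * A) + s ^ 2 • B ^ 2 := by
    simp only [sq, add_mul, mul_add, smul_mul_assoc, mul_smul_comm, smul_add, smul_smul]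
    abel
  simp only [h, Matrix.trace_add, Matrix.trace_smul, smul_eq_mul, Matrix.trace_mul_comm B A]
  ring

theorem trace_cube_add_smul (A B : M3) (s : ℝ) :
    ((A + s • B) ^ 3).trace = (A ^ 3).trace + 3 * s * (A * A * B).trace
      + 3 * s ^ 2 * (A * B * B).trace + s ^ 3 * (B ^ 3).trace := by
  have h : (A + s • B) ^ 3 = A ^ 3 + s • (A * A * B + A * B * A + B * A * A)
      + s ^ 2 • (A * B * B + B * A * B + B * B * A) + s ^ 3 • B ^ 3 := by
    simp only [pow_succ, pow_zero, one_mul, add_mul, mul_add, smul_mul_assoc, mul_smul_comm,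
      smul_add, smul_smul, mul_assoc]
    abel
  have h1 : (A * B * A).trace = (A * A * B).trace := by
    rw [Matrix.trace_mul_comm, ← mul_assoc]
  have h2 : (B * A * A).trace = (A * A * B).trace := by
    rw [mul_assoc, Matrix.trace_mul_comm]
  have h3 : (B * A * B).trace = (A * B * B).trace := by
    rw [mul_assoc, Matrix.trace_mul_comm]
  have h4 : (B * B * A).trace = (A * B * B).trace := by
    rw [Matrix.trace_mul_comm, ← mul_assoc]
  simp only [h, Matrix.trace_add, Matrix.trace_smul, smul_eq_mul, h1, h2, h3, h4]
  ring

/-- The bulk part of the first variation of the Landau–de Gennes density. -/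
noncomputable def bulkVariation (t : ℝ) (A B : M3) : ℝ :=
  -(A * B).trace - 3 * (√6 * hPlus t / t) * (A * A * B).trace
    + 4 * (hPlus t ^ 2 / (2 * t)) * (A ^ 2).trace * (A * B).trace

/-- The bulk part of the second-order coefficient of the Landau–de Gennes density. -/
noncomputable def bulkVariation₂ (t : ℝ) (A B : M3) : ℝ :=
  -(B ^ 2).trace / 2 - 3 * (√6 * hPlus t / t) * (A * B * B).trace
    + hPlus t ^ 2 / (2 * t) * (4 * (A * B).trace ^ 2 + 2 * (A ^ 2).trace * (B ^ 2).trace)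

/-- The third-order coefficient of the Landau–de Gennes density. -/
noncomputable def bulkVariation₃ (t : ℝ) (A B : M3) : ℝ :=
  -(√6 * hPlus t / t) * (B ^ 3).trace
    + 4 * (hPlus t ^ 2 / (2 * t)) * (A * B).trace * (B ^ 2).trace

/-- The fourth-order coefficient of the Landau–de Gennes density. -/
noncomputable def bulkVariation₄ (t : ℝ) (B : M3) : ℝ :=
  hPlus t ^ 2 / (2 * t) * (B ^ 2).trace ^ 2

/-- The density is a quartic in `s`, so the first variation is a coefficient and no limit has to be
exchanged with the integral. -/
theorem ldgDensity_add_smul (t : ℝ) {Q V : E3 → M3} {x : E3}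
    (hQ : ∀ i j, DifferentiableAt ℝ (fun y => Q y i j) x)
    (hV : ∀ i j, DifferentiableAt ℝ (fun y => V y i j) x) (s : ℝ) :
    ldgDensity t (fun y => Q y + s • V y) x =
      ldgDensity t Q x + s * (gradInner Q V x + bulkVariation t (Q x) (V x))
        + s ^ 2 * (gradSq V x / 2 + bulkVariation₂ t (Q x) (V x))
        + s ^ 3 * bulkVariation₃ t (Q x) (V x) + s ^ 4 * bulkVariation₄ t (V x) := by
  simp only [ldgDensity, gradSq_add_smul hQ hV, trace_sq_add_smul, trace_cube_add_smul,
    bulkVariation, bulkVariation₂, bulkVariation₃, bulkVariation₄]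
  ring

theorem continuousOn_matrix {Q : E3 → M3} {U : Set E3}
    (hQ : ∀ i j, ContinuousOn (fun y => Q y i j) U) : ContinuousOn Q U :=
  continuousOn_pi.2 fun i => continuousOn_pi.2 fun j => hQ i j

theorem continuousOn_comp₂ {F : M3 → M3 → ℝ} (hF : Continuous fun p : M3 × M3 => F p.1 p.2)
    {A B : E3 → M3} {U : Set E3} (hA : ContinuousOn A U) (hB : ContinuousOn B U) :
    ContinuousOn (fun x => F (A x) (B x)) U :=
  hF.comp_continuousOn (hA.prodMk hB)

theorem continuous_bulkVariation (t : ℝ) :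
    Continuous fun p : M3 × M3 => bulkVariation t p.1 p.2 := by
  unfold bulkVariation; fun_prop

theorem continuous_bulkVariation₂ (t : ℝ) :
    Continuous fun p : M3 × M3 => bulkVariation₂ t p.1 p.2 := by
  unfold bulkVariation₂; fun_prop

theorem continuous_bulkVariation₃ (t : ℝ) :
    Continuous fun p : M3 × M3 => bulkVariation₃ t p.1 p.2 := by
  unfold bulkVariation₃; fun_prop

theorem continuous_bulkVariation₄ (t : ℝ) :
    Continuous fun p : M3 × M3 => bulkVariation₄ t p.2 := by
  unfold bulkVariation₄; fun_prop

theorem continuousOn_partialDeriv {A : E3 → M3} {U : Set E3} (hU : IsOpen U)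
    (hA : ∀ i j, ContDiffOn ℝ 2 (fun y => A y i j) U) (i j k : Fin 3) :
    ContinuousOn (partialDeriv A i j k) U :=
  ((hA i j).continuousOn_fderiv_of_isOpen hU (by norm_num)).clm_apply continuousOn_const

theorem contDiffOn_partialDeriv {A : E3 → M3} {U : Set E3} (hU : IsOpen U)
    (hA : ∀ i j, ContDiffOn ℝ 2 (fun y => A y i j) U) (i j k : Fin 3) :
    ContDiffOn ℝ 1 (partialDeriv A i j k) U :=
  ((hA i j).fderiv_of_isOpen hU (m := 1) (by norm_num)).clm_apply contDiffOn_const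

theorem continuousOn_gradInner {A B : E3 → M3} {U : Set E3} (hU : IsOpen U)
    (hA : ∀ i j, ContDiffOn ℝ 2 (fun y => A y i j) U)
    (hB : ∀ i j, ContDiffOn ℝ 2 (fun y => B y i j) U) :
    ContinuousOn (gradInner A B) U :=
  continuousOn_finsetSum _ fun i _ => continuousOn_finsetSum _ fun j _ =>
    continuousOn_finsetSum _ fun k _ =>
      (continuousOn_partialDeriv hU hA i j k).mul (continuousOn_partialDeriv hU hB i j k)

/-- On a solution of the Euler–Lagrange equations the bulk part of the first variation is
`∑ V_ij Δ Q_ij`. -/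
theorem IsClassicalSolution.bulkVariation_eq {t R : ℝ} {Q : E3 → M3}
    (hQ : IsClassicalSolution t R Q) {x : E3} (hx : x ∈ Metric.ball (0 : E3) R) {B : M3}
    (hB : IsQTensor B) :
    bulkVariation t (Q x) B = ∑ i, ∑ j, (Δ (fun y => Q y i j)) x * B i j := by
  simp only [hQ.eulerLagrange x hx]
  have hs : ∀ i j, B j i = B i j := fun i j => hB.1.apply i j
  have htr := hB.2
  simp only [Matrix.trace_fin_three] at htr
  -- Tracelessness of the variation removes the Lagrange multiplier term `δ_ij tr Q²/3`.
  have h22 : B 2 2 = -B 0 0 - B 1 1 := by linarith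
  simp only [bulkVariation, sq, Matrix.trace_fin_three, Matrix.mul_apply, Fin.sum_univ_three,
    Matrix.one_apply, hs 0 1, hs 0 2, hs 1 2, h22]
  simp
  ring

/-- Integration by parts on the whole space. `A` need only be regular on `U`, since outside the
support of `B` every product vanishes. -/
theorem integral_partialDeriv_mul {U : Set E3} (hU : IsOpen U) {A B : E3 → M3}
    (hA : ∀ i j, ContDiffOn ℝ 2 (fun y => A y i j) U)
    (hB : ∀ i j, ContDiff ℝ ∞ (fun y => B y i j))
    (hc : ∀ i j, HasCompactSupport (fun y => B y i j))
    (hsub : ∀ i j, tsupport (fun y => B y i j) ⊆ U) (i j k : Fin 3) :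
    Integrable (fun x => partialDeriv A i j k x * partialDeriv B i j k x +
      fderiv ℝ (partialDeriv A i j k) x (EuclideanSpace.single k 1) * B x i j) ∧
    ∫ x, (partialDeriv A i j k x * partialDeriv B i j k x +
      fderiv ℝ (partialDeriv A i j k) x (EuclideanSpace.single k 1) * B x i j) = 0 := by
  have hz : ∀ x ∉ tsupport (fun y => B y i j), B x i j = 0 := fun x hx =>
    image_eq_zero_of_notMem_tsupport (f := fun y => B y i j) hx
  have hz' : ∀ x ∉ tsupport (fun y => B y i j), partialDeriv B i j k x = 0 := fun x hx => by
    rw [partialDeriv, fderiv_of_notMem_tsupport ℝ hx]; rfl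
  have hB2 : ∀ i j, ContDiffOn ℝ 2 (fun y => B y i j) U := fun i j =>
    (contDiff_infty.1 (hB i j) 2).contDiffOn
  have hcB : ContinuousOn (fun y => B y i j) U := (hB i j).continuous.continuousOn
  have hdA := contDiffOn_partialDeriv hU hA i j k
  have i1 : Integrable fun x =>
      fderiv ℝ (partialDeriv A i j k) x (EuclideanSpace.single k 1) * B x i j :=
    integrable_of_eq_zero_off_compact (hc i j) (hsub i j)
      (((hdA.continuousOn_fderiv_of_isOpen hU (by norm_num)).clm_apply continuousOn_const).mul hcB)
      fun x hx => by rw [hz x hx, mul_zero]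
  have i2 : Integrable fun x => partialDeriv A i j k x * partialDeriv B i j k x :=
    integrable_of_eq_zero_off_compact (hc i j) (hsub i j)
      (hdA.continuousOn.mul (continuousOn_partialDeriv hU hB2 i j k))
      fun x hx => by rw [hz' x hx, mul_zero]
  have i3 : Integrable fun x => partialDeriv A i j k x * B x i j :=
    integrable_of_eq_zero_off_compact (hc i j) (hsub i j) (hdA.continuousOn.mul hcB)
      fun x hx => by rw [hz x hx, mul_zero]
  have key := integral_mul_fderiv_eq_neg_fderiv_mul_of_integrable (g := fun x => B x i j) i1 i2 i3
    (fun x hx => (hdA.differentiableOn (by norm_num)).differentiableAt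
      (hU.mem_nhds (hsub i j hx)))
    (fun x _ => (hB i j).differentiable (by simp) x)
  refine ⟨i2.add i1, ?_⟩
  rw [integral_add i2 i1]
  change ∫ x, partialDeriv A i j k x * partialDeriv B i j k x = _ at key
  rw [key, neg_add_cancel]

theorem hasDerivAt_quartic (e₀ e₁ e₂ e₃ e₄ : ℝ) :
    HasDerivAt (fun s : ℝ => e₀ + s * e₁ + s ^ 2 * e₂ + s ^ 3 * e₃ + s ^ 4 * e₄) e₁ 0 := by
  have hd := ((((hasDerivAt_const (0 : ℝ) e₀).add ((hasDerivAt_id (0 : ℝ)).mul_const e₁)).add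
    ((hasDerivAt_pow 2 (0 : ℝ)).mul_const e₂)).add ((hasDerivAt_pow 3 (0 : ℝ)).mul_const e₃)).add
    ((hasDerivAt_pow 4 (0 : ℝ)).mul_const e₄)
  exact hd.congr_deriv (by simp)

theorem IsClassicalSolution.isStationary {t R : ℝ} {Q : E3 → M3}
    (hQ : IsClassicalSolution t R Q) (hint : IntegrableOn (ldgDensity t Q) (Metric.ball 0 R)) :
    IsStationary t R Q := by
  intro V hVQ hVs hVc hVsub
  set U : Set E3 := Metric.ball 0 R with hUdef
  have hU : IsOpen U := Metric.isOpen_ball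
  set K : Set E3 := ⋃ i, ⋃ j, tsupport fun x => V x i j with hKdef
  have hK : IsCompact K := isCompact_iUnion fun i => isCompact_iUnion fun j => hVc i j
  have hKU : K ⊆ U := iUnion_subset fun i => iUnion_subset fun j => hVsub i j
  have hnot : ∀ x ∉ K, ∀ i j, x ∉ tsupport fun y => V y i j := fun x hx i j h =>
    hx (mem_iUnion₂.2 ⟨i, j, h⟩)
  have hV0 : ∀ x ∉ K, V x = 0 := fun x hx => by
    ext i j
    exact image_eq_zero_of_notMem_tsupport (f := fun y => V y i j) (hnot x hx i j)
  have hdV0 : ∀ x ∉ K, ∀ i j k, partialDeriv V i j k x = 0 := fun x hx i j k => by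
    rw [partialDeriv, fderiv_of_notMem_tsupport ℝ (hnot x hx i j)]; rfl
  have hV2 : ∀ i j, ContDiffOn ℝ 2 (fun y => V y i j) U := fun i j =>
    (contDiff_infty.1 (hVs i j) 2).contDiffOn
  have hQ2 := hQ.contDiffOn
  have hcQ := continuousOn_matrix fun i j => (hQ2 i j).continuousOn
  have hcV := continuousOn_matrix fun i j => (hV2 i j).continuousOn
  have hb₁ := continuousOn_comp₂ (continuous_bulkVariation t) hcQ hcV
  have hb₂ := continuousOn_comp₂ (continuous_bulkVariation₂ t) hcQ hcV
  have hb₃ := continuousOn_comp₂ (continuous_bulkVariation₃ t) hcQ hcV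
  have hb₄ := continuousOn_comp₂ (F := fun _ B => bulkVariation₄ t B)
    (continuous_bulkVariation₄ t) hcQ hcV
  have hz₁ : ∀ x ∉ K, gradInner Q V x + bulkVariation t (Q x) (V x) = 0 := fun x hx => by
    simp only [gradInner, bulkVariation, hV0 x hx, hdV0 x hx]
    simp
  have hz₂ : ∀ x ∉ K, gradInner V V x / 2 + bulkVariation₂ t (Q x) (V x) = 0 := fun x hx => by
    simp only [gradInner, bulkVariation₂, hV0 x hx, hdV0 x hx]
    simp
  have hz₃ : ∀ x ∉ K, bulkVariation₃ t (Q x) (V x) = 0 := fun x hx => by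
    simp only [bulkVariation₃, hV0 x hx]
    simp
  have hz₄ : ∀ x ∉ K, bulkVariation₄ t (V x) = 0 := fun x hx => by
    simp only [bulkVariation₄, hV0 x hx]
    simp
  have hI1 : Integrable fun x => gradInner Q V x + bulkVariation t (Q x) (V x) :=
    integrable_of_eq_zero_off_compact hK hKU ((continuousOn_gradInner hU hQ2 hV2).add hb₁) hz₁
  have hI2 : Integrable fun x => gradSq V x / 2 + bulkVariation₂ t (Q x) (V x) := by
    simp only [← gradInner_self]
    exact integrable_of_eq_zero_off_compact hK hKU
      (((continuousOn_gradInner hU hV2 hV2).div_const 2).add hb₂) hz₂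
  have hI3 : Integrable fun x => bulkVariation₃ t (Q x) (V x) :=
    integrable_of_eq_zero_off_compact hK hKU hb₃ hz₃
  have hI4 : Integrable fun x => bulkVariation₄ t (V x) :=
    integrable_of_eq_zero_off_compact hK hKU hb₄ hz₄
  have hfirst : ∫ x in U, (gradInner Q V x + bulkVariation t (Q x) (V x)) = 0 := by
    -- On the ball the equations turn the first variation into the divergence sum `∑ ∂ₖ(∂ₖQ_ij
    -- V_ij)`; off the ball both sides vanish, so the identity is global.
    have hpt : ∀ x, gradInner Q V x + bulkVariation t (Q x) (V x) =
        ∑ i, ∑ j, ∑ k, (partialDeriv Q i j k x * partialDeriv V i j k x +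
          fderiv ℝ (partialDeriv Q i j k) x (EuclideanSpace.single k 1) * V x i j) := by
      intro x
      by_cases hx : x ∈ U
      · have hL : ∀ i j, (Δ (fun y => Q y i j)) x =
            ∑ k, fderiv ℝ (partialDeriv Q i j k) x (EuclideanSpace.single k 1) := fun i j =>
          laplacian_eq_sum_fderiv ((hQ2 i j).contDiffAt (hU.mem_nhds hx))
        rw [hQ.bulkVariation_eq hx (hVQ x)]
        simp only [hL, gradInner, Finset.sum_mul, ← Finset.sum_add_distrib]
      · have hx' : x ∉ K := fun h => hx (hKU h)
        rw [hz₁ x hx']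
        simp [hV0 x hx', hdV0 x hx']
    rw [setIntegral_eq_integral_of_forall_compl_eq_zero fun x hx => hz₁ x fun h => hx (hKU h)]
    have hibp := integral_partialDeriv_mul hU hQ2 hVs hVc hVsub
    simp only [hpt]
    rw [integral_finsetSum _ fun i _ => integrable_finsetSum _ fun j _ =>
      integrable_finsetSum _ fun k _ => (hibp i j k).1]
    simp only [integral_finsetSum _ fun j _ => integrable_finsetSum _ fun k _ => (hibp _ j k).1,
      integral_finsetSum _ fun k _ => (hibp _ _ k).1, (hibp _ _ _).2, Finset.sum_const_zero]
  have hE : (fun s : ℝ => ldgEnergy t R fun x => Q x + s • V x) = fun s =>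
      ldgEnergy t R Q + s * 0
        + s ^ 2 * (∫ x in U, (gradSq V x / 2 + bulkVariation₂ t (Q x) (V x)))
        + s ^ 3 * (∫ x in U, bulkVariation₃ t (Q x) (V x))
        + s ^ 4 * ∫ x in U, bulkVariation₄ t (V x) := by
    ext s
    have hq := (integral_quartic (μ := volume.restrict U) hint hI1.integrableOn hI2.integrableOn
      hI3.integrableOn hI4.integrableOn s).2
    rw [hfirst] at hq
    rw [ldgEnergy, ldgEnergy, ← hq]
    exact setIntegral_congr_fun measurableSet_ball fun x hx => ldgDensity_add_smul t
      (fun i j => ((hQ2 i j).contDiffAt (hU.mem_nhds hx)).differentiableAt (by norm_num))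
      (fun i j => (hVs i j).differentiable (by simp) x) s
  rw [hE]
  exact hasDerivAt_quartic _ _ _ _ _

end Hedgehog

/-! ### The main theorem. -/

theorem proposition1 (t R : ℝ) (ht : 1 < t) (hR : 0 < R) :
    -- normalisation of the bulk density
    ((∀ x : ℝ, 0 ≤ Hedgehog.bulk t x) ∧ Hedgehog.bulk t 1 = 0) ∧
    -- existence of a global minimizer
    (∃ h : ℝ → ℝ, Hedgehog.IsGlobalMinimizer t R h) ∧
    -- properties of every global minimizer and of its radial hedgehog
    (∀ h : ℝ → ℝ, Hedgehog.IsGlobalMinimizer t R h →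
      AnalyticOn ℝ h (Set.Icc 0 R) ∧
      (∀ r ∈ Set.Ioo 0 R,
        deriv (deriv h) r + 2 / r * deriv h r - 6 * h r / r ^ 2 =
          -h r + h r ^ 3 + 3 * Hedgehog.hPlus t / t * (h r ^ 3 - h r ^ 2)) ∧
      h 0 = 0 ∧ h R = 1 ∧
      (∀ r ∈ Set.Icc 0 R, 0 ≤ h r ∧ h r ≤ 1) ∧
      Hedgehog.IsClassicalSolution t R (Hedgehog.hedgehog h) ∧
      Hedgehog.IsStationary t R (Hedgehog.hedgehog h) ∧
      -- the hedgehog has finite Dirichlet energy and integrable energy density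
      MeasureTheory.IntegrableOn (Hedgehog.gradSq (Hedgehog.hedgehog h))
        (Metric.ball 0 R) ∧
      MeasureTheory.IntegrableOn (Hedgehog.ldgDensity t (Hedgehog.hedgehog h))
        (Metric.ball 0 R) ∧
      -- the energy bound, without and with the additive constant in the density
      Hedgehog.ldgEnergy t R (Hedgehog.hedgehog h) ≤ 12 * Real.pi * R ∧
      ∫ x in Metric.ball (0 : Hedgehog.E3) R,
        (Hedgehog.ldgDensity t (Hedgehog.hedgehog h) x + Hedgehog.bulkConst t)
          ≤ 12 * Real.pi * R) := by
  have ht0 : 0 < t := one_pos.trans ht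
  refine ⟨⟨Hedgehog.bulk_nonneg ht0, Hedgehog.bulk_one t⟩,
    Hedgehog.exists_isGlobalMinimizer ht0 hR, fun h H => ?_⟩
  obtain ⟨S, h0, hbd, -⟩ := H.properties ht0 hR
  have hC := S.isClassicalSolution ht0 hR h0
  obtain ⟨hg, hd, hle, hle'⟩ := H.energy_bounds ht0 hR
  refine ⟨S.analyticOn ht0 hR h0, fun r hr => ?_, h0, S.boundary, hbd, hC, hC.isStationary hd,
    hg, hd, hle, hle'⟩
  rw [S.euler_lagrange hr]
  unfold Hedgehog.bulkDeriv Hedgehog.coupling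
  ring
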